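/- Let $k$ be a field of characteristic $0$, let $X=\{x_1,x_2,\dots\}$, and let $k\{X\}$ be the free nonassociative unital algebra on $X$, graded by $|x_i|=i$ and made into a unital bialgebra by the unital algebra homomorphism $\Delta$ with $\Delta(x_i)=x_i\otimes 1+1\otimes x_i$ (counit $\epsilon(x_i)=0$). Let $I_n$ be the projection of $k\{X\}$ onto its component of degree $n$, and let the descent algebra $\Sigma=\Sigma^{k\{X\}}$ be the subalgebra of $\operatorname{End}_k(k\{X\})$ generated by $\{I_n\mid n\ge 0\}$ with respect to the convolution product $(f*h)(u)=\sum f(u_{(1)})h(u_{(2)})$. *Compermutations.* A symbol $t\pi$ (of degree $m$) consists of a pseudo-composition $\pi=(\pi_1,\dots,\pi_r)$ of $[m]=\{1,\dots,m\}$ (pairwise disjoint, possibly empty subsets with union $[m]$) and a planar binary rooted tree $t$ with $r$ leaves (the empty tree if $r=0$). Two symbols are equivalent if they become equal after deleting all empty components together with the corresponding leaves; the classes are the compermutations of $[m]$, and they form the set Ϭ$_m$. Let $k[$Ϭ$]=\bigoplus_{m\ge0}k[$Ϭ$_m]$ be the space with basis $\{\mathbf F_{t\pi}\}$ indexed by all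 compermutations. It carries the following operations, where $t\pi$ has degree $m$ and $t'\pi'$ has degree $n$. - Outer product: $\mathbf F_{t\pi}*\mathbf F_{t'\pi'}=\sum_\gamma \mathbf F_{(t\vee t')\,\gamma(\pi_1,\dots,\pi_r,\,m+\pi'_1,\dots,m+\pi'_s)}$, the sum over all permutations $\gamma$ of $[m+n]$ that are increasing on $\{1,\dots,m\}$ and on $\{m+1,\dots,m+n\}$; here $t\vee t'$ is the grafting of trees. - Comultiplication: $\Delta(\mathbf F_{t\pi})=\sum_{p=0}^m \mathbf F_{t\,\pi|_{\{1,\dots,p\}}}\otimes \mathbf F_{t\,\mathrm{st}(\pi|_{\{p+1,\dots,m\}})}$, where $\pi|_B=(\pi_1\cap B,\dots,\pi_r\cap B)$ and $\mathrm{st}$ subtracts $p$ from every element. - The unit is the class of the empty symbol, and the counit is the projection onto $k[$Ϭ$_0]=k$. - Opposite inner product: $\mathbf F_{t\pi}\bullet\mathbf F_{t'\pi'}=0$ if $m\ne n$, and if $m=n$ it equals $\mathbf F_{t(t')\,(\sigma(\pi_1)\cap\pi'_1,\dots,\sigma(\pi_1)\cap\pi'_s,\dots,\sigma(\pi_r)\cap\pi'_1,\dots,\sigma(\pi_r)\cap\pi'_s)}$.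 Here $t(t')$ has a copy of $t'$ in each leaf of $t$, and $\sigma=\sigma^{\pi'}$ is the permutation whose one-line notation lists the elements of $\pi'_1$ in increasing order, then those of $\pi'_2$ in increasing order, and so on. *Solomon algebra.* For a composition $I=(i_1,\dots,i_r)$ of $m$ (all $i_j>0$) and a tree $t$ with $r$ leaves put $D^t_{\le I}=\sum_{(|\pi_1|,\dots,|\pi_r|)=I}\mathbf F_{t\pi}$. Let $\mathrm{sol}($Ϭ$)\subseteq k[$Ϭ$]$ be the span of all these elements, for all $m,r\ge 0$. *Claim.* 1. $\mathrm{sol}($Ϭ$)$ is a unital bialgebra under the operations $*$ and $\Delta$ of $k[$Ϭ$]$, and it is closed under $\bullet$. 2. $\Sigma$ is closed under composition, and $(\Sigma,*)$ is a unital bialgebra with a comultiplication satisfying $\Delta(I_m)=\sum_{i+j=m}I_i\otimes I_j$ for all $m$. This comultiplication is the one transported from $k\{X\}$ in the following way. Let $g=\sum_n g_n$ be any base for logarithms, i.e. a group-like formal nonassociative power series in one primitive variable $x$ with $g_n$ homogeneous of degree $n$ and $g_1\neq0$. There is a unique $L\in\operatorname{End}_k(k\{X\})$ with $L(1)=0$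 and $\sum_n g_n^*(L)=\mathrm{Id}$ ($g_n^*$ denotes evaluation of $g_n$ with respect to $*$), and $x_i\mapsto I_i\circ g_1^*(L)$ $(i\ge1)$ defines an isomorphism of bialgebras $(k\{X\},\cdot,\Delta)\to(\Sigma,*,\Delta)$. 3. There are isomorphisms of unital bialgebras $$(\mathrm{sol}(Ϭ),*,\Delta)\;\cong\;(\Sigma,*,\Delta)\;\cong\;(k\{X\},\cdot,\Delta).$$ 4. Moreover $(\mathrm{sol}($Ϭ$),\bullet)\cong(\Sigma,\circ)$, where $\circ$ is composition of linear maps; indeed one and the same linear isomorphism $\mathrm{sol}($Ϭ$)\to\Sigma$ is an isomorphism of bialgebras for $(*,\Delta)$ and carries $\bullet$ to $\circ$. -/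

import Mathlib

open scoped TensorProduct

noncomputable section

namespace NonassocDescent

/-! ### Planar binary rooted trees with labelled leaves -/

/-- Planar binary rooted trees with leaves labelled by `X`, including the empty tree `1`.
This is the free unital magma on `X`: the product is grafting, and its elements are the
nonassociative words (monomials) in the alphabet `X`.
Unlabelled trees are the elements of `PTree Unit`. A tree `t` with `r` leaves together with an
`r`-tuple `(a₁, …, a_r)` is the same thing as one labelled tree, with `shape = t` and
`leaves = [a₁, …, a_r]` (see `PTree.ext_shape_leaves`). -/
abbrev PTree (X : Type*) := WithOne (FreeMagma X)

namespace PTree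

variable {X Y : Type*}

/-- The tree with a single leaf, labelled by `x`. -/
def leaf (x : X) : PTree X := (FreeMagma.of x : FreeMagma X)

/-- Evaluation of a nonempty tree in a set with a binary operation. -/
def evalAux {V : Type*} (mul : V → V → V) (f : X → V) : FreeMagma X → V
  | .of x => f x
  | .mul a b => mul (evalAux mul f a) (evalAux mul f b)

/-- Evaluation of a tree: the leaf labelled `x` is replaced by `f x`, the vertices are read as the
binary operation `mul`, and the empty tree is sent to `one`. -/
def eval {V : Type*} (mul : V → V → V) (one : V) (f : X → V) (w : PTree X) : V :=
  WithOne.recOneCoe (motive := fun _ => V) one (evalAux mul f) w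

/-- The labels of the leaves, from left to right. -/
def leaves (w : PTree X) : List X := eval (· ++ ·) [] (fun x => [x]) w

/-- Substitution: every leaf labelled `x` is replaced by the tree `f x`, whose root is identified
with the leaf. When `f x` is the empty tree the leaf is removed. -/
def subst (f : X → PTree Y) (w : PTree X) : PTree Y := eval (· * ·) 1 f w

/-- Relabelling of the leaves. -/
def map (f : X → Y) (w : PTree X) : PTree Y := subst (fun x => leaf (f x)) w

/-- The underlying unlabelled tree. -/
def shape (w : PTree X) : PTree Unit := map (fun _ => ()) w

lemma eval_mul {V : Type*} (mul : V → V → V) (one : V) (f : X → V)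
    (h1 : ∀ a, mul one a = a) (h2 : ∀ a, mul a one = a) (w v : PTree X) :
    eval mul one f (w * v) = mul (eval mul one f w) (eval mul one f v) := by
  induction w using WithOne.recOneCoe with
  | one => rw [one_mul]; exact (h1 _).symm
  | coe a =>
    induction v using WithOne.recOneCoe with
    | one => rw [mul_one]; exact (h2 _).symm
    | coe b => rfl

@[simp] lemma leaves_one : leaves (1 : PTree X) = [] := rfl

@[simp] lemma leaves_leaf (x : X) : leaves (leaf x) = [x] := rfl

@[simp] lemma leaves_mul (w v : PTree X) : leaves (w * v) = leaves w ++ leaves v :=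
  eval_mul _ _ _ (fun _ => rfl) (fun a => List.append_nil a) w v

@[simp] lemma subst_mul (f : X → PTree Y) (w v : PTree X) :
    subst f (w * v) = subst f w * subst f v :=
  eval_mul _ _ _ (fun a => one_mul a) (fun a => mul_one a) w v

/-- Induction on trees: the empty tree, one leaf, grafting of two trees. -/
lemma induction_on {P : PTree X → Prop} (w : PTree X) (h1 : P 1) (hl : ∀ x, P (leaf x))
    (hm : ∀ a b, P a → P b → P (a * b)) : P w := by
  induction w using WithOne.recOneCoe with
  | one => exact h1
  | coe a =>
    induction a using FreeMagma.rec with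
    | of x => exact hl x
    | mul a b iha ihb => exact hm _ _ iha ihb

@[simp] lemma leaves_subst (f : X → PTree Y) (w : PTree X) :
    leaves (subst f w) = (leaves w).flatMap (fun x => leaves (f x)) := by
  induction w using induction_on with
  | h1 => rfl
  | hl x => simp [subst, eval, leaf, evalAux, leaves]
  | hm a b iha ihb => simp [iha, ihb]

@[simp] lemma leaves_map (f : X → Y) (w : PTree X) : leaves (map f w) = (leaves w).map f := by
  simp only [map, leaves_subst, leaves_leaf]
  exact List.flatMap_pure_eq_map f _

lemma length_evalAux (a b : FreeMagma X)
    (h : evalAux (· * ·) (fun _ => FreeMagma.of ()) a =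
      evalAux (· * ·) (fun _ => FreeMagma.of ()) b) :
    (evalAux (· ++ ·) (fun x => [x]) a).length = (evalAux (· ++ ·) (fun x => [x]) b).length := by
  induction a using FreeMagma.rec generalizing b with
  | of x => cases b with
    | of y => rfl
    | mul b c => cases h
  | mul a a' ih ih' => cases b with
    | of y => cases h
    | mul b b' =>
      change FreeMagma.mul _ _ = FreeMagma.mul _ _ at h
      injection h with h1 h2
      simp only [evalAux, List.length_append, ih b h1, ih' b' h2]

lemma evalAux_ext (a b : FreeMagma X)
    (h : evalAux (· * ·) (fun _ => FreeMagma.of ()) a =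
      evalAux (· * ·) (fun _ => FreeMagma.of ()) b)
    (hl : evalAux (· ++ ·) (fun x => [x]) a = evalAux (· ++ ·) (fun x => [x]) b) : a = b := by
  induction a using FreeMagma.rec generalizing b with
  | of x => cases b with
    | of y => exact congrArg _ (List.singleton_injective hl)
    | mul b c => cases h
  | mul a a' ih ih' => cases b with
    | of y => cases h
    | mul b b' =>
      change FreeMagma.mul _ _ = FreeMagma.mul _ _ at h
      injection h with h1 h2
      have hl' := List.append_inj hl (length_evalAux a b h1)
      rw [ih b h1 hl'.1, ih' b' h2 hl'.2]

lemma shape_coe (a : FreeMagma X) :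
    shape (a : PTree X) = ((evalAux (· * ·) (fun _ => FreeMagma.of ()) a : FreeMagma Unit)) := by
  change evalAux _ _ a = _
  induction a using FreeMagma.rec with
  | of x => rfl
  | mul a b iha ihb => simp only [evalAux, iha, ihb]; rfl

/-- A labelled tree is determined by its shape and the sequence of its labels. -/
theorem ext_shape_leaves (w v : PTree X) (hs : shape w = shape v) (hl : leaves w = leaves v) :
    w = v := by
  induction w using WithOne.recOneCoe with
  | one =>
    induction v using WithOne.recOneCoe with
    | one => rfl
    | coe b => rw [shape_coe] at hs; exact absurd hs.symm (WithOne.coe_ne_one)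
  | coe a =>
    induction v using WithOne.recOneCoe with
    | one => rw [shape_coe] at hs; exact absurd hs (WithOne.coe_ne_one)
    | coe b =>
      rw [shape_coe, shape_coe] at hs
      exact congrArg _ (evalAux_ext a b (WithOne.coe_injective hs) hl)

end PTree

/-! ### Nonassociative unital bialgebras -/

/-- The operations of a (not necessarily associative) unital bialgebra on the space `V`. -/
structure BialgData (k V : Type*) [Field k] [AddCommGroup V] [Module k V] where
  mul : V →ₗ[k] V →ₗ[k] V
  one : V
  comul : V →ₗ[k] V ⊗[k] V
  counit : V →ₗ[k] k

namespace BialgData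

variable {k V W : Type*} [Field k] [AddCommGroup V] [Module k V] [AddCommGroup W] [Module k W]

/-- The axioms of a unital bialgebra: `V` is a unital algebra and a coalgebra (with counit), and
the comultiplication and the counit are morphisms of unital algebras. Neither associativity nor
coassociativity is part of the axioms. -/
structure IsBialgebra (B : BialgData k V) : Prop where
  one_mul : ∀ u, B.mul B.one u = u
  mul_one : ∀ u, B.mul u B.one = u
  counit_left : ∀ u, TensorProduct.lid k V (TensorProduct.map B.counit LinearMap.id (B.comul u)) = u
  counit_right : ∀ u,
    TensorProduct.rid k V (TensorProduct.map LinearMap.id B.counit (B.comul u)) = u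
  comul_mul : ∀ u v,
    B.comul (B.mul u v) = TensorProduct.map₂ B.mul B.mul (B.comul u) (B.comul v)
  comul_one : B.comul B.one = B.one ⊗ₜ[k] B.one
  counit_mul : ∀ u v, B.counit (B.mul u v) = B.counit u * B.counit v
  counit_one : B.counit B.one = 1

/-- Homomorphisms of unital bialgebras. -/
structure IsHom (B : BialgData k V) (C : BialgData k W) (f : V →ₗ[k] W) : Prop where
  map_one : f B.one = C.one
  map_mul : ∀ u v, f (B.mul u v) = C.mul (f u) (f v)
  map_comul : ∀ u, C.comul (f u) = TensorProduct.map f f (B.comul u)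
  map_counit : ∀ u, C.counit (f u) = B.counit u

/-- The convolution product `f * h : u ↦ ∑ f(u₍₁₎) h(u₍₂₎)` of linear endomorphisms. -/
def conv (B : BialgData k V) (f h : V →ₗ[k] V) : V →ₗ[k] V :=
  TensorProduct.lift B.mul ∘ₗ TensorProduct.map f h ∘ₗ B.comul

/-- The map `ε 1 : u ↦ ε(u) 1`, the unit of the convolution product. -/
def convOne (B : BialgData k V) : V →ₗ[k] V := B.counit.smulRight B.one

/-- The subalgebra of `(End V, *)` generated by a sequence of endomorphisms `I n`; when `B` is graded
and `I n` is the projection on the component of degree `n`, this is the descent algebra of `B`. -/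
def descent (B : BialgData k V) (I : ℕ → V →ₗ[k] V) : Submodule k (V →ₗ[k] V) :=
  sInf {W | (∀ n, I n ∈ W) ∧ ∀ f ∈ W, ∀ h ∈ W, B.conv f h ∈ W}

lemma proj_mem_descent (B : BialgData k V) (I : ℕ → V →ₗ[k] V) (n : ℕ) : I n ∈ B.descent I :=
  (Submodule.mem_sInf).2 fun _ hW => hW.1 n

end BialgData

/-! ### The free nonassociative unital algebra -/

section Free

variable (k : Type*) [Field k] (X : Type*)

/-- The free nonassociative unital algebra `k{X}`: it has the nonassociative words as basis. -/
abbrev FreeNA := MonoidAlgebra k (PTree X)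

variable {X} in
/-- Evaluation of a nonassociative polynomial `p` in a space with a bilinear product `mul` and an
element `one`, the variable `x` being replaced by `f x`. -/
def FreeNA.eval {V : Type*} [AddCommGroup V] [Module k V] (mul : V → V → V) (one : V) (f : X → V) :
    FreeNA k X →ₗ[k] V :=
  (MonoidAlgebra.basis (PTree X) k).constr k (PTree.eval mul one f)

variable {X} in
/-- The generator `x` of `k{X}`. -/
def FreeNA.gen (x : X) : FreeNA k X := MonoidAlgebra.single (PTree.leaf x) 1

/-- The bialgebra `k{X}`: the comultiplication and the counit are the unital algebra homomorphisms
with `Δ x = x ⊗ 1 + 1 ⊗ x` and `ε x = 0` for the generators `x`. -/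
def freeBialg : BialgData k (FreeNA k X) where
  mul := LinearMap.mul k (FreeNA k X)
  one := 1
  comul := FreeNA.eval k (fun u v => u * v) 1
    (fun x => FreeNA.gen k x ⊗ₜ[k] 1 + 1 ⊗ₜ[k] FreeNA.gen k x)
  counit := FreeNA.eval k (fun u v => u * v) 1 (fun _ => 0)

variable {X} in
/-- The projection of `k{X}` on its component of degree `n`, where the generator `x` has degree
`d x` and the degree of a word is the sum of the degrees of its letters. -/
def FreeNA.proj (d : X → ℕ) (n : ℕ) : FreeNA k X →ₗ[k] FreeNA k X :=
  (MonoidAlgebra.basis (PTree X) k).constr k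
    (fun w => if (w.leaves.map d).sum = n then MonoidAlgebra.single w 1 else 0)

/-- `k{X}` for `X = {x₁, x₂, …}`. -/
abbrev KX := FreeNA k ℕ+

/-- The bialgebra `k{X}` for `X = {x₁, x₂, …}`. -/
abbrev kxBialg : BialgData k (KX k) := freeBialg k ℕ+

/-- The projection `I_n` of `k{X}` on its component of degree `n`, for the grading `|x_i| = i`. -/
def degProj (n : ℕ) : KX k →ₗ[k] KX k := FreeNA.proj k (fun i : ℕ+ => (i : ℕ)) n

/-- The descent algebra `Σ` of the graded bialgebra `k{X}`. -/
def descentAlgebra : Submodule k (KX k →ₗ[k] KX k) := (kxBialg k).descent (degProj k)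

/-- `I_n` as an element of the descent algebra. -/
def degProjMem (n : ℕ) : descentAlgebra k :=
  ⟨degProj k n, (kxBialg k).proj_mem_descent (degProj k) n⟩

variable {k}

/-- `g = ∑ g_n` is a base for logarithms: a group-like formal power series in one nonassociative
variable `x`, with `g_n` homogeneous of degree `n` and `g_1 ≠ 0`. -/
structure IsLogBase (g : ℕ → FreeNA k Unit) : Prop where
  homogeneous : ∀ n, FreeNA.proj k (fun _ => 1) n (g n) = g n
  counit_eq : (freeBialg k Unit).counit (g 0) = 1
  comul_eq : ∀ n, (freeBialg k Unit).comul (g n) =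
    ∑ ij ∈ Finset.HasAntidiagonal.antidiagonal n, g ij.1 ⊗ₜ[k] g ij.2
  ne_zero : g 1 ≠ 0

/-- `p^*(f)`: the nonassociative polynomial `p(x)` evaluated at `f` for the convolution product on
the endomorphisms of `k{X}`. -/
def convEval (p : FreeNA k Unit) (f : KX k →ₗ[k] KX k) : KX k →ₗ[k] KX k :=
  FreeNA.eval k (kxBialg k).conv (kxBialg k).convOne (fun _ => f) p

/-- `L` is the convolution logarithm to the base `g` of the identity map: `L 1 = 0` and
`∑ g_n^*(L) = Id`, the sum being finite on every element. -/
def IsConvLog (g : ℕ → FreeNA k Unit) (L : KX k →ₗ[k] KX k) : Prop :=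
  L 1 = 0 ∧ ∀ u, ∀ᶠ N in Filter.atTop, ∑ n ∈ Finset.range N, convEval (g n) L u = u

end Free

/-! ### Compermutations -/

/-- A symbol `tπ`, with `π` a pseudo-composition of `{1, …, m}` (modelled by `Fin m`) and `t` a
planar binary rooted tree with one leaf for each component of `π`: a tree with leaves labelled by
subsets of `Fin m` such that every element belongs to exactly one label. -/
@[ext] structure Symb (m : ℕ) where
  tree : PTree (Finset (Fin m))
  mem_one : ∀ i, tree.leaves.countP (fun A => decide (i ∈ A)) = 1

/-- Compermutations of `{1, …, m}`: every class of symbols `tπ` is represented by its unique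
reduced form, in which no component of `π` is empty (see `Symb.reduce_eq_iff`). -/
@[ext] structure Comperm (m : ℕ) where
  symb : Symb m
  reduced : ∀ A ∈ symb.tree.leaves, A.Nonempty

namespace Symb

variable {m n : ℕ}

open scoped Classical in
/-- Removal of the leaves labelled by the empty set. -/
def prune (w : PTree (Finset (Fin m))) : PTree (Finset (Fin m)) :=
  w.subst (fun A => if A.Nonempty then PTree.leaf A else 1)

open scoped Classical in
lemma leaves_prune (w : PTree (Finset (Fin m))) :
    (prune w).leaves = w.leaves.filter (fun A => decide A.Nonempty) := by
  rw [prune, PTree.leaves_subst]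
  generalize w.leaves = l
  induction l with
  | nil => rfl
  | cons A l ih =>
    rw [List.flatMap_cons, ih, List.filter_cons]
    by_cases h : A.Nonempty <;> simp [h]

/-- The reduced form of a symbol. -/
def reduce (s : Symb m) : Comperm m :=
  ⟨⟨prune s.1, fun i => by
    classical
    rw [leaves_prune, List.countP_filter, ← s.mem_one i]
    congr 1
    funext A
    by_cases h : i ∈ A
    · simp [h, show A.Nonempty from ⟨i, h⟩]
    · simp [h]⟩, fun A hA => by
    classical
    change A ∈ (prune s.tree).leaves at hA
    rw [leaves_prune] at hA
    simpa using (List.mem_filter.1 hA).2⟩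

open scoped Classical in
/-- Two symbols have the same reduced form if and only if the compositions associated to their
pseudo-compositions agree and their trees agree after removing the leaves corresponding to empty
components. -/
theorem reduce_eq_iff (s s' : Symb m) : s.reduce = s'.reduce ↔
    s.tree.leaves.filter (fun A => decide A.Nonempty) =
      s'.tree.leaves.filter (fun A => decide A.Nonempty) ∧
    (prune s.tree).shape = (prune s'.tree).shape := by
  rw [← leaves_prune, ← leaves_prune]
  constructor
  · intro h
    have : prune s.tree = prune s'.tree := congrArg (fun c : Comperm m => c.symb.tree) h
    rw [this]; exact ⟨rfl, rfl⟩
  · rintro ⟨h1, h2⟩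
    exact Comperm.ext (Symb.ext (PTree.ext_shape_leaves _ _ h2 h1))

/-- The symbol `t · f⁻¹(π)` obtained from `tπ` by taking the preimage of each component. -/
def comap (f : Fin n → Fin m) (s : Symb m) : Symb n :=
  ⟨s.tree.map (fun A => Finset.univ.filter (fun i => f i ∈ A)), fun i => by
    rw [PTree.leaves_map, List.countP_map, ← s.mem_one (f i)]
    congr 1
    funext A
    simp⟩

/-- The symbol `t · γ(π)` obtained by applying a permutation to each component. -/
def act (γ : Equiv.Perm (Fin m)) (s : Symb m) : Symb m := s.comap γ.symm

/-- `t · π|_{{1, …, p}}`. -/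
def restrictLow (s : Symb m) (p : Fin (m + 1)) : Symb (p : ℕ) :=
  s.comap (fun i : Fin (p : ℕ) => Fin.castLE (Nat.lt_succ_iff.1 p.2) i)

/-- `t · st(π|_{{p + 1, …, m}})`, where `st` subtracts `p` from every element. -/
def restrictHigh (s : Symb m) (p : Fin (m + 1)) : Symb (m - p) :=
  s.comap (fun i : Fin (m - p) => ⟨(p : ℕ) + i, by have := i.2; omega⟩)

/-- `t ∨ t' · (π₁, …, π_r, m + π'₁, …, m + π'_s)`. -/
def graft (s : Symb m) (s' : Symb n) : Symb (m + n) :=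
  ⟨s.tree.map (fun A => A.map (Fin.castAddEmb n)) * s'.tree.map (fun A => A.map (Fin.natAddEmb m)),
    fun i => by
    rw [PTree.leaves_mul, List.countP_append, PTree.leaves_map, PTree.leaves_map,
      List.countP_map, List.countP_map]
    refine Fin.addCases (fun j => ?_) (fun j => ?_) i
    · rw [← s.mem_one j]
      refine (congrArg₂ (· + ·) (y' := 0) ?_ ?_).trans (Nat.add_zero _)
      · congr 1; funext A; simp [Fin.ext_iff]
        constructor
        · rintro ⟨a, ha, h⟩; rwa [← Fin.ext h]
        · exact fun h => ⟨j, h, rfl⟩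
      · rw [List.countP_eq_zero]
        intro A _
        simp only [Function.comp, decide_eq_true_eq, Finset.mem_map, not_exists, not_and]
        intro a _ h
        have := congrArg Fin.val h
        simp at this
        have := j.2
        omega
    · rw [← s'.mem_one j]
      refine (congrArg₂ (· + ·) (x' := 0) ?_ ?_).trans (Nat.zero_add _)
      · rw [List.countP_eq_zero]
        intro A _
        simp only [Function.comp, decide_eq_true_eq, Finset.mem_map, not_exists, not_and]
        intro a _ h
        have := congrArg Fin.val h
        simp at this
        have := a.2
        omega
      · congr 1; funext A; simp⟩

/-- The underlying permutation of `π` in one-line notation: the elements of the first component in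
increasing order, then those of the second one in increasing order, and so on. -/
def word (s : Symb m) : List (Fin m) := s.tree.leaves.flatMap (fun A => A.sort (· ≤ ·))

lemma count_word (s : Symb m) (i : Fin m) : s.word.count i = 1 := by
  rw [word, List.count_flatMap, ← s.mem_one i]
  generalize s.tree.leaves = l
  induction l with
  | nil => rfl
  | cons A l ih =>
    rw [List.map_cons, List.sum_cons, ih, List.countP_cons, Nat.add_comm]
    congr 1
    by_cases h : i ∈ A
    · simp [h]
    · simp [h, List.count_eq_zero]

lemma nodup_word (s : Symb m) : s.word.Nodup :=
  List.nodup_iff_count_le_one.2 fun i => (s.count_word i).le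

lemma mem_word (s : Symb m) (i : Fin m) : i ∈ s.word :=
  List.count_pos_iff.1 (by rw [s.count_word i]; exact Nat.one_pos)

lemma length_word (s : Symb m) : s.word.length = m := by
  simpa using Fintype.card_congr (s.nodup_word.getEquivOfForallMemList _ s.mem_word)

/-- The underlying permutation `σ^π`, sending `i` to the `i`-th entry of `word`. -/
def perm (s : Symb m) : Equiv.Perm (Fin m) :=
  (finCongr s.length_word.symm).trans (s.nodup_word.getEquivOfForallMemList _ s.mem_word)

/-- The product `tπ • t'π' = t(t') · (σ^{π'}(π₁) ∩ π'₁, …, σ^{π'}(π₁) ∩ π'_s, …, σ^{π'}(π_r) ∩ π'_s)`,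
where `t(t')` has a copy of `t'` in each leaf of `t`. -/
def bullet (s s' : Symb m) : Symb m :=
  ⟨s.tree.subst (fun A => s'.tree.map (fun B => A.map s'.perm.toEmbedding ∩ B)), fun i => by
    rw [PTree.leaves_subst, List.countP_flatMap, ← s.mem_one (s'.perm.symm i)]
    generalize s.tree.leaves = l
    have key : ∀ A : Finset (Fin m),
        List.countP (fun B => decide (i ∈ B))
          (s'.tree.map (fun B => A.map s'.perm.toEmbedding ∩ B)).leaves =
        if s'.perm.symm i ∈ A then 1 else 0 := by
      intro A
      rw [PTree.leaves_map, List.countP_map]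
      split_ifs with h
      · rw [← s'.mem_one i]
        congr 1; funext B
        simp only [Function.comp, Finset.mem_inter, Finset.mem_map_equiv, h, true_and]
      · rw [List.countP_eq_zero]
        intro B _
        simp [Finset.mem_map_equiv, h]
    induction l with
    | nil => rfl
    | cons A l ih =>
      rw [List.map_cons, List.sum_cons, ih, List.countP_cons, Nat.add_comm]
      simp only [Function.comp, key, decide_eq_true_eq]⟩

/-- The symbol formed by the empty tree and the empty pseudo-composition. -/
def empty : Symb 0 := ⟨1, fun i => i.elim0⟩

end Symb

/-! ### The bialgebra of compermutations and the nonassociative Solomon descent algebra -/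

section Bialgebra

variable (k : Type*) [Field k]

/-- The space `k[Ϭ] = ⊕ k[Ϭ_m]` with basis all the compermutations. -/
abbrev KComperm := (Σ m, Comperm m) →₀ k

variable {m n : ℕ}

/-- The basis element `F_{tπ}` of the class of the symbol `tπ`. -/
def F (s : Symb m) : KComperm k := Finsupp.single ⟨m, s.reduce⟩ 1

open scoped Classical in
/-- The `(m, n)`-shuffles: permutations increasing on the first `m` and on the last `n` elements. -/
def shuffles (m n : ℕ) : Finset (Equiv.Perm (Fin (m + n))) :=
  Finset.univ.filter fun γ =>
    StrictMono (fun i : Fin m => γ (Fin.castAdd n i)) ∧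
      StrictMono (fun j : Fin n => γ (Fin.natAdd m j))

/-- The operations of `k[Ϭ]`: the outer product
`F_{tπ} * F_{t'π'} = ∑ F_{t ∨ t' · γ(π × π'[m])}` over the shuffles `γ`, the comultiplication
`Δ F_{tπ} = ∑ F_{t · π|_{{1, …, p}}} ⊗ F_{t · st(π|_{{p+1, …, m}})}` over `0 ≤ p ≤ m`, the class of
the empty symbol as unit, and the projection on `k[Ϭ_0] = k` as counit. -/
def compermBialg : BialgData k (KComperm k) where
  mul := Finsupp.linearCombination k fun a : Σ m, Comperm m =>
    Finsupp.linearCombination k fun b : Σ m, Comperm m =>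
      ∑ γ ∈ shuffles a.1 b.1, F k ((a.2.symb.graft b.2.symb).act γ)
  one := F k Symb.empty
  comul := Finsupp.linearCombination k fun a : Σ m, Comperm m =>
    ∑ p : Fin (a.1 + 1), F k (a.2.symb.restrictLow p) ⊗ₜ[k] F k (a.2.symb.restrictHigh p)
  counit := Finsupp.linearCombination k fun a : Σ m, Comperm m => if a.1 = 0 then (1 : k) else 0

/-- The opposite `•` of the inner product `∘` of `k[Ϭ]`: `F_{tπ} • F_{t'π'} = F_{tπ • t'π'}` if `tπ` and
`t'π'` are compermutations of the same `{1, …, m}`, and `0` otherwise. -/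
def bulletMul : KComperm k →ₗ[k] KComperm k →ₗ[k] KComperm k :=
  Finsupp.linearCombination k fun a : Σ m, Comperm m =>
    Finsupp.linearCombination k fun b : Σ m, Comperm m =>
      if h : b.1 = a.1 then F k (a.2.symb.bullet (h ▸ b.2.symb)) else 0

/-- There are finitely many compermutations `tπ` with given tree `t` and type `I` of `π`. -/
lemma finite_type (t : PTree Unit) (I : List ℕ) :
    {c : Comperm I.sum | c.symb.tree.shape = t ∧ c.symb.tree.leaves.map Finset.card = I}.Finite := by
  refine Set.Finite.of_finite_image (f := fun c => c.symb.tree.leaves)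
    ((List.finite_length_eq (Finset (Fin I.sum)) I.length).subset ?_) ?_
  · rintro _ ⟨c, ⟨_, hc⟩, rfl⟩
    simpa using congrArg List.length hc
  · rintro c ⟨hc, _⟩ d ⟨hd, _⟩ h
    exact Comperm.ext (Symb.ext (PTree.ext_shape_leaves _ _ (hc.trans hd.symm) h))

/-- `D^t_{≤ I} = ∑ F_{tπ}`, the sum over the compositions `π` of `{1, …, m}` of type `I`, where `I` is a
composition of `m` with as many parts as `t` has leaves. -/
def D (t : PTree Unit) (I : List ℕ) : KComperm k :=
  ∑ c ∈ (finite_type t I).toFinset, F k c.symb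

/-- The nonassociative Solomon descent algebra: the span of the elements `D^t_{≤ I}`, where `I` is a
composition (a finite tuple of positive integers) and `t` is a tree with `l(I)` leaves. -/
def sol : Submodule k (KComperm k) :=
  Submodule.span k {x | ∃ (t : PTree Unit) (I : List ℕ),
    (∀ i ∈ I, 0 < i) ∧ t.leaves.length = I.length ∧ x = D k t I}

end Bialgebra

end NonassocDescent

end

/-!
All the structures are images of one bialgebra `symBialg k` on the free nonassociative algebra
`k{X}`, whose comultiplication is the algebra homomorphism with `x_m ↦ ∑ x_i ⊗ x_{m-i}` (`x₀ = 1`).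

* The convolution homomorphism `theta : x_i ↦ I_i` has image `Σ` (`range_theta`). The reason why it
  respects composition is that `I_i` is compatible with the products and coproducts of `k{X}`, so
  that `θ(p) ∘ θ(q)` can be computed by the splitting rule `(f * f') ∘ h = ∑ (f ∘ h₁) * (f' ∘ h₂)`,
  where `Δ ∘ h = (∑ h₁ ⊗ h₂) ∘ Δ`. Reading this rule in `k{X}` gives a product `inner k` on `k{X}`,
  determined by `1 ⊛ q = I₀ q`, `x_i ⊛ q = I_i q` and `(p p') ⊛ q = ∑ (p ⊛ q₁) (p' ⊛ q₂)` for
  the comultiplication of `symBialg k`, with `theta (inner k p q) = theta p ∘ theta q`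
  (`theta_inner`).
* The homomorphism `xi` to the algebra of compermutations sends a word with shape `t` and letters
  `x_{i₁}, …, x_{i_r}` to `D^t_{≤ I}` (`xi_mono`), hence its image is `sol(Ϭ)` (`range_xi`). A
  pseudo-composition of `{1, …, m}` with components indexed by `J` is a function `{1, …, m} → J`,
  and `D^t_{≤ I}` is the sum over the functions with fibres of given sizes (`funSum`). For such
  sums, shuffles and deconcatenation become bijections between sets of functions, and the permutation `σ`
  in the definition of `•` drops out, because precomposition with `σ` only permutes the summands. So
  `xi` is a homomorphism of bialgebras (`xi_isBialgHom`), and `•` obeys the same splitting rule,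
  i.e. `xi (inner k p q) = xi p • xi q` (`xi_inner`).

Both maps are injective. For `xi`, the map `typeMap` recovers a word from its image up to a positive
integer, the number of functions with fibres of given sizes, which is invertible in `k`. For
`theta`, one uses an isomorphism `e : k{X} ≅ symBialg k`: the elements `q_n = e⁻¹(x_n)` satisfy `Δ q_n = ∑ q_i ⊗ q_{n-i}`, and
evaluation of endomorphisms at all `q_n` turns convolution into multiplication of power series over
`k{X}`; the image of `theta p` under it lists the components of `e⁻¹(p)`.

The isomorphism `e` comes from a base for logarithms `g` (`IsLogBase.exists_log_generators`): since
`g₁ ≠ 0`, the equation `∑ g_n(ℓ) = ∑ x_n` can be solved degree by degree for a series `ℓ = ∑ ℓ_n`.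
Comparing `Δ(ℓ_n)` with `ℓ_n ⊗ 1 + 1 ⊗ ℓ_n`, which are solutions of the same equation in the tensor
square, shows that the `ℓ_n` are primitive, and they are free generators. The same equation, solved
for the convolution product, gives `L` (`IsLogBase.exists_convLog`), with `I_i ∘ L = theta ℓ_i`. The
exponential series `g_{n+1} = x g_n / (n + 1)` is a base for logarithms (`expSeries_isLogBase`).
-/

open scoped TensorProduct

noncomputable section

namespace NonassocDescent

/-! ### Nonassociative unital algebras -/

/-- A nonassociative unital algebra structure on the space `V`, as a bundle of operations and laws,
so that several products on one space can be considered side by side. -/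
structure NAlg (k V : Type*) [Field k] [AddCommGroup V] [Module k V] where
  mul : V →ₗ[k] V →ₗ[k] V
  one : V
  unit_mul : ∀ u, mul one u = u
  mul_unit : ∀ u, mul u one = u

namespace FreeNA

variable {k : Type*} [Field k] {X Y : Type*}

/-- The word `w`, as a basis element of `k{X}`. -/
abbrev mono (k : Type*) [Field k] (w : PTree X) : FreeNA k X := MonoidAlgebra.single w 1

lemma mono_mul (w v : PTree X) : mono k (w * v) = mono k w * mono k v := by
  simp [mono, MonoidAlgebra.single_mul_single]

lemma mono_one : mono k (1 : PTree X) = 1 := rfl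

lemma mono_leaf (x : X) : mono k (PTree.leaf x) = gen k x := rfl

variable {V W : Type*} [AddCommGroup V] [Module k V] [AddCommGroup W] [Module k W]

lemma hom_ext {f g : FreeNA k X →ₗ[k] V} (h : ∀ w, f (mono k w) = g (mono k w)) : f = g :=
  (MonoidAlgebra.basis (PTree X) k).ext fun w => by simpa using h w

lemma constr_mono (f : PTree X → V) (w : PTree X) :
    (MonoidAlgebra.basis (PTree X) k).constr k f (mono k w) = f w := by
  have := (MonoidAlgebra.basis (PTree X) k).constr_basis k f w
  rwa [MonoidAlgebra.basis_apply] at this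

lemma induction_on {P : FreeNA k X → Prop} (p : FreeNA k X) (hw : ∀ w, P (mono k w))
    (h0 : P 0) (hadd : ∀ a b, P a → P b → P (a + b)) (hs : ∀ (c : k) a, P a → P (c • a)) : P p := by
  have hp : p ∈ Submodule.span k (Set.range (MonoidAlgebra.basis (PTree X) k)) := by
    rw [(MonoidAlgebra.basis (PTree X) k).span_eq]; trivial
  induction hp using Submodule.span_induction with
  | mem x hx => obtain ⟨w, rfl⟩ := hx; simpa using hw w
  | zero => exact h0
  | add x y _ _ hx hy => exact hadd _ _ hx hy
  | smul c x _ hx => exact hs _ _ hx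

end FreeNA

namespace NAlg

open FreeNA

variable {k : Type*} [Field k] {X : Type*} {V W U : Type*} [AddCommGroup V] [Module k V]
  [AddCommGroup W] [Module k W] [AddCommGroup U] [Module k U]

/-- The evaluation homomorphism `k{X} → V` with `x ↦ f x`. -/
def ev (A : NAlg k V) (f : X → V) : FreeNA k X →ₗ[k] V :=
  FreeNA.eval k (fun u v => A.mul u v) A.one f

lemma ev_mono (A : NAlg k V) (f : X → V) (w : PTree X) :
    A.ev f (mono k w) = w.eval (fun u v => A.mul u v) A.one f := constr_mono _ w

lemma ev_one (A : NAlg k V) (f : X → V) : A.ev f 1 = A.one := A.ev_mono f 1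

lemma ev_gen (A : NAlg k V) (f : X → V) (x : X) : A.ev f (gen k x) = f x := A.ev_mono f _

/-- Homomorphisms of nonassociative unital algebras. -/
structure IsHom (A : NAlg k V) (B : NAlg k W) (f : V →ₗ[k] W) : Prop where
  map_one : f A.one = B.one
  map_mul : ∀ u v, f (A.mul u v) = B.mul (f u) (f v)

lemma IsHom.comp {A : NAlg k V} {B : NAlg k W} {C : NAlg k U} {g : W →ₗ[k] U} {f : V →ₗ[k] W}
    (hg : IsHom B C g) (hf : IsHom A B f) : IsHom A C (g ∘ₗ f) :=
  ⟨by simp [hf.map_one, hg.map_one], fun u v => by simp [hf.map_mul, hg.map_mul]⟩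

lemma IsHom.id (A : NAlg k V) : IsHom A A LinearMap.id := ⟨rfl, fun _ _ => rfl⟩

variable (k X) in
/-- The free nonassociative unital algebra. -/
def free : NAlg k (FreeNA k X) := ⟨LinearMap.mul k _, 1, _root_.one_mul, _root_.mul_one⟩

lemma free_mul (p q : FreeNA k X) : (free k X).mul p q = p * q := rfl

lemma free_one : (free k X).one = 1 := rfl

lemma ev_mul (A : NAlg k V) (f : X → V) (p q : FreeNA k X) :
    A.ev f (p * q) = A.mul (A.ev f p) (A.ev f q) := by
  have : (LinearMap.mul k (FreeNA k X)).compr₂ (A.ev f) = A.mul.compl₁₂ (A.ev f) (A.ev f) := by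
    refine hom_ext fun w => hom_ext fun v => ?_
    simp only [LinearMap.compr₂_apply, LinearMap.mul_apply', LinearMap.compl₁₂_apply, ← mono_mul,
      ev_mono]
    exact PTree.eval_mul _ _ _ A.unit_mul A.mul_unit w v
  exact LinearMap.congr_fun (LinearMap.congr_fun this p) q

lemma ev_isHom (A : NAlg k V) (f : X → V) : IsHom (free k X) A (A.ev f) :=
  ⟨A.ev_one f, A.ev_mul f⟩

/-- A homomorphism on `k{X}` is determined by its values on the generators. -/
lemma IsHom.ext {A : NAlg k V} {f g : FreeNA k X →ₗ[k] V} (hf : IsHom (free k X) A f)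
    (hg : IsHom (free k X) A g) (h : ∀ x, f (gen k x) = g (gen k x)) : f = g := by
  refine hom_ext fun w => ?_
  induction w using PTree.induction_on with
  | h1 => exact hf.map_one.trans hg.map_one.symm
  | hl x => exact h x
  | hm a b iha ihb =>
    have h1 := hf.map_mul (mono k a) (mono k b)
    have h2 := hg.map_mul (mono k a) (mono k b)
    rw [free_mul, ← mono_mul] at h1 h2
    rw [h1, h2, iha, ihb]

lemma IsHom.comp_ev {A : NAlg k V} {B : NAlg k W} {h : V →ₗ[k] W} (hh : IsHom A B h) (f : X → V) :
    h ∘ₗ A.ev f = B.ev fun x => h (f x) :=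
  (hh.comp (A.ev_isHom f)).ext (B.ev_isHom _) fun x => by simp [ev_gen]

lemma IsHom.apply_ev {A : NAlg k V} {B : NAlg k W} {h : V →ₗ[k] W} (hh : IsHom A B h) (f : X → V)
    (p : FreeNA k X) : h (A.ev f p) = B.ev (fun x => h (f x)) p :=
  LinearMap.congr_fun (hh.comp_ev f) p

/-- The tensor product of two algebras. -/
def tensor (A : NAlg k V) (B : NAlg k W) : NAlg k (V ⊗[k] W) where
  mul := TensorProduct.map₂ A.mul B.mul
  one := A.one ⊗ₜ B.one
  unit_mul u := by
    induction u with
    | zero => simp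
    | tmul x y => simp [A.unit_mul, B.unit_mul]
    | add x y hx hy => rw [map_add, hx, hy]
  mul_unit u := by
    induction u with
    | zero => simp
    | tmul x y => simp [A.mul_unit, B.mul_unit]
    | add x y hx hy => simp [hx, hy]

lemma tensor_mul_tmul (A : NAlg k V) (B : NAlg k W) (u u' : V) (v v' : W) :
    (A.tensor B).mul (u ⊗ₜ v) (u' ⊗ₜ v') = A.mul u u' ⊗ₜ B.mul v v' := by
  simp [tensor]

lemma tensor_one (A : NAlg k V) (B : NAlg k W) : (A.tensor B).one = A.one ⊗ₜ[k] B.one := rfl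

/-- To check that a linear map on a tensor product is a homomorphism, pure tensors are enough. -/
lemma isHom_of_tmul {A : NAlg k V} {B : NAlg k W} {C : NAlg k U} {f : V ⊗[k] W →ₗ[k] U}
    (h1 : f (A.one ⊗ₜ B.one) = C.one)
    (hm : ∀ u v u' v', f (A.mul u u' ⊗ₜ B.mul v v') = C.mul (f (u ⊗ₜ v)) (f (u' ⊗ₜ v'))) :
    IsHom (A.tensor B) C f := by
  refine ⟨h1, fun x y => ?_⟩
  induction x with
  | zero => simp
  | add a b ha hb => simp [ha, hb]
  | tmul u v =>
    induction y with
    | zero => simp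
    | add a b ha hb => simp [ha, hb]
    | tmul u' v' => rw [tensor_mul_tmul, hm]

lemma IsHom.map {V' W' : Type*} [AddCommGroup V'] [Module k V'] [AddCommGroup W'] [Module k W']
    {A : NAlg k V} {B : NAlg k W} {A' : NAlg k V'} {B' : NAlg k W'} {f : V →ₗ[k] V'}
    {g : W →ₗ[k] W'} (hf : IsHom A A' f) (hg : IsHom B B' g) :
    IsHom (A.tensor B) (A'.tensor B') (TensorProduct.map f g) :=
  isHom_of_tmul (by simp [hf.map_one, hg.map_one, tensor_one]) fun u v u' v' => by
    simp [hf.map_mul, hg.map_mul, tensor_mul_tmul]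

/-- The product of `k` itself. -/
def base (k : Type*) [Field k] : NAlg k k := ⟨LinearMap.mul k k, 1, _root_.one_mul, _root_.mul_one⟩

lemma lid_isHom (A : NAlg k V) :
    IsHom ((base k).tensor A) A (TensorProduct.lid k V).toLinearMap :=
  isHom_of_tmul (by simp [base]) fun u v u' v' => by simp [base, mul_smul, smul_comm u u']

lemma rid_isHom (A : NAlg k V) :
    IsHom (A.tensor (base k)) A (TensorProduct.rid k V).toLinearMap :=
  isHom_of_tmul (by simp [base]) fun u v u' v' => by simp [base, mul_smul, smul_comm v v']

/-- The interchange of the two middle factors is a homomorphism. -/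
lemma tensorTensorTensorComm_isHom {U' : Type*} [AddCommGroup U'] [Module k U'] (A : NAlg k V)
    (B : NAlg k W) (C : NAlg k U) (D : NAlg k U') :
    IsHom ((A.tensor B).tensor (C.tensor D)) ((A.tensor C).tensor (B.tensor D))
      (TensorProduct.tensorTensorTensorComm k V W U U').toLinearMap := by
  refine isHom_of_tmul (by simp [tensor_one]) fun x y x' y' => ?_
  induction x with
  | zero => simp
  | add a b ha hb => simp only [ha, hb, TensorProduct.add_tmul, map_add, LinearMap.add_apply]
  | tmul u v =>
  induction y with
  | zero => simp
  | add a b ha hb => simp only [ha, hb, TensorProduct.tmul_add, map_add, LinearMap.add_apply]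
  | tmul s t =>
  induction x' with
  | zero => simp
  | add a b ha hb => simp only [ha, hb, TensorProduct.add_tmul, map_add]
  | tmul u' v' =>
  induction y' with
  | zero => simp
  | add a b ha hb => simp only [ha, hb, TensorProduct.tmul_add, map_add]
  | tmul s' t' => simp [tensor_mul_tmul]

end NAlg

/-! ### Bialgebra structures on the free algebra -/

namespace BialgData

open FreeNA NAlg

variable {k : Type*} [Field k] {X : Type*} {V W : Type*} [AddCommGroup V] [Module k V]
  [AddCommGroup W] [Module k W]

/-- The underlying algebra of a bialgebra. -/
def IsBialgebra.toNAlg {B : BialgData k V} (hB : B.IsBialgebra) : NAlg k V :=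
  ⟨B.mul, B.one, hB.one_mul, hB.mul_one⟩

lemma IsBialgebra.comul_isHom {B : BialgData k V} (hB : B.IsBialgebra) :
    NAlg.IsHom hB.toNAlg (hB.toNAlg.tensor hB.toNAlg) B.comul := ⟨hB.comul_one, hB.comul_mul⟩

variable (k X) in
/-- The operations on `k{X}` for which the comultiplication is the algebra homomorphism with given
values `d x` on the generators, and the counit vanishes on the generators. -/
def ofComul (d : X → FreeNA k X ⊗[k] FreeNA k X) : BialgData k (FreeNA k X) where
  mul := LinearMap.mul k _
  one := 1
  comul := ((free k X).tensor (free k X)).ev d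
  counit := (NAlg.base k).ev fun _ => 0

variable (d : X → FreeNA k X ⊗[k] FreeNA k X)

lemma ofComul_counit_isHom : NAlg.IsHom (free k X) (NAlg.base k) (ofComul k X d).counit :=
  (NAlg.base k).ev_isHom _

lemma ofComul_comul_isHom :
    NAlg.IsHom (free k X) ((free k X).tensor (free k X)) (ofComul k X d).comul :=
  NAlg.ev_isHom _ _

lemma ofComul_isBialgebra
    (hl : ∀ x, TensorProduct.lid k _
      (TensorProduct.map (ofComul k X d).counit LinearMap.id (d x)) = gen k x)
    (hr : ∀ x, TensorProduct.rid k _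
      (TensorProduct.map LinearMap.id (ofComul k X d).counit (d x)) = gen k x) :
    (ofComul k X d).IsBialgebra where
  one_mul := _root_.one_mul
  mul_one := _root_.mul_one
  counit_left u := by
    have h := ((lid_isHom (free k X)).comp
      (((ofComul_counit_isHom d).map (NAlg.IsHom.id _)).comp (ofComul_comul_isHom d))).ext
      (NAlg.IsHom.id _) fun x => by
        simpa [ofComul, ev_gen] using hl x
    exact LinearMap.congr_fun h u
  counit_right u := by
    have h := ((rid_isHom (free k X)).comp
      (((NAlg.IsHom.id _).map (ofComul_counit_isHom d)).comp (ofComul_comul_isHom d))).ext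
      (NAlg.IsHom.id _) fun x => by
        simpa [ofComul, ev_gen] using hr x
    exact LinearMap.congr_fun h u
  comul_mul := (ofComul_comul_isHom d).map_mul
  comul_one := (ofComul_comul_isHom d).map_one
  counit_mul := (ofComul_counit_isHom d).map_mul
  counit_one := (ofComul_counit_isHom d).map_one

/-- On a tensor product of free algebras, `NAlg.tensor` is the product given by Mathlib. -/
lemma tensor_free_mul (p q : FreeNA k X ⊗[k] FreeNA k X) :
    ((free k X).tensor (free k X)).mul p q = p * q := by
  induction p with
  | zero => simp
  | add a b ha hb => simp [ha, hb, add_mul]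
  | tmul u v =>
    induction q with
    | zero => simp
    | add a b ha hb => simp [ha, hb, mul_add]
    | tmul u' v' => rw [tensor_mul_tmul, Algebra.TensorProduct.tmul_mul_tmul]; rfl

lemma freeBialg_eq : freeBialg k X =
    ofComul k X fun x => gen k x ⊗ₜ 1 + 1 ⊗ₜ gen k x := by
  have h : (fun u v : FreeNA k X ⊗[k] FreeNA k X => u * v) =
      fun u v => ((free k X).tensor (free k X)).mul u v := by
    funext u v; exact (tensor_free_mul u v).symm
  unfold freeBialg ofComul
  rw [h]
  rfl

lemma freeBialg_isBialgebra : (freeBialg k X).IsBialgebra := by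
  rw [freeBialg_eq]
  refine ofComul_isBialgebra _ (fun x => ?_) fun x => ?_ <;>
  simp [ofComul, ev_gen, ev_one, NAlg.base]

lemma freeBialg_comul_gen (x : X) :
    (freeBialg k X).comul (gen k x) = gen k x ⊗ₜ 1 + 1 ⊗ₜ gen k x := by
  rw [freeBialg_eq]; exact NAlg.ev_gen _ _ _

lemma freeBialg_counit_gen (x : X) : (freeBialg k X).counit (gen k x) = 0 := by
  rw [freeBialg_eq]; exact NAlg.ev_gen _ _ _

lemma freeBialg_comul_isHom :
    NAlg.IsHom (free k X) ((free k X).tensor (free k X)) (freeBialg k X).comul :=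
  freeBialg_isBialgebra.comul_isHom

/-- The convolution product as a bilinear map. -/
def convL (B : BialgData k V) : (V →ₗ[k] V) →ₗ[k] (V →ₗ[k] V) →ₗ[k] (V →ₗ[k] V) :=
  LinearMap.mk₂ k B.conv
    (fun f f' h => by
      simp [conv, TensorProduct.map_add_left, LinearMap.add_comp, LinearMap.comp_add])
    (fun c f h => by
      simp [conv, TensorProduct.map_smul_left, LinearMap.smul_comp, LinearMap.comp_smul])
    (fun f h h' => by
      simp [conv, TensorProduct.map_add_right, LinearMap.add_comp, LinearMap.comp_add])
    (fun c f h => by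
      simp [conv, TensorProduct.map_smul_right, LinearMap.smul_comp, LinearMap.comp_smul])

lemma convL_apply (B : BialgData k V) (f h : V →ₗ[k] V) : B.convL f h = B.conv f h := rfl

/-- The convolution algebra of linear endomorphisms. -/
def IsBialgebra.convAlg {B : BialgData k V} (hB : B.IsBialgebra) : NAlg k (V →ₗ[k] V) where
  mul := B.convL
  one := B.convOne
  unit_mul f := by
    ext u
    have h : ∀ z : V ⊗[k] V, TensorProduct.lift B.mul (TensorProduct.map B.convOne f z) =
        f (TensorProduct.lid k V (TensorProduct.map B.counit LinearMap.id z)) := fun z => by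
      induction z with
      | zero => simp
      | add a b ha hb => simp only [map_add, ha, hb]
      | tmul a b => simp [convOne, hB.one_mul]
    simp only [convL_apply, conv, LinearMap.comp_apply, h, hB.counit_left]
  mul_unit f := by
    ext u
    have h : ∀ z : V ⊗[k] V, TensorProduct.lift B.mul (TensorProduct.map f B.convOne z) =
        f (TensorProduct.rid k V (TensorProduct.map LinearMap.id B.counit z)) := fun z => by
      induction z with
      | zero => simp
      | add a b ha hb => simp only [map_add, ha, hb]
      | tmul a b => simp [convOne, hB.mul_one]
    simp only [convL_apply, conv, LinearMap.comp_apply, h, hB.counit_right]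

/-- Transport of operations along a linear isomorphism. -/
def transport (B : BialgData k V) (e : V ≃ₗ[k] W) : BialgData k W where
  mul := (B.mul.compl₁₂ e.symm.toLinearMap e.symm.toLinearMap).compr₂ e.toLinearMap
  one := e B.one
  comul := TensorProduct.map e.toLinearMap e.toLinearMap ∘ₗ B.comul ∘ₗ e.symm.toLinearMap
  counit := B.counit ∘ₗ e.symm.toLinearMap

lemma transport_mul (B : BialgData k V) (e : V ≃ₗ[k] W) (u v : W) :
    (B.transport e).mul u v = e (B.mul (e.symm u) (e.symm v)) := rfl

lemma transport_comul (B : BialgData k V) (e : V ≃ₗ[k] W) (u : W) :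
    (B.transport e).comul u =
      TensorProduct.map e.toLinearMap e.toLinearMap (B.comul (e.symm u)) := rfl

lemma transport_isHom (B : BialgData k V) (e : V ≃ₗ[k] W) : B.IsHom (B.transport e) e.toLinearMap :=
  ⟨rfl, fun u v => by simp [transport_mul], fun u => by simp [transport_comul],
    fun u => by simp [transport]⟩

lemma IsHom.comp {U : Type*} [AddCommGroup U] [Module k U] {B : BialgData k V} {C : BialgData k W}
    {D : BialgData k U} {g : W →ₗ[k] U} {f : V →ₗ[k] W} (hg : C.IsHom D g) (hf : B.IsHom C f) :
    B.IsHom D (g ∘ₗ f) :=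
  ⟨by simp [hf.map_one, hg.map_one], fun u v => by simp [hf.map_mul, hg.map_mul],
    fun u => by simp [hf.map_comul, hg.map_comul, TensorProduct.map_map],
    fun u => by simp [hf.map_counit, hg.map_counit]⟩

lemma IsHom.symm {B : BialgData k V} {C : BialgData k W} {e : V ≃ₗ[k] W}
    (he : B.IsHom C e.toLinearMap) : C.IsHom B e.symm.toLinearMap := by
  refine ⟨?_, fun u v => ?_, fun u => ?_, fun u => ?_⟩
  · have := he.map_one; simp at this; simp [← this]
  · have := he.map_mul (e.symm u) (e.symm v)
    simp at this; simp [← this]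
  · have := he.map_comul (e.symm u)
    simp at this; simp [this, TensorProduct.map_map]
  · have := he.map_counit (e.symm u)
    simp at this; simp [this]

/-- The bialgebra laws are transported along a linear isomorphism. -/
lemma IsBialgebra.of_equiv {B : BialgData k V} {C : BialgData k W} (hB : B.IsBialgebra)
    (e : V ≃ₗ[k] W) (he : B.IsHom C e.toLinearMap) : C.IsBialgebra := by
  have h1 : e B.one = C.one := he.map_one
  have hm : ∀ u v, e (B.mul u v) = C.mul (e u) (e v) := he.map_mul
  have hc : ∀ u, C.comul (e u) = TensorProduct.map e.toLinearMap e.toLinearMap (B.comul u) :=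
    he.map_comul
  have hε : ∀ u, C.counit (e u) = B.counit u := he.map_counit
  have hε' : C.counit ∘ₗ e.toLinearMap = B.counit := LinearMap.ext hε
  refine ⟨fun u => ?_, fun u => ?_, fun u => ?_, fun u => ?_, fun u v => ?_, ?_, fun u v => ?_, ?_⟩
  · obtain ⟨u, rfl⟩ := e.surjective u
    rw [← h1, ← hm, hB.one_mul]
  · obtain ⟨u, rfl⟩ := e.surjective u
    rw [← h1, ← hm, hB.mul_one]
  · obtain ⟨u, rfl⟩ := e.surjective u
    have : ∀ z : V ⊗[k] V, TensorProduct.lid k W (TensorProduct.map B.counit e.toLinearMap z) =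
        e (TensorProduct.lid k V (TensorProduct.map B.counit LinearMap.id z)) := fun z => by
      induction z with
      | zero => simp
      | add a b ha hb => simp only [map_add, ha, hb]
      | tmul a b => simp
    rw [hc, TensorProduct.map_map, hε', LinearMap.id_comp, this, hB.counit_left]
  · obtain ⟨u, rfl⟩ := e.surjective u
    have : ∀ z : V ⊗[k] V, TensorProduct.rid k W (TensorProduct.map e.toLinearMap B.counit z) =
        e (TensorProduct.rid k V (TensorProduct.map LinearMap.id B.counit z)) := fun z => by
      induction z with
      | zero => simp
      | add a b ha hb => simp only [map_add, ha, hb]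
      | tmul a b => simp
    rw [hc, TensorProduct.map_map, hε', LinearMap.id_comp, this, hB.counit_right]
  · obtain ⟨u, rfl⟩ := e.surjective u
    obtain ⟨v, rfl⟩ := e.surjective v
    have : ∀ y z : V ⊗[k] V, TensorProduct.map e.toLinearMap e.toLinearMap
        (TensorProduct.map₂ B.mul B.mul y z) = TensorProduct.map₂ C.mul C.mul
        (TensorProduct.map e.toLinearMap e.toLinearMap y)
        (TensorProduct.map e.toLinearMap e.toLinearMap z) := fun y z => by
      induction y with
      | zero => simp
      | add a b ha hb => simp only [map_add, LinearMap.add_apply, ha, hb]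
      | tmul a b =>
        induction z with
        | zero => simp
        | add a b ha hb => simp only [map_add, ha, hb]
        | tmul c d => simp [hm]
    rw [← hm, hc, hB.comul_mul, this, hc, hc]
  · rw [← h1, hc, hB.comul_one]; simp
  · obtain ⟨u, rfl⟩ := e.surjective u
    obtain ⟨v, rfl⟩ := e.surjective v
    rw [← hm, hε, hε, hε, hB.counit_mul]
  · rw [← h1, hε, hB.counit_one]

end BialgData

/-! ### Formal series over a nonassociative algebra -/

namespace PTree

variable {X : Type*}

lemma leaves_eq_nil {w : PTree X} (h : w.leaves = []) : w = 1 := by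
  induction w using PTree.induction_on with
  | h1 => rfl
  | hl x => simp at h
  | hm a b iha ihb =>
    rw [leaves_mul, List.append_eq_nil_iff] at h
    rw [iha h.1, ihb h.2, one_mul]

lemma length_leaves_pos {w : PTree X} (h : w ≠ 1) : 0 < w.leaves.length :=
  List.length_pos_iff.2 fun h' => h (leaves_eq_nil h')

lemma eq_leaf_of_length_eq_one {w : PTree X} (h : w.leaves.length = 1) : ∃ x, w = leaf x := by
  induction w using PTree.induction_on with
  | h1 => simp at h
  | hl x => exact ⟨x, rfl⟩
  | hm a b iha ihb =>
    rw [leaves_mul, List.length_append] at h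
    by_cases ha : a = 1
    · subst ha; rw [one_mul]; exact ihb (by simpa using h)
    by_cases hb : b = 1
    · subst hb; rw [mul_one]; exact iha (by simpa using h)
    have := length_leaves_pos ha
    have := length_leaves_pos hb
    omega

end PTree

namespace NAlg

open FreeNA
open Finset hiding antidiagonal mem_antidiagonal
open Finset.HasAntidiagonal

variable {k : Type*} [Field k] {V W : Type*} [AddCommGroup V] [Module k V]
  [AddCommGroup W] [Module k W]

/-- The algebra `V[[y]]` of formal power series in a central variable `y` with coefficients in `V`;
the series `∑ f_n yⁿ` is encoded by the sequence of its coefficients. -/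
def series (A : NAlg k V) : NAlg k (ℕ → V) where
  mul := LinearMap.mk₂ k (fun f h n => ∑ ij ∈ antidiagonal n, A.mul (f ij.1) (h ij.2))
    (fun f f' h => by ext n; simp [sum_add_distrib])
    (fun c f h => by ext n; simp [smul_sum])
    (fun f h h' => by ext n; simp [sum_add_distrib])
    (fun c f h => by ext n; simp [smul_sum])
  one := fun n => if n = 0 then A.one else 0
  unit_mul f := by
    ext n
    rw [LinearMap.mk₂_apply, sum_eq_single (0, n)]
    · simp [A.unit_mul]
    · rintro ⟨i, j⟩ hij hne
      have hi : i ≠ 0 := by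
        rintro rfl
        exact hne (by simpa using hij)
      simp [hi]
    · simp
  mul_unit f := by
    ext n
    rw [LinearMap.mk₂_apply, sum_eq_single (n, 0)]
    · simp [A.mul_unit]
    · rintro ⟨i, j⟩ hij hne
      have hi : j ≠ 0 := by
        rintro rfl
        exact hne (by simpa using hij)
      simp [hi]
    · simp

lemma series_mul (A : NAlg k V) (f h : ℕ → V) (n : ℕ) :
    A.series.mul f h n = ∑ ij ∈ antidiagonal n, A.mul (f ij.1) (h ij.2) := rfl

lemma series_one (A : NAlg k V) (n : ℕ) : A.series.one n = if n = 0 then A.one else 0 := rfl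

lemma IsHom.series {A : NAlg k V} {B : NAlg k W} {h : V →ₗ[k] W} (hh : IsHom A B h) :
    IsHom A.series B.series (h.compLeft ℕ) := by
  refine ⟨?_, fun u v => ?_⟩
  · ext n
    by_cases hn : n = 0 <;> simp [series_one, hn, hh.map_one]
  · ext n
    simp [series_mul, hh.map_mul]

/-- Substitution of the series `f` without constant term for the variable of the nonassociative
series `∑ g_N`. Only finitely many `N` contribute to each coefficient. -/
def subs (A : NAlg k V) (g : ℕ → FreeNA k Unit) (f : ℕ → V) (n : ℕ) : V :=
  ∑ N ∈ range (n + 1), A.series.ev (fun _ => f) (g N) n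

lemma IsHom.subs {A : NAlg k V} {B : NAlg k W} {h : V →ₗ[k] W} (hh : IsHom A B h)
    (g : ℕ → FreeNA k Unit) (f : ℕ → V) (n : ℕ) :
    h (A.subs g f n) = B.subs g (fun i => h (f i)) n := by
  simp only [NAlg.subs, map_sum]
  refine sum_congr rfl fun N _ => ?_
  exact congrFun (hh.series.apply_ev (fun _ => f) (g N)) n

section Local

variable (A : NAlg k V) {f f' : ℕ → V}

lemma ev_series_eq_zero (h0 : f 0 = 0) (w : PTree Unit) {n : ℕ} (hn : n < w.leaves.length) :
    A.series.ev (fun _ => f) (mono k w) n = 0 := by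
  induction w using PTree.induction_on generalizing n with
  | h1 => simp at hn
  | hl x =>
    obtain rfl : n = 0 := by simpa using hn
    rw [mono_leaf, ev_gen, h0]
  | hm a b iha ihb =>
    rw [mono_mul, ev_mul, series_mul]
    refine sum_eq_zero fun ij hij => ?_
    rw [mem_antidiagonal] at hij
    rw [PTree.leaves_mul, List.length_append] at hn
    by_cases h : ij.1 < a.leaves.length
    · rw [iha h]; simp
    · rw [ihb (n := ij.2) (by omega)]; simp

lemma ev_series_congr_le {n : ℕ} (h : ∀ i ≤ n, f i = f' i) (w : PTree Unit) :
    A.series.ev (fun _ => f) (mono k w) n = A.series.ev (fun _ => f') (mono k w) n := by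
  induction w using PTree.induction_on generalizing n with
  | h1 => rw [mono_one, ev_one, ev_one]
  | hl x => rw [mono_leaf, ev_gen, ev_gen, h n le_rfl]
  | hm a b iha ihb =>
    rw [mono_mul, ev_mul, ev_mul, series_mul, series_mul]
    refine sum_congr rfl fun ij hij => ?_
    rw [mem_antidiagonal] at hij
    rw [iha fun i hi => h i (by omega), ihb fun i hi => h i (by omega)]

/-- For a word which is not a single letter, the coefficient of `yⁿ` depends only on the
coefficients of `yⁱ` for `i < n` of the argument. -/
lemma ev_series_congr_lt (h0 : f 0 = 0) (h0' : f' 0 = 0) {n : ℕ} (h : ∀ i < n, f i = f' i)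
    (w : PTree Unit) (hw : w.leaves.length ≠ 1) :
    A.series.ev (fun _ => f) (mono k w) n = A.series.ev (fun _ => f') (mono k w) n := by
  induction w using PTree.induction_on with
  | h1 => rw [mono_one, ev_one, ev_one]
  | hl x => simp at hw
  | hm a b iha ihb =>
    by_cases ha : a = 1
    · subst ha; rw [one_mul]; rw [one_mul] at hw; exact ihb hw
    by_cases hb : b = 1
    · subst hb; rw [mul_one]; rw [mul_one] at hw; exact iha hw
    rw [mono_mul, ev_mul, ev_mul, series_mul, series_mul]
    refine sum_congr rfl fun ij hij => ?_
    rw [mem_antidiagonal] at hij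
    have hz {f : ℕ → V} (hf : f 0 = 0) {w : PTree Unit} (hw : w ≠ 1) :
        A.series.ev (fun _ => f) (mono k w) 0 = 0 :=
      A.ev_series_eq_zero hf w (PTree.length_leaves_pos hw)
    by_cases hi : ij.1 = 0
    · rw [hi, hz h0 ha, hz h0' ha]; simp
    by_cases hj : ij.2 = 0
    · rw [hj, hz h0 hb, hz h0' hb]; simp
    rw [A.ev_series_congr_le (fun i hi' => h i (by omega)) a,
      A.ev_series_congr_le (fun i hi' => h i (by omega)) b]

lemma ev_series_mem (M : ℕ → Submodule k V) (h1 : A.one ∈ M 0)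
    (hm : ∀ i j, ∀ u ∈ M i, ∀ v ∈ M j, A.mul u v ∈ M (i + j)) (hf : ∀ n, f n ∈ M n)
    (p : FreeNA k Unit) (n : ℕ) : A.series.ev (fun _ => f) p n ∈ M n := by
  induction p using FreeNA.induction_on with
  | hw w =>
    induction w using PTree.induction_on generalizing n with
    | h1 =>
      rw [mono_one, ev_one, series_one]
      split_ifs with h
      · rwa [h]
      · exact zero_mem _
    | hl x => rw [mono_leaf, ev_gen]; exact hf n
    | hm a b iha ihb =>
      rw [mono_mul, ev_mul, series_mul]
      refine sum_mem fun ij hij => ?_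
      rw [← mem_antidiagonal.1 hij]
      exact hm _ _ _ (iha _) _ (ihb _)
  | h0 => simp
  | hadd a b ha hb => rw [map_add]; exact add_mem ha hb
  | hs c a ha => rw [map_smul]; exact Submodule.smul_mem _ _ ha

end Local

/-- The map `f ⊗ h ↦ f(y) ⊗ h(y)` from `V[[y]] ⊗ W[[y]]` to `(V ⊗ W)[[y]]`. -/
def seriesTensor (k V W : Type*) [Field k] [AddCommGroup V] [Module k V] [AddCommGroup W]
    [Module k W] : (ℕ → V) ⊗[k] (ℕ → W) →ₗ[k] (ℕ → V ⊗[k] W) :=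
  TensorProduct.lift (LinearMap.mk₂ k
    (fun f h n => ∑ ij ∈ antidiagonal n, f ij.1 ⊗ₜ[k] h ij.2)
    (fun f f' h => by ext n; simp [sum_add_distrib, TensorProduct.add_tmul])
    (fun c f h => by ext n; simp [smul_sum, TensorProduct.smul_tmul'])
    (fun f h h' => by ext n; simp [sum_add_distrib, TensorProduct.tmul_add])
    (fun c f h => by ext n; simp [smul_sum]))

lemma seriesTensor_tmul (f : ℕ → V) (h : ℕ → W) (n : ℕ) :
    seriesTensor k V W (f ⊗ₜ h) n = ∑ ij ∈ antidiagonal n, f ij.1 ⊗ₜ[k] h ij.2 := by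
  simp [seriesTensor]

/-- Interchange of summation over decompositions of `n` into four parts. -/
lemma sum_antidiagonal_interchange {M : Type*} [AddCommMonoid M] (n : ℕ)
    (φ : ℕ → ℕ → ℕ → ℕ → M) :
    ∑ ij ∈ antidiagonal n, ∑ ab ∈ antidiagonal ij.1, ∑ cd ∈ antidiagonal ij.2,
        φ ab.1 ab.2 cd.1 cd.2 =
      ∑ ij ∈ antidiagonal n, ∑ ab ∈ antidiagonal ij.1, ∑ cd ∈ antidiagonal ij.2,
        φ ab.1 cd.1 ab.2 cd.2 := by
  simp only [← sum_product', sum_sigma']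
  refine sum_bij' (fun x _ => ⟨(x.2.1.1 + x.2.2.1, x.2.1.2 + x.2.2.2),
      ((x.2.1.1, x.2.2.1), (x.2.1.2, x.2.2.2))⟩)
    (fun x _ => ⟨(x.2.1.1 + x.2.2.1, x.2.1.2 + x.2.2.2),
      ((x.2.1.1, x.2.2.1), (x.2.1.2, x.2.2.2))⟩) ?_ ?_ ?_ ?_ ?_
  · rintro ⟨⟨i, j⟩, ⟨a, b⟩, c, d⟩ h
    simp at h ⊢; omega
  · rintro ⟨⟨i, j⟩, ⟨a, b⟩, c, d⟩ h
    simp at h ⊢; omega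
  · rintro ⟨⟨i, j⟩, ⟨a, b⟩, c, d⟩ h
    simp at h ⊢; omega
  · rintro ⟨⟨i, j⟩, ⟨a, b⟩, c, d⟩ h
    simp at h ⊢; omega
  · rintro ⟨⟨i, j⟩, ⟨a, b⟩, c, d⟩ h
    rfl

lemma seriesTensor_isHom (A : NAlg k V) (B : NAlg k W) :
    IsHom (A.series.tensor B.series) (A.tensor B).series (seriesTensor k V W) := by
  refine isHom_of_tmul ?_ fun f h f' h' => ?_
  · ext n
    rw [seriesTensor_tmul, series_one]
    by_cases hn : n = 0
    · subst hn; simp [series_one, tensor_one]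
    · rw [if_neg hn]
      refine sum_eq_zero fun ij hij => ?_
      rw [mem_antidiagonal] at hij
      by_cases hi : ij.1 = 0
      · simp [series_one, show ij.2 ≠ 0 by omega]
      · simp [series_one, hi]
  · ext n
    simp only [series_mul, seriesTensor_tmul, map_sum, LinearMap.sum_apply, tensor_mul_tmul,
      TensorProduct.sum_tmul, TensorProduct.tmul_sum]
    refine Eq.trans ?_ ((sum_antidiagonal_interchange n
      fun a b c d => A.mul (f a) (f' b) ⊗ₜ[k] B.mul (h c) (h' d)).trans ?_)
    · exact sum_congr rfl fun _ _ => sum_comm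
    · exact sum_congr rfl fun _ _ => sum_comm

lemma seriesTensor_tmul_one (B : NAlg k W) (f : ℕ → V) (n : ℕ) :
    seriesTensor k V W (f ⊗ₜ B.series.one) n = f n ⊗ₜ B.one := by
  rw [seriesTensor_tmul, sum_eq_single_of_mem (n, 0) (by simp)]
  · simp [series_one]
  · rintro ⟨i, j⟩ hij hne
    have hj : j ≠ 0 := by
      rintro rfl
      exact hne (by simpa using hij)
    simp [series_one, hj]

lemma seriesTensor_one_tmul (A : NAlg k V) (h : ℕ → W) (n : ℕ) :
    seriesTensor k V W (A.series.one ⊗ₜ h) n = A.one ⊗ₜ h n := by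
  rw [seriesTensor_tmul, sum_eq_single_of_mem (0, n) (by simp)]
  · simp [series_one]
  · rintro ⟨i, j⟩ hij hne
    have hi : i ≠ 0 := by
      rintro rfl
      exact hne (by simpa using hij)
    simp [series_one, hi]

end NAlg

/-! ### Bases for logarithms -/

namespace FreeNA

open NAlg

variable {k : Type*} [Field k] {X : Type*}

lemma proj_mono (d : X → ℕ) (n : ℕ) (w : PTree X) :
    proj k d n (mono k w) = if (w.leaves.map d).sum = n then mono k w else 0 :=
  constr_mono _ w

/-- A homogeneous element is a linear combination of words of its degree. -/
lemma mem_span_of_proj_eq {d : X → ℕ} {n : ℕ} {p : FreeNA k X} (hp : proj k d n p = p) :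
    p ∈ Submodule.span k {q | ∃ w : PTree X, (w.leaves.map d).sum = n ∧ mono k w = q} := by
  rw [← hp]
  generalize p = q
  induction q using FreeNA.induction_on with
  | hw w =>
    rw [proj_mono]
    split_ifs with h
    · exact Submodule.subset_span ⟨w, h, rfl⟩
    · exact zero_mem _
  | h0 => simp
  | hadd a b ha hb => rw [map_add]; exact add_mem ha hb
  | hs c a ha => rw [map_smul]; exact Submodule.smul_mem _ _ ha

lemma proj_one_mem_span {n : ℕ} {p : FreeNA k Unit} (hp : proj k (fun _ => 1) n p = p) :
    p ∈ Submodule.span k {q | ∃ w : PTree Unit, w.leaves.length = n ∧ mono k w = q} := by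
  simpa using mem_span_of_proj_eq hp

end FreeNA

namespace IsLogBase

open NAlg FreeNA BialgData
open Finset hiding antidiagonal mem_antidiagonal
open Finset.HasAntidiagonal

variable {k : Type*} [Field k] {V W : Type*} [AddCommGroup V] [Module k V] [AddCommGroup W]
  [Module k W] {g : ℕ → FreeNA k Unit}

lemma mem_span (hg : IsLogBase g) (n : ℕ) :
    g n ∈ Submodule.span k {q | ∃ w : PTree Unit, w.leaves.length = n ∧ mono k w = q} :=
  proj_one_mem_span (hg.homogeneous n)

/-- To compare two linear maps on `g n`, it suffices to do so on words with `n` letters. -/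
lemma map_congr (hg : IsLogBase g) {f h : FreeNA k Unit →ₗ[k] V} {n : ℕ}
    (H : ∀ w : PTree Unit, w.leaves.length = n → f (mono k w) = h (mono k w)) :
    f (g n) = h (g n) := by
  have := hg.mem_span n
  generalize g n = p at this ⊢
  induction this using Submodule.span_induction with
  | mem x hx => obtain ⟨w, hw, rfl⟩ := hx; exact H w hw
  | zero => simp
  | add x y _ _ hx hy => rw [map_add, map_add, hx, hy]
  | smul c x _ hx => rw [map_smul, map_smul, hx]

lemma zero_eq_one (hg : IsLogBase g) : g 0 = 1 := by
  have h := hg.mem_span 0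
  have hs : {q | ∃ w : PTree Unit, w.leaves.length = 0 ∧ mono k w = q} ⊆ {1} := by
    rintro _ ⟨w, hw, rfl⟩
    rw [PTree.leaves_eq_nil (List.length_eq_zero_iff.1 hw)]; rfl
  obtain ⟨c, hc⟩ := Submodule.mem_span_singleton.1 (Submodule.span_mono hs h)
  have h1 := hg.counit_eq
  rw [← hc, map_smul, show (1 : FreeNA k Unit) = (freeBialg k Unit).one from rfl,
    freeBialg_isBialgebra.counit_one, smul_eq_mul, mul_one] at h1
  rw [← hc, h1, one_smul]

lemma exists_one_eq (hg : IsLogBase g) : ∃ c : k, c ≠ 0 ∧ g 1 = c • gen k () := by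
  have h := hg.mem_span 1
  have hs : {q | ∃ w : PTree Unit, w.leaves.length = 1 ∧ mono k w = q} ⊆ {gen k ()} := by
    rintro _ ⟨w, hw, rfl⟩
    obtain ⟨x, rfl⟩ := PTree.eq_leaf_of_length_eq_one hw
    rfl
  obtain ⟨c, hc⟩ := Submodule.mem_span_singleton.1 (Submodule.span_mono hs h)
  refine ⟨c, ?_, hc.symm⟩
  rintro rfl
  exact hg.ne_zero (by rw [← hc, zero_smul])

lemma ev_series_eq_zero (hg : IsLogBase g) (A : NAlg k V) {f : ℕ → V} (h0 : f 0 = 0) {n N : ℕ}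
    (h : n < N) : A.series.ev (fun _ => f) (g N) n = 0 := by
  have := hg.map_congr (n := N) (f := LinearMap.proj n ∘ₗ A.series.ev (fun _ => f)) (h := 0)
    fun w hw => A.ev_series_eq_zero h0 w (by omega)
  exact this

lemma subs_eq_sum_range (hg : IsLogBase g) (A : NAlg k V) {f : ℕ → V} (h0 : f 0 = 0) {n M : ℕ}
    (h : n < M) : A.subs g f n = ∑ N ∈ range M, A.series.ev (fun _ => f) (g N) n := by
  refine sum_subset (range_subset_range.2 h) fun N _ hN => hg.ev_series_eq_zero A h0 ?_
  simpa using hN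

lemma subs_zero (hg : IsLogBase g) (A : NAlg k V) (f : ℕ → V) : A.subs g f 0 = A.one := by
  simp [subs, hg.zero_eq_one, ev_one, series_one]

/-- The coefficient of `yⁿ` in `g(f)` is `c f_n`, up to an expression in the `f_i` with `i < n`. -/
lemma subs_sub_subs (hg : IsLogBase g) (A : NAlg k V) {c : k} (hc : g 1 = c • gen k ())
    {f f' : ℕ → V} (h0 : f 0 = 0) (h0' : f' 0 = 0) {n : ℕ} (h : ∀ i < n, f i = f' i) :
    A.subs g f n - A.subs g f' n = c • (f n - f' n) := by
  rw [hg.subs_eq_sum_range A h0 (show n < n + 2 by omega),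
    hg.subs_eq_sum_range A h0' (show n < n + 2 by omega), ← sum_sub_distrib,
    sum_eq_single_of_mem 1 (by simp)]
  · rw [hc, map_smul, map_smul, ev_gen, ev_gen, smul_sub]; rfl
  · intro N _ hN
    rw [sub_eq_zero]
    exact hg.map_congr (f := LinearMap.proj n ∘ₗ A.series.ev (fun _ => f))
      (h := LinearMap.proj n ∘ₗ A.series.ev (fun _ => f')) fun w hw =>
        A.ev_series_congr_lt h0 h0' h w (by rwa [hw])

/-- Uniqueness of the logarithm to the base `g`. -/
lemma subs_injective (hg : IsLogBase g) (A : NAlg k V) {f f' : ℕ → V} (h0 : f 0 = 0)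
    (h0' : f' 0 = 0) (h : ∀ n, A.subs g f n = A.subs g f' n) : f = f' := by
  obtain ⟨c, hc0, hc⟩ := hg.exists_one_eq
  funext n
  induction n using Nat.strong_induction_on with
  | _ n ih =>
    have := hg.subs_sub_subs A hc h0 h0' ih
    rw [h, sub_self, eq_comm, smul_eq_zero, sub_eq_zero] at this
    exact this.resolve_left hc0

/-- Existence of the logarithm to the base `g` of a series with constant term `1`, with homogeneous
coefficients if those of the given series are homogeneous. -/
lemma exists_subs_eq (hg : IsLogBase g) (A : NAlg k V) (M : ℕ → Submodule k V)
    (h1 : A.one ∈ M 0) (hm : ∀ i j, ∀ u ∈ M i, ∀ v ∈ M j, A.mul u v ∈ M (i + j)) {z : ℕ → V}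
    (hz0 : z 0 = A.one) (hz : ∀ n, z n ∈ M n) :
    ∃ f : ℕ → V, f 0 = 0 ∧ (∀ n, A.subs g f n = z n) ∧ ∀ n, f n ∈ M n := by
  obtain ⟨c, hc0, hc⟩ := hg.exists_one_eq
  -- Newton iteration: each step makes one more coefficient of `g(f)` agree with `z`.
  let P : (ℕ → V) → ℕ → V := fun f n => if n = 0 then 0 else f n + c⁻¹ • (z n - A.subs g f n)
  let a : ℕ → ℕ → V := fun N => P^[N] 0
  have ha (N : ℕ) : a (N + 1) = P (a N) := Function.iterate_succ_apply' P N 0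
  have ha0 (N : ℕ) : a N 0 = 0 := by
    cases N with
    | zero => rfl
    | succ N => rw [ha]; exact if_pos rfl
  have hPM {f : ℕ → V} (hf : ∀ n, f n ∈ M n) (n : ℕ) : P f n ∈ M n := by
    simp only [P]
    split_ifs
    · exact zero_mem _
    · exact add_mem (hf n) (Submodule.smul_mem _ _ (sub_mem (hz n)
        (sum_mem fun N _ => A.ev_series_mem M h1 hm hf (g N) n)))
  have haM (N n : ℕ) : a N n ∈ M n := by
    induction N generalizing n with
    | zero => exact zero_mem _
    | succ N ih => rw [ha]; exact hPM ih n
  have hP {f f' : ℕ → V} (h0 : f 0 = 0) (h0' : f' 0 = 0) {n : ℕ} (h : ∀ i < n, f i = f' i) :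
      P f n = P f' n := by
    simp only [P]
    split_ifs
    · rfl
    · have := hg.subs_sub_subs A hc h0 h0' h
      rw [sub_eq_iff_eq_add] at this
      rw [this, sub_add_eq_sub_sub_swap, smul_sub _ _ (c • _), smul_smul, inv_mul_cancel₀ hc0,
        one_smul]
      abel
  have hstep (N n : ℕ) (hn : n ≤ N) : a (N + 1) n = a N n := by
    induction N generalizing n with
    | zero =>
      obtain rfl : n = 0 := by omega
      rw [ha0, ha0]
    | succ N ih =>
      rw [ha (N + 1)]
      conv_rhs => rw [ha N]
      exact hP (ha0 _) (ha0 _) fun i hi => ih i (Nat.lt_succ_iff.1 (hi.trans_le hn))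
  have hstab (N n : ℕ) (hn : n ≤ N) : a N n = a n n := by
    induction N, hn using Nat.le_induction with
    | base => rfl
    | succ N hN ih => rw [hstep N n hN, ih]
  refine ⟨fun n => a n n, ha0 0, fun n => ?_, fun n => haM n n⟩
  by_cases hn : n = 0
  · subst hn; rw [hg.subs_zero, hz0]
  have h2 : P (fun n => a n n) n = a n n := by
    rw [hP (f := fun n => a n n) (f' := a n) (ha0 0) (ha0 n) fun i hi => (hstab n i hi.le).symm,
      ← ha, hstep n n le_rfl]
  simp only [P, if_neg hn, add_eq_left, smul_eq_zero, inv_eq_zero, hc0, false_or,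
    sub_eq_zero] at h2
  exact h2.symm

/-- Since `g` is group-like, the substitution of `ℓ ⊗ 1 + 1 ⊗ ℓ` in `g` gives `g(ℓ) ⊗ g(ℓ)`. -/
lemma subs_primitive (hg : IsLogBase g) (A : NAlg k V) {f : ℕ → V} (h0 : f 0 = 0) (n : ℕ) :
    (A.tensor A).subs g (fun i => f i ⊗ₜ A.one + A.one ⊗ₜ f i) n =
      ∑ ij ∈ antidiagonal n, A.subs g f ij.1 ⊗ₜ[k] A.subs g f ij.2 := by
  have key : (A.tensor A).series.ev (fun _ i => f i ⊗ₜ A.one + A.one ⊗ₜ f i) =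
      seriesTensor k V V ∘ₗ TensorProduct.map (A.series.ev fun _ => f) (A.series.ev fun _ => f) ∘ₗ
        (freeBialg k Unit).comul := by
    refine (NAlg.ev_isHom _ _).ext ((seriesTensor_isHom A A).comp
      (((NAlg.ev_isHom _ _).map (NAlg.ev_isHom _ _)).comp freeBialg_comul_isHom)) fun x => ?_
    ext n
    rw [ev_gen, LinearMap.comp_apply, LinearMap.comp_apply, freeBialg_comul_gen, map_add, map_add,
      TensorProduct.map_tmul, TensorProduct.map_tmul, Pi.add_apply, ev_gen, ev_one,
      seriesTensor_tmul_one, seriesTensor_one_tmul]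
  have hN (N : ℕ) : (A.tensor A).series.ev (fun _ i => f i ⊗ₜ A.one + A.one ⊗ₜ f i) (g N) n =
      ∑ ij ∈ antidiagonal n, ∑ ab ∈ antidiagonal N,
        A.series.ev (fun _ => f) (g ab.1) ij.1 ⊗ₜ[k] A.series.ev (fun _ => f) (g ab.2) ij.2 := by
    rw [key, LinearMap.comp_apply, LinearMap.comp_apply, hg.comul_eq, map_sum, map_sum,
      Finset.sum_apply, sum_comm]
    refine sum_congr rfl fun ab _ => ?_
    rw [TensorProduct.map_tmul, seriesTensor_tmul]
  rw [subs]
  simp only [hN]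
  rw [sum_comm]
  refine sum_congr rfl fun ij hij => ?_
  rw [mem_antidiagonal] at hij
  simp only [subs, TensorProduct.sum_tmul, TensorProduct.tmul_sum]
  rw [← sum_product', sum_sigma']
  symm
  refine sum_of_injOn (fun ab => ⟨ab.2 + ab.1, (ab.2, ab.1)⟩) ?_ ?_ ?_ ?_
  · rintro ⟨a, b⟩ _ ⟨a', b'⟩ _ h
    simp at h; ext <;> simp [h]
  · rintro ⟨a, b⟩ h
    simp at h ⊢; omega
  · rintro ⟨N, a, b⟩ h h'
    simp only [mem_sigma, mem_range, mem_antidiagonal] at h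
    simp only [coe_product, Set.mem_image, not_exists, not_and] at h'
    by_cases ha : ij.1 < a
    · rw [hg.ev_series_eq_zero A h0 ha, TensorProduct.zero_tmul]
    by_cases hb : ij.2 < b
    · rw [hg.ev_series_eq_zero A h0 hb, TensorProduct.tmul_zero]
    refine absurd ?_ (h' (b, a) (by simp; omega))
    simp [h.2]
  · rintro ⟨a, b⟩ h
    rfl

/-- The logarithm of a group-like series is primitive. -/
lemma primitive_of_subs_grouplike (hg : IsLogBase g) (A : NAlg k V) {D : V →ₗ[k] V ⊗[k] V}
    (hD : NAlg.IsHom A (A.tensor A) D) {f z : ℕ → V} (h0 : f 0 = 0)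
    (hf : ∀ n, A.subs g f n = z n)
    (hz : ∀ n, D (z n) = ∑ ij ∈ antidiagonal n, z ij.1 ⊗ₜ[k] z ij.2) (n : ℕ) :
    D (f n) = f n ⊗ₜ A.one + A.one ⊗ₜ f n := by
  have := hg.subs_injective (A.tensor A) (f := fun n => D (f n))
    (f' := fun n => f n ⊗ₜ A.one + A.one ⊗ₜ f n) (by simp [h0]) (by simp [h0]) fun n => by
      rw [← hD.subs, hf, hz, hg.subs_primitive A h0]
      simp only [hf]
  exact congrFun this n

end IsLogBase

/-! ### The exponential series -/

section Exp

open NAlg FreeNA BialgData Finset.HasAntidiagonal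

variable (k : Type*) [Field k]

/-- The right-normed exponential series: `xⁿ / n!` with `xⁿ⁺¹ = x xⁿ`. -/
def expSeries : ℕ → FreeNA k Unit
  | 0 => 1
  | n + 1 => (n + 1 : k)⁻¹ • (gen k () * expSeries n)

lemma expSeries_zero : expSeries k 0 = 1 := by rw [expSeries]

lemma gen_mul_expSeries [CharZero k] (n : ℕ) :
    gen k () * expSeries k n = ((n + 1 : ℕ) : k) • expSeries k (n + 1) := by
  have : (n + 1 : k) ≠ 0 := by exact_mod_cast Nat.succ_ne_zero n
  rw [expSeries, smul_smul]
  push_cast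
  rw [mul_inv_cancel₀ this, one_smul]

lemma proj_gen_mul (n : ℕ) (p : FreeNA k Unit) :
    proj k (fun _ => 1) (n + 1) (gen k () * p) = gen k () * proj k (fun _ => 1) n p := by
  have : proj k (fun _ => 1) (n + 1) ∘ₗ LinearMap.mulLeft k (gen k ()) =
      LinearMap.mulLeft k (gen k ()) ∘ₗ proj k (fun _ => 1) n := hom_ext fun w => by
    simp only [LinearMap.comp_apply, LinearMap.mulLeft_apply, ← mono_leaf, ← mono_mul, proj_mono]
    by_cases h : w.leaves.length = n
    · rw [if_pos (by simp [h, add_comm]), if_pos (by simp [h]), mono_mul]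
    · rw [if_neg (by simp; omega), if_neg (by simpa using h), mul_zero]
  exact LinearMap.congr_fun this p

lemma expSeries_comul [CharZero k] (n : ℕ) : (freeBialg k Unit).comul (expSeries k n) =
    ∑ ij ∈ antidiagonal n, expSeries k ij.1 ⊗ₜ[k] expSeries k ij.2 := by
  induction n with
  | zero => simpa [expSeries_zero, free_one, tensor_one] using
      (freeBialg_comul_isHom (k := k) (X := Unit)).map_one
  | succ n ih =>
    have hn : ((n + 1 : ℕ) : k) ≠ 0 := by exact_mod_cast Nat.succ_ne_zero n
    refine smul_right_injective _ hn ?_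
    change ((n + 1 : ℕ) : k) • (freeBialg k Unit).comul (expSeries k (n + 1)) =
      ((n + 1 : ℕ) : k) • _
    rw [← map_smul, ← gen_mul_expSeries, ← free_mul, freeBialg_comul_isHom.map_mul, ih,
      freeBialg_comul_gen, map_add, LinearMap.add_apply, map_sum, map_sum, Finset.smul_sum]
    have h1 : ∑ ij ∈ antidiagonal (n + 1), (ij.1 : k) • (expSeries k ij.1 ⊗ₜ[k] expSeries k ij.2) =
        ∑ ij ∈ antidiagonal n, ((free k Unit).tensor (free k Unit)).mul (gen k () ⊗ₜ 1)
          (expSeries k ij.1 ⊗ₜ[k] expSeries k ij.2) := by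
      rw [Finset.Nat.sum_antidiagonal_succ]
      simp only [Nat.cast_zero, zero_smul, zero_add]
      refine Finset.sum_congr rfl fun ij _ => ?_
      rw [tensor_mul_tmul, free_mul, free_mul, one_mul, gen_mul_expSeries,
        TensorProduct.smul_tmul']
    have h2 : ∑ ij ∈ antidiagonal (n + 1), (ij.2 : k) • (expSeries k ij.1 ⊗ₜ[k] expSeries k ij.2) =
        ∑ ij ∈ antidiagonal n, ((free k Unit).tensor (free k Unit)).mul (1 ⊗ₜ gen k ())
          (expSeries k ij.1 ⊗ₜ[k] expSeries k ij.2) := by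
      rw [Finset.Nat.sum_antidiagonal_succ']
      simp only [Nat.cast_zero, zero_smul, zero_add]
      refine Finset.sum_congr rfl fun ij _ => ?_
      rw [tensor_mul_tmul, free_mul, free_mul, one_mul, gen_mul_expSeries,
        TensorProduct.tmul_smul]
    rw [← h1, ← h2, ← Finset.sum_add_distrib]
    refine Finset.sum_congr rfl fun ij hij => ?_
    rw [← mem_antidiagonal.1 hij, ← add_smul, Nat.cast_add]

lemma expSeries_isLogBase [CharZero k] : IsLogBase (expSeries k) where
  homogeneous n := by
    induction n with
    | zero => rw [expSeries_zero, ← mono_one, proj_mono]; simp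
    | succ n ih => rw [expSeries, map_smul, proj_gen_mul, ih]
  counit_eq := by rw [expSeries_zero]; exact freeBialg_isBialgebra.counit_one
  comul_eq := expSeries_comul k
  ne_zero := by
    have h : expSeries k 1 = gen k () := by
      rw [expSeries, expSeries_zero]; simp
    rw [h]
    simp [gen]

end Exp

/-! ### The grading of the free algebra and its two comultiplications -/

namespace PTree

/-- The degree of a word in the letters `x₁, x₂, …`, where `|x_i| = i`. -/
def weight (w : PTree ℕ+) : ℕ := (w.leaves.map (fun i : ℕ+ => (i : ℕ))).sum

@[simp] lemma weight_one : weight 1 = 0 := rfl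

@[simp] lemma weight_leaf (i : ℕ+) : weight (leaf i) = i := by simp [weight]

@[simp] lemma weight_mul (w v : PTree ℕ+) : weight (w * v) = weight w + weight v := by
  simp [weight]

/-- The letter `x_n`, with the convention `x₀ = 1`. -/
def letter : ℕ → PTree ℕ+
  | 0 => 1
  | n + 1 => leaf n.succPNat

@[simp] lemma letter_zero : letter 0 = 1 := rfl

lemma letter_coe (i : ℕ+) : letter i = leaf i := by
  obtain ⟨n, hn⟩ := i
  cases n with
  | zero => exact absurd hn (lt_irrefl 0)
  | succ n => rfl

end PTree

section Sym

open NAlg FreeNA BialgData PTree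
open Finset hiding antidiagonal mem_antidiagonal
open Finset.HasAntidiagonal

variable (k : Type*) [Field k]

lemma degProj_mono (n : ℕ) (w : PTree ℕ+) :
    degProj k n (mono k w) = if w.weight = n then mono k w else 0 := proj_mono _ _ _

/-- The bialgebra of noncommutative nonassociative symmetric functions: the algebra `k{X}` with the
comultiplication `x_m ↦ ∑ x_i ⊗ x_{m-i}`, where `x₀ = 1`. -/
def symBialg : BialgData k (KX k) :=
  ofComul k ℕ+ fun m => ∑ ij ∈ antidiagonal (m : ℕ), mono k (letter ij.1) ⊗ₜ mono k (letter ij.2)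

variable {k}

lemma ofComul_counit_letter (d : ℕ+ → KX k ⊗[k] KX k) (n : ℕ) :
    (ofComul k ℕ+ d).counit (mono k (letter n)) = if n = 0 then 1 else 0 := by
  cases n with
  | zero => exact (ofComul_counit_isHom d).map_one
  | succ n => rw [if_neg n.succ_ne_zero]; exact NAlg.ev_gen _ _ _

lemma symBialg_isBialgebra : (symBialg k).IsBialgebra := by
  refine ofComul_isBialgebra _ (fun m => ?_) fun m => ?_
  · simp only [map_sum, TensorProduct.map_tmul, TensorProduct.lid_tmul, ofComul_counit_letter]
    rw [sum_eq_single_of_mem (0, (m : ℕ)) (by simp)]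
    · simp [letter_coe, mono_leaf]
    · rintro ⟨i, j⟩ hij hne
      have hi : i ≠ 0 := by
        rintro rfl
        exact hne (by simpa using hij)
      simp [hi]
  · simp only [map_sum, TensorProduct.map_tmul, TensorProduct.rid_tmul, ofComul_counit_letter]
    rw [sum_eq_single_of_mem ((m : ℕ), 0) (by simp)]
    · simp [letter_coe, mono_leaf]
    · rintro ⟨i, j⟩ hij hne
      have hi : j ≠ 0 := by
        rintro rfl
        exact hne (by simpa using hij)
      simp [hi]

lemma symBialg_comul_isHom :
    NAlg.IsHom (free k ℕ+) ((free k ℕ+).tensor (free k ℕ+)) (symBialg k).comul :=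
  symBialg_isBialgebra.comul_isHom

lemma symBialg_comul_letter (n : ℕ) : (symBialg k).comul (mono k (letter n)) =
    ∑ ij ∈ antidiagonal n, mono k (letter ij.1) ⊗ₜ[k] mono k (letter ij.2) := by
  cases n with
  | zero =>
    rw [letter_zero, mono_one, Nat.antidiagonal_zero, sum_singleton]
    exact symBialg_isBialgebra.comul_one
  | succ n => exact NAlg.ev_gen _ _ _

lemma counit_eq_ite (d : ℕ+ → KX k ⊗[k] KX k) (w : PTree ℕ+) :
    (ofComul k ℕ+ d).counit (mono k w) = if w.weight = 0 then 1 else 0 := by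
  induction w using PTree.induction_on with
  | h1 => exact (ofComul_counit_isHom d).map_one
  | hl x => rw [← letter_coe, ofComul_counit_letter, letter_coe, weight_leaf]
  | hm a b iha ihb =>
    rw [mono_mul, ← free_mul, (ofComul_counit_isHom d).map_mul, iha, ihb, weight_mul]
    by_cases ha : a.weight = 0 <;> by_cases hb : b.weight = 0 <;> simp [ha, hb, NAlg.base]

lemma eq_one_of_weight_eq_zero {w : PTree ℕ+} (h : w.weight = 0) : w = 1 := by
  induction w using PTree.induction_on with
  | h1 => rfl
  | hl x => simp at h
  | hm a b iha ihb =>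
    rw [weight_mul, Nat.add_eq_zero_iff] at h
    rw [iha h.1, ihb h.2, one_mul]

/-- The projection on the component of degree `0` is the unit of every convolution algebra. -/
lemma convOne_ofComul (d : ℕ+ → KX k ⊗[k] KX k) : (ofComul k ℕ+ d).convOne = degProj k 0 := by
  refine hom_ext fun w => ?_
  rw [degProj_mono]
  change (ofComul k ℕ+ d).counit (mono k w) • (1 : KX k) = _
  rw [counit_eq_ite]
  split_ifs with h
  · rw [eq_one_of_weight_eq_zero h, one_smul, mono_one]
  · rw [zero_smul]

lemma convOne_kxBialg : (kxBialg k).convOne = degProj k 0 := by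
  rw [kxBialg, freeBialg_eq, convOne_ofComul]

lemma convOne_symBialg : (symBialg k).convOne = degProj k 0 := convOne_ofComul _

lemma degProj_one (n : ℕ) : degProj k n 1 = if n = 0 then 1 else 0 := by
  rw [← mono_one, degProj_mono, weight_one]
  simp only [eq_comm]

lemma degProj_degProj (m n : ℕ) (u : KX k) :
    degProj k m (degProj k n u) = if m = n then degProj k n u else 0 := by
  have : degProj k m ∘ₗ degProj k n = if m = n then degProj k n else 0 := hom_ext fun w => by
    rw [LinearMap.comp_apply, degProj_mono]
    by_cases h : w.weight = n
    · rw [if_pos h, degProj_mono, h]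
      by_cases hm : m = n
      · rw [if_pos hm.symm, if_pos hm, degProj_mono, if_pos h]
      · rw [if_neg (Ne.symm hm), if_neg hm, LinearMap.zero_apply]
    · rw [if_neg h, map_zero]
      split_ifs
      · rw [degProj_mono, if_neg h]
      · rfl
  rw [← LinearMap.comp_apply, this]
  split_ifs <;> rfl

variable (k) in
/-- The homomorphism `k{X} → k{X}[[y]]`, `u ↦ ∑ (I_n u) yⁿ`. -/
def gradeHom : KX k →ₗ[k] (ℕ → KX k) := LinearMap.pi fun n => degProj k n

lemma gradeHom_apply (u : KX k) (n : ℕ) : gradeHom k u n = degProj k n u := rfl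

lemma gradeHom_isHom : NAlg.IsHom (free k ℕ+) (free k ℕ+).series (gradeHom k) := by
  refine ⟨?_, fun u v => ?_⟩
  · ext1 n; exact degProj_one n
  · have : (free k ℕ+).mul.compr₂ (gradeHom k) =
        (free k ℕ+).series.mul.compl₁₂ (gradeHom k) (gradeHom k) := by
      refine hom_ext fun w => hom_ext fun v => ?_
      ext1 n
      simp only [LinearMap.compr₂_apply, LinearMap.compl₁₂_apply, gradeHom_apply, free_mul,
        ← mono_mul, degProj_mono, series_mul, weight_mul]
      split_ifs with h
      · rw [sum_eq_single_of_mem (w.weight, v.weight) (by simpa using h)]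
        · rw [if_pos rfl, if_pos rfl, mono_mul]
        · rintro ⟨i, j⟩ _ hne
          by_cases hi : w.weight = i
          · have hj : v.weight ≠ j := by
              rintro rfl
              exact hne (by rw [hi])
            simp [hj]
          · simp [hi]
      · refine (sum_eq_zero fun ij hij => ?_).symm
        rw [mem_antidiagonal] at hij
        by_cases hi : w.weight = ij.1
        · simp [show v.weight ≠ ij.2 by omega]
        · simp [hi]
    exact LinearMap.congr_fun (LinearMap.congr_fun this u) v

/-- The comultiplication of `k{X}` preserves the degree. -/
lemma comul_degProj (n : ℕ) (u : KX k) : (kxBialg k).comul (degProj k n u) =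
    ∑ ij ∈ antidiagonal n,
      TensorProduct.map (degProj k ij.1) (degProj k ij.2) ((kxBialg k).comul u) := by
  have h : (kxBialg k).comul.compLeft ℕ ∘ₗ gradeHom k =
      seriesTensor k _ _ ∘ₗ TensorProduct.map (gradeHom k) (gradeHom k) ∘ₗ (kxBialg k).comul := by
    refine (freeBialg_comul_isHom.series.comp gradeHom_isHom).ext
      ((seriesTensor_isHom _ _).comp ((gradeHom_isHom.map gradeHom_isHom).comp
        freeBialg_comul_isHom)) fun x => ?_
    ext1 n
    simp only [LinearMap.comp_apply, freeBialg_comul_gen, map_add, TensorProduct.map_tmul,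
      Pi.add_apply]
    rw [show gradeHom k 1 = (free k ℕ+).series.one from gradeHom_isHom.map_one,
      seriesTensor_tmul_one, seriesTensor_one_tmul]
    simp only [LinearMap.compLeft_apply, Function.comp_apply, gradeHom_apply, ← mono_leaf,
      degProj_mono]
    split_ifs
    · rw [mono_leaf, freeBialg_comul_gen]; rfl
    · simp
  have h' : ∀ z : KX k ⊗[k] KX k,
      seriesTensor k _ _ (TensorProduct.map (gradeHom k) (gradeHom k) z) n =
        ∑ ij ∈ antidiagonal n, TensorProduct.map (degProj k ij.1) (degProj k ij.2) z := fun z => by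
    induction z with
    | zero => simp
    | tmul a b => rw [TensorProduct.map_tmul, seriesTensor_tmul]; rfl
    | add a b ha hb => simp only [map_add, Pi.add_apply, ha, hb, sum_add_distrib]
  rw [← h']
  exact congrFun (LinearMap.congr_fun h u) n

/-- Coassociativity and cocommutativity of `k{X}`, in the form in which they are used. -/
lemma comul_comul_interchange (u : KX k) :
    TensorProduct.tensorTensorTensorComm k _ _ _ _
      (TensorProduct.map (kxBialg k).comul (kxBialg k).comul ((kxBialg k).comul u)) =
    TensorProduct.map (kxBialg k).comul (kxBialg k).comul ((kxBialg k).comul u) := by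
  have hD := (freeBialg_comul_isHom (k := k) (X := ℕ+))
  have h4 := (hD.map hD).comp hD
  have h1 : (freeBialg k ℕ+).comul 1 = 1 ⊗ₜ[k] 1 := hD.map_one
  refine LinearMap.congr_fun (((tensorTensorTensorComm_isHom _ _ _ _).comp h4).ext h4
    fun x => ?_) u
  simp only [LinearMap.comp_apply, freeBialg_comul_gen, map_add, TensorProduct.map_tmul, h1,
    TensorProduct.add_tmul, TensorProduct.tmul_add, LinearEquiv.coe_coe,
    TensorProduct.tensorTensorTensorComm_tmul]
  abel

/-! ### The descent algebra as an image of the free algebra -/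

variable (k) in
/-- The convolution algebra of endomorphisms of `k{X}`. -/
def convKX : NAlg k (KX k →ₗ[k] KX k) := freeBialg_isBialgebra.convAlg

lemma convKX_mul (f h : KX k →ₗ[k] KX k) : (convKX k).mul f h = (kxBialg k).conv f h := rfl

lemma convKX_one : (convKX k).one = degProj k 0 := convOne_kxBialg

variable (k) in
/-- The homomorphism from `k{X}` to the convolution algebra with `x_i ↦ I_i`. -/
def theta : KX k →ₗ[k] KX k →ₗ[k] KX k := (convKX k).ev fun i : ℕ+ => degProj k i

lemma theta_isHom : NAlg.IsHom (free k ℕ+) (convKX k) (theta k) := NAlg.ev_isHom _ _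

lemma theta_letter (n : ℕ) : theta k (mono k (letter n)) = degProj k n := by
  cases n with
  | zero => rw [letter_zero, mono_one, theta, ev_one, convKX_one]
  | succ n => exact NAlg.ev_gen _ _ _

lemma theta_mul (p q : KX k) : theta k (p * q) = (kxBialg k).conv (theta k p) (theta k q) :=
  theta_isHom.map_mul p q

/-- If `Δ f = F Δ` and `Δ h = H Δ` for `F, H ∈ End ⊗ End`, then `Δ (f * h) = (F * H) Δ`. -/
lemma comul_conv {f h : KX k →ₗ[k] KX k} {F H : (KX k →ₗ[k] KX k) ⊗[k] (KX k →ₗ[k] KX k)}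
    (hf : ∀ u, (kxBialg k).comul (f u) =
      TensorProduct.homTensorHomMap (RingHom.id k) _ _ _ _ F ((kxBialg k).comul u))
    (hh : ∀ u, (kxBialg k).comul (h u) =
      TensorProduct.homTensorHomMap (RingHom.id k) _ _ _ _ H ((kxBialg k).comul u)) (u : KX k) :
    (kxBialg k).comul ((kxBialg k).conv f h u) =
      TensorProduct.homTensorHomMap (RingHom.id k) _ _ _ _ (((convKX k).tensor (convKX k)).mul F H)
        ((kxBialg k).comul u) := by
  set Δ := (kxBialg k).comul
  set τ := TensorProduct.homTensorHomMap (RingHom.id k) (KX k) (KX k) (KX k) (KX k)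
  let M : (KX k ⊗[k] KX k) ⊗[k] (KX k ⊗[k] KX k) →ₗ[k] KX k ⊗[k] KX k :=
    TensorProduct.lift ((free k ℕ+).tensor (free k ℕ+)).mul
  have h1 : ∀ z : KX k ⊗[k] KX k,
      Δ (TensorProduct.lift (kxBialg k).mul (TensorProduct.map f h z)) =
        M (TensorProduct.map (τ F) (τ H) (TensorProduct.map Δ Δ z)) := fun z => by
    induction z with
    | zero => simp
    | add a b ha hb => simp only [map_add, ha, hb]
    | tmul a b =>
      simp only [TensorProduct.map_tmul, TensorProduct.lift.tmul, M, ← hf, ← hh]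
      exact freeBialg_comul_isHom.map_mul _ _
  have h2 : ∀ z : (KX k ⊗[k] KX k) ⊗[k] (KX k ⊗[k] KX k), ∀ f' f'' h' h'' : KX k →ₗ[k] KX k,
      M (TensorProduct.map (TensorProduct.map f' f'') (TensorProduct.map h' h'')
        (TensorProduct.tensorTensorTensorComm k _ _ _ _ z)) =
      TensorProduct.map (TensorProduct.lift (kxBialg k).mul ∘ₗ TensorProduct.map f' h')
        (TensorProduct.lift (kxBialg k).mul ∘ₗ TensorProduct.map f'' h'') z := by
    intro z f' f'' h' h''
    induction z with
    | zero => simp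
    | add a b ha hb => simp only [map_add, ha, hb]
    | tmul x y =>
    induction x with
    | zero => simp
    | add a b ha hb => simp only [map_add, TensorProduct.add_tmul, ha, hb]
    | tmul a b =>
    induction y with
    | zero => simp
    | add a b ha hb => simp only [map_add, TensorProduct.tmul_add, ha, hb]
    | tmul c d =>
      simp only [TensorProduct.tensorTensorTensorComm_tmul, TensorProduct.map_tmul,
        LinearMap.comp_apply, TensorProduct.lift.tmul, M, tensor_mul_tmul]
      rfl
  have h3 : ∀ F H : (KX k →ₗ[k] KX k) ⊗[k] (KX k →ₗ[k] KX k),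
      M (TensorProduct.map (τ F) (τ H) (TensorProduct.map Δ Δ (Δ u))) =
        τ (((convKX k).tensor (convKX k)).mul F H) (Δ u) := by
    intro F H
    induction F with
    | zero => simp
    | add a b ha hb =>
      simp only [map_add, TensorProduct.map_add_left, LinearMap.add_apply, ha, hb]
    | tmul f' f'' =>
    induction H with
    | zero => simp
    | add a b ha hb =>
      simp only [map_add, TensorProduct.map_add_right, LinearMap.add_apply, ha, hb]
    | tmul h' h'' =>
      simp only [τ, TensorProduct.homTensorHomMap_apply, tensor_mul_tmul]
      rw [← comul_comul_interchange, h2, TensorProduct.map_map]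
      rfl
  rw [← h3, ← h1]
  rfl

/-- The comultiplication of `k{X}` intertwines the endomorphisms in the descent algebra with the
comultiplication `x_m ↦ ∑ x_i ⊗ x_{m-i}`. -/
lemma comul_theta (p u : KX k) : (kxBialg k).comul (theta k p u) =
    TensorProduct.homTensorHomMap (RingHom.id k) _ _ _ _
      (TensorProduct.map (theta k) (theta k) ((symBialg k).comul p)) ((kxBialg k).comul u) := by
  induction p using FreeNA.induction_on with
  | hw w =>
    induction w using PTree.induction_on generalizing u with
    | h1 =>
      have h := theta_letter (k := k) 0
      rw [letter_zero] at h
      rw [← letter_zero, theta_letter, comul_degProj, symBialg_comul_letter]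
      simp [h]
    | hl x =>
      rw [← letter_coe, theta_letter, comul_degProj, symBialg_comul_letter]
      simp [theta_letter]
    | hm a b iha ihb =>
      rw [mono_mul, theta_mul, comul_conv iha ihb, ← (theta_isHom.map theta_isHom).map_mul,
        ← symBialg_comul_isHom.map_mul, free_mul]
  | h0 => simp
  | hadd a b ha hb => simp only [map_add, LinearMap.add_apply, ha, hb]
  | hs c a ha => simp only [map_smul, LinearMap.smul_apply, ha]

variable (k) in
/-- The homomorphism `f ↦ ∑ (f I_n) yⁿ` from the convolution algebra to series over it. -/
def compGrade : (KX k →ₗ[k] KX k) →ₗ[k] (ℕ → KX k →ₗ[k] KX k) :=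
  LinearMap.pi fun n => LinearMap.lcomp k _ (degProj k n)

lemma compGrade_apply (f : KX k →ₗ[k] KX k) (n : ℕ) : compGrade k f n = f ∘ₗ degProj k n := rfl

lemma compGrade_isHom : NAlg.IsHom (convKX k) (convKX k).series (compGrade k) := by
  refine ⟨?_, fun f h => ?_⟩
  · ext1 n
    rw [compGrade_apply, series_one, convKX_one]
    refine LinearMap.ext fun u => ?_
    rw [LinearMap.comp_apply, degProj_degProj]
    by_cases h : n = 0
    · simp [h]
    · simp [h, Ne.symm h]
  · ext1 n
    refine LinearMap.ext fun u => ?_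
    rw [compGrade_apply, series_mul, LinearMap.comp_apply, LinearMap.sum_apply, convKX_mul, conv,
      LinearMap.comp_apply, LinearMap.comp_apply, comul_degProj, map_sum, map_sum]
    refine sum_congr rfl fun ij _ => ?_
    rw [TensorProduct.map_map]
    rfl

variable (k) in
/-- The homomorphism `f ↦ ∑ (I_n f) yⁿ` from the convolution algebra to series over it. -/
def gradeComp : (KX k →ₗ[k] KX k) →ₗ[k] (ℕ → KX k →ₗ[k] KX k) :=
  LinearMap.pi fun n => LinearMap.llcomp k _ _ _ (degProj k n)

lemma gradeComp_apply (f : KX k →ₗ[k] KX k) (n : ℕ) : gradeComp k f n = degProj k n ∘ₗ f := rfl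

lemma gradeComp_isHom : NAlg.IsHom (convKX k) (convKX k).series (gradeComp k) := by
  refine ⟨?_, fun f h => ?_⟩
  · ext1 n
    rw [gradeComp_apply, series_one, convKX_one]
    refine LinearMap.ext fun u => ?_
    rw [LinearMap.comp_apply, degProj_degProj]
    split_ifs <;> rfl
  · ext1 n
    refine LinearMap.ext fun u => ?_
    rw [gradeComp_apply, series_mul, LinearMap.comp_apply, LinearMap.sum_apply, convKX_mul, conv]
    simp only [convKX_mul, conv, LinearMap.comp_apply]
    generalize (kxBialg k).comul u = z
    induction z with
    | zero => simp
    | add a b ha hb => simp only [map_add, ha, hb, sum_add_distrib]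
    | tmul a b =>
      exact congrFun (gradeHom_isHom.map_mul (f a) (h b)) n

lemma theta_comp_degProj (p : KX k) (n : ℕ) :
    theta k p ∘ₗ degProj k n = theta k (degProj k n p) := by
  have h : compGrade k ∘ₗ theta k = (theta k).compLeft ℕ ∘ₗ gradeHom k := by
    refine (compGrade_isHom.comp theta_isHom).ext (theta_isHom.series.comp gradeHom_isHom)
      fun x => ?_
    ext1 n
    simp only [LinearMap.comp_apply, compGrade_apply, LinearMap.compLeft_apply,
      Function.comp_apply, gradeHom_apply, ← mono_leaf, degProj_mono, weight_leaf]
    rw [← letter_coe, theta_letter]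
    refine LinearMap.ext fun u => ?_
    rw [LinearMap.comp_apply, degProj_degProj]
    split_ifs with h
    · rw [theta_letter, h]
    · simp
  exact congrFun (LinearMap.congr_fun h p) n

lemma degProj_comp_theta (p : KX k) (n : ℕ) :
    degProj k n ∘ₗ theta k p = theta k (degProj k n p) := by
  have h : gradeComp k ∘ₗ theta k = (theta k).compLeft ℕ ∘ₗ gradeHom k := by
    refine (gradeComp_isHom.comp theta_isHom).ext (theta_isHom.series.comp gradeHom_isHom)
      fun x => ?_
    ext1 n
    simp only [LinearMap.comp_apply, gradeComp_apply, LinearMap.compLeft_apply,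
      Function.comp_apply, gradeHom_apply, ← mono_leaf, degProj_mono, weight_leaf]
    rw [← letter_coe, theta_letter]
    refine LinearMap.ext fun u => ?_
    rw [LinearMap.comp_apply, degProj_degProj]
    by_cases h : n = x
    · rw [if_pos h, if_pos h.symm, theta_letter]
    · rw [if_neg h, if_neg (Ne.symm h)]; simp
  exact congrFun (LinearMap.congr_fun h p) n

variable (k) in
/-- The inner product on `k{X}` corresponding to the composition in the descent algebra: it is
determined by `x_i ⊛ q = I_i q` and the splitting rule `(p p') ⊛ q = ∑ (p ⊛ q₍₁₎) (p' ⊛ q₍₂₎)`, the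
comultiplication of `q` being the one of `symBialg`. -/
def inner : KX k →ₗ[k] KX k →ₗ[k] KX k :=
  symBialg_isBialgebra.convAlg.ev fun i : ℕ+ => degProj k i

lemma inner_one : inner k 1 = degProj k 0 := (NAlg.ev_one _ _).trans convOne_symBialg

lemma inner_gen (i : ℕ+) : inner k (gen k i) = degProj k i := NAlg.ev_gen _ _ _

lemma inner_mul (p q : KX k) : inner k (p * q) = (symBialg k).conv (inner k p) (inner k q) :=
  NAlg.ev_mul _ _ p q

/-- The map `theta` carries the inner product of `k{X}` to the composition of endomorphisms. -/
lemma theta_inner (p q : KX k) : theta k (inner k p q) = theta k p ∘ₗ theta k q := by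
  induction p using FreeNA.induction_on with
  | hw w =>
    induction w using PTree.induction_on generalizing q with
    | h1 =>
      rw [mono_one, inner_one, ← degProj_comp_theta, ← mono_one, ← letter_zero, theta_letter]
    | hl x =>
      rw [mono_leaf, inner_gen, ← degProj_comp_theta, ← mono_leaf, ← letter_coe, theta_letter]
    | hm a b iha ihb =>
      refine LinearMap.ext fun u => ?_
      have key : ∀ z : KX k ⊗[k] KX k,
          theta k (TensorProduct.lift (symBialg k).mul
            (TensorProduct.map (inner k (mono k a)) (inner k (mono k b)) z)) u =
          TensorProduct.lift (kxBialg k).mul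
            (TensorProduct.map (theta k (mono k a)) (theta k (mono k b))
              (TensorProduct.homTensorHomMap (RingHom.id k) _ _ _ _
                (TensorProduct.map (theta k) (theta k) z) ((kxBialg k).comul u))) := fun z => by
        induction z with
        | zero => simp
        | add a b ha hb => simp only [map_add, LinearMap.add_apply, ha, hb]
        | tmul y z =>
          rw [TensorProduct.map_tmul, TensorProduct.lift.tmul, TensorProduct.map_tmul,
            TensorProduct.homTensorHomMap_apply, TensorProduct.map_map, ← iha, ← ihb]
          exact LinearMap.congr_fun (theta_mul _ _) u
      rw [mono_mul, inner_mul, theta_mul, LinearMap.comp_apply]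
      simp only [conv, LinearMap.comp_apply]
      rw [key, ← comul_theta]
  | h0 => simp
  | hadd a b ha hb =>
    rw [map_add, LinearMap.add_apply, map_add, ha, hb, map_add, LinearMap.add_comp]
  | hs c a ha => rw [map_smul, LinearMap.smul_apply, map_smul, ha, map_smul, LinearMap.smul_comp]

/-- The image of `theta` is the descent algebra. -/
lemma range_theta : LinearMap.range (theta k) = descentAlgebra k := by
  refine le_antisymm ?_ (sInf_le ⟨fun n => ⟨_, theta_letter n⟩, ?_⟩)
  · rintro _ ⟨p, rfl⟩
    refine Submodule.mem_sInf.2 fun W hW => ?_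
    induction p using FreeNA.induction_on with
    | hw w =>
      induction w using PTree.induction_on with
      | h1 => rw [← letter_zero, theta_letter]; exact hW.1 0
      | hl x => rw [← letter_coe, theta_letter]; exact hW.1 x
      | hm a b iha ihb => rw [mono_mul, theta_mul]; exact hW.2 _ iha _ ihb
    | h0 => rw [map_zero]; exact zero_mem _
    | hadd a b ha hb => rw [map_add]; exact add_mem ha hb
    | hs c a ha => rw [map_smul]; exact Submodule.smul_mem _ _ ha
  · rintro _ ⟨p, rfl⟩ _ ⟨q, rfl⟩
    exact ⟨p * q, theta_mul p q⟩

end Sym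

/-! ### Logarithms of the identity -/

section Log

open NAlg FreeNA BialgData PTree
open Finset hiding antidiagonal mem_antidiagonal
open Finset.HasAntidiagonal

variable {k : Type*} [Field k]

lemma degProj_mul_of_homogeneous {i j : ℕ} {u v : KX k} (hu : degProj k i u = u)
    (hv : degProj k j v = v) : degProj k (i + j) (u * v) = u * v := by
  have h := congrFun (gradeHom_isHom.map_mul u v) (i + j)
  rw [series_mul, sum_eq_single_of_mem (i, j) (by simp)] at h
  · simpa only [gradeHom_apply, hu, hv, free_mul] using h
  · rintro ⟨a, b⟩ hab hne
    rw [gradeHom_apply, gradeHom_apply, ← hu, ← hv, degProj_degProj, degProj_degProj]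
    by_cases ha : a = i
    · have hb : b ≠ j := by
        rintro rfl
        exact hne (by rw [ha])
      simp [hb]
    · simp [ha]

lemma eventually_sum_degProj (u : KX k) :
    ∀ᶠ N in Filter.atTop, ∑ n ∈ range N, degProj k n u = u := by
  induction u using FreeNA.induction_on with
  | hw w =>
    filter_upwards [Filter.eventually_gt_atTop w.weight] with N hN
    simp only [degProj_mono]
    rw [sum_ite_eq, if_pos (mem_range.2 hN)]
  | h0 => simp
  | hadd a b ha hb =>
    filter_upwards [ha, hb] with N ha hb
    simp only [map_add, sum_add_distrib, ha, hb]
  | hs c a ha =>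
    filter_upwards [ha] with N ha
    simp only [map_smul, ← smul_sum, ha]

lemma eq_zero_of_degProj_eq_zero {u : KX k} (h : ∀ n, degProj k n u = 0) : u = 0 := by
  obtain ⟨N, hN⟩ := (eventually_sum_degProj u).exists
  rw [← hN]
  exact sum_eq_zero fun n _ => h n

lemma symBialg_counit_eq_zero {i : ℕ} (hi : i ≠ 0) {u : KX k} (hu : degProj k i u = u) :
    (symBialg k).counit u = 0 := by
  have h : (symBialg k).counit u • (1 : KX k) = degProj k 0 u :=
    LinearMap.congr_fun convOne_symBialg u
  rw [← hu, degProj_degProj, if_neg (Ne.symm hi), hu, smul_eq_zero] at h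
  refine h.resolve_right ?_
  rw [← mono_one]
  simp

/-- The logarithm `∑ ℓ_n` of the series `∑ x_n` to the base `g`. Up to the scalar `c` with
`g₁ = c x`, its components are primitive free generators of `symBialg`, and so define an
isomorphism with `k{X}` in which the generators are primitive. -/
lemma IsLogBase.exists_log_generators {g : ℕ → FreeNA k Unit} (hg : IsLogBase g) :
    ∃ (c : k) (l : ℕ → KX k) (e : KX k ≃ₗ[k] KX k), g 1 = c • gen k () ∧ l 0 = 0 ∧
      (∀ n, (free k ℕ+).subs g l n = mono k (letter n)) ∧ (∀ n, degProj k n (l n) = l n) ∧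
      (kxBialg k).IsHom (symBialg k) e.toLinearMap ∧ ∀ i : ℕ+, e (gen k i) = c • l i := by
  obtain ⟨c, hc0, hc⟩ := hg.exists_one_eq
  obtain ⟨l, hl0, hl, hlh⟩ := hg.exists_subs_eq (free k ℕ+) (z := fun n => mono k (letter n))
    (fun n => LinearMap.eqLocus (degProj k n) LinearMap.id) (by simp [free_one, degProj_one])
    (fun i j u hu v hv => degProj_mul_of_homogeneous hu hv) rfl (fun n => by
      cases n with
      | zero => simp [mono_one, degProj_one]
      | succ n => simp [letter, degProj_mono])
  replace hlh : ∀ n, degProj k n (l n) = l n := hlh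
  -- The inverse of `x_i ↦ c ℓ_i` is given by `x_i ↦ q_i`, where `q = g(c⁻¹ (x₁ + x₂ + …))`.
  let x' : ℕ → KX k := fun n => if n = 0 then 0 else c⁻¹ • mono k (letter n)
  let q : ℕ → KX k := (free k ℕ+).subs g x'
  let η : KX k →ₗ[k] KX k := (free k ℕ+).ev fun i : ℕ+ => c • l i
  let κ : KX k →ₗ[k] KX k := (free k ℕ+).ev fun i : ℕ+ => q i
  have hη : NAlg.IsHom (free k ℕ+) (free k ℕ+) η := NAlg.ev_isHom _ _
  have hκ : NAlg.IsHom (free k ℕ+) (free k ℕ+) κ := NAlg.ev_isHom _ _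
  have hηx (n : ℕ) : η (x' n) = l n := by
    cases n with
    | zero => simp [x', hl0]
    | succ n =>
      simp only [x', n.succ_ne_zero, if_false, map_smul]
      rw [show η (mono k (letter (n + 1))) = _ from NAlg.ev_gen _ _ _, smul_smul,
        inv_mul_cancel₀ hc0, one_smul]
      rfl
  have hηκ : η ∘ₗ κ = LinearMap.id := by
    refine (hη.comp hκ).ext (NAlg.IsHom.id _) fun i => ?_
    rw [LinearMap.comp_apply, show κ (gen k i) = q i from NAlg.ev_gen _ _ _, hη.subs]
    simp only [hηx, hl, letter_coe]
    rfl
  have hκx (n : ℕ) : κ (mono k (letter n)) = q n := by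
    cases n with
    | zero => exact hκ.map_one.trans (hg.subs_zero _ _).symm
    | succ n => exact NAlg.ev_gen _ _ _
  have hκl : (fun n => κ (l n)) = x' := by
    refine hg.subs_injective (free k ℕ+) (by simp [hl0]) (by simp [x']) fun n => ?_
    rw [← hκ.subs, hl, hκx]
  have hκη : κ ∘ₗ η = LinearMap.id := by
    refine (hκ.comp hη).ext (NAlg.IsHom.id _) fun i => ?_
    rw [LinearMap.comp_apply, show η (gen k i) = c • l i from NAlg.ev_gen _ _ _, map_smul,
      congrFun hκl i]
    simp only [x', i.pos.ne', if_false, smul_smul, mul_inv_cancel₀ hc0, one_smul, letter_coe]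
    rfl
  refine ⟨c, l, LinearEquiv.ofLinearMap η κ hηκ hκη, hc, hl0, hl, hlh, ?_,
    fun i => NAlg.ev_gen _ _ _⟩
  refine ⟨hη.map_one, hη.map_mul, fun u => ?_, fun u => ?_⟩
  · have hprim := hg.primitive_of_subs_grouplike (free k ℕ+) symBialg_comul_isHom hl0 hl
      symBialg_comul_letter
    refine LinearMap.congr_fun ((symBialg_comul_isHom.comp hη).ext
      ((hη.map hη).comp freeBialg_comul_isHom) fun i => ?_) u
    rw [LinearMap.comp_apply, LinearMap.comp_apply, freeBialg_comul_gen, map_add,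
      TensorProduct.map_tmul, TensorProduct.map_tmul, show η 1 = 1 from hη.map_one,
      show η (gen k i) = c • l i from NAlg.ev_gen _ _ _, map_smul, hprim, smul_add,
      TensorProduct.smul_tmul', TensorProduct.tmul_smul]
    rfl
  · have h1 : NAlg.IsHom (free k ℕ+) (NAlg.base k) (kxBialg k).counit := by
      rw [kxBialg, freeBialg_eq]; exact ofComul_counit_isHom _
    have h2 : NAlg.IsHom (free k ℕ+) (NAlg.base k) (symBialg k).counit := ofComul_counit_isHom _
    refine LinearMap.congr_fun ((h2.comp hη).ext h1 fun i => ?_) u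
    rw [LinearMap.comp_apply, show η (gen k i) = c • l i from NAlg.ev_gen _ _ _, map_smul,
      freeBialg_counit_gen, symBialg_counit_eq_zero i.pos.ne' (hlh i), smul_zero]

/-- A convolution logarithm, in terms of the series `∑ (L I_n) yⁿ`. -/
lemma IsLogBase.isConvLog_iff {g : ℕ → FreeNA k Unit} (hg : IsLogBase g)
    (L : KX k →ₗ[k] KX k) : IsConvLog g L ↔ compGrade k L 0 = 0 ∧
      ∀ n, (convKX k).subs g (compGrade k L) n = degProj k n := by
  have hev (N n : ℕ) : convEval (g N) L ∘ₗ degProj k n =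
      (convKX k).series.ev (fun _ => compGrade k L) (g N) n :=
    congrFun (compGrade_isHom.apply_ev (fun _ => L) (g N)) n
  have hL0 : L 1 = 0 ↔ compGrade k L 0 = 0 := by
    constructor
    · intro h
      refine hom_ext fun w => ?_
      rw [compGrade_apply, LinearMap.comp_apply, degProj_mono]
      split_ifs with hw
      · rw [eq_one_of_weight_eq_zero hw, mono_one, h]; rfl
      · simp
    · intro h
      have := LinearMap.congr_fun h 1
      rwa [compGrade_apply, LinearMap.comp_apply, degProj_one, if_pos rfl] at this
  rw [IsConvLog, hL0]
  refine and_congr_right fun h0 => ⟨fun h n => LinearMap.ext fun u => ?_, fun h u => ?_⟩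
  · obtain ⟨M, hM, hM'⟩ := ((h (degProj k n u)).and (Filter.eventually_gt_atTop n)).exists
    rw [hg.subs_eq_sum_range _ h0 hM', LinearMap.sum_apply]
    simp only [← hev]
    exact hM
  · induction u using FreeNA.induction_on with
    | hw w =>
      filter_upwards [Filter.eventually_gt_atTop w.weight] with M hM
      have := hg.subs_eq_sum_range (convKX k) h0 hM
      rw [h] at this
      have := LinearMap.congr_fun this (mono k w)
      rw [LinearMap.sum_apply, degProj_mono, if_pos rfl] at this
      simp only [← hev, LinearMap.comp_apply, degProj_mono, if_true] at this
      exact this.symm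
    | h0 => simp
    | hadd a b ha hb =>
      filter_upwards [ha, hb] with N ha hb
      simp only [map_add, sum_add_distrib, ha, hb]
    | hs c a ha =>
      filter_upwards [ha] with N ha
      simp only [map_smul, ← smul_sum, ha]

lemma compGrade_injective : Function.Injective (compGrade k) := fun f h hfh => hom_ext fun w => by
  have := LinearMap.congr_fun (congrFun hfh w.weight) (mono k w)
  rwa [compGrade_apply, compGrade_apply, LinearMap.comp_apply, LinearMap.comp_apply, degProj_mono,
    if_pos rfl] at this

/-- The convolution logarithm to the base `g` of the identity is unique, and its homogeneous
components are the images of the components of the logarithm of `∑ x_n`. -/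
lemma IsLogBase.exists_convLog {g : ℕ → FreeNA k Unit} (hg : IsLogBase g) {l : ℕ → KX k}
    (hl0 : l 0 = 0) (hl : ∀ n, (free k ℕ+).subs g l n = mono k (letter n))
    (hlh : ∀ n, degProj k n (l n) = l n) :
    ∃ L : KX k →ₗ[k] KX k, (∀ L', IsConvLog g L' ↔ L' = L) ∧
      ∀ i, degProj k i ∘ₗ L = theta k (l i) := by
  let L : KX k →ₗ[k] KX k := (MonoidAlgebra.basis (PTree ℕ+) k).constr k
    fun w => theta k (l w.weight) (mono k w)
  have hL (w : PTree ℕ+) : L (mono k w) = theta k (l w.weight) (mono k w) := constr_mono _ w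
  have hθ (i : ℕ) (w : PTree ℕ+) :
      theta k (l i) (mono k w) = if w.weight = i then L (mono k w) else 0 := by
    split_ifs with h
    · rw [hL, h]
    · rw [← hlh, ← theta_comp_degProj, LinearMap.comp_apply, degProj_mono, if_neg h, map_zero]
  have hLg : compGrade k L = fun n => theta k (l n) := by
    ext1 n
    refine hom_ext fun w => ?_
    rw [compGrade_apply, LinearMap.comp_apply, degProj_mono, hθ]
    split_ifs
    · rfl
    · rw [map_zero]
  have hsub (n : ℕ) : (convKX k).subs g (compGrade k L) n = degProj k n := by
    rw [hLg, ← theta_isHom.subs, hl, theta_letter]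
  have h0 : compGrade k L 0 = 0 := by simp only [hLg, hl0, map_zero]
  refine ⟨L, fun L' => ⟨fun h => ?_, ?_⟩, fun i => hom_ext fun w => ?_⟩
  · rw [hg.isConvLog_iff] at h
    exact compGrade_injective (hg.subs_injective (convKX k) h.1 h0 fun n => by rw [h.2, hsub])
  · rintro rfl
    exact (hg.isConvLog_iff _).2 ⟨h0, hsub⟩
  · rw [LinearMap.comp_apply, hθ, hL, ← LinearMap.comp_apply, degProj_comp_theta, ← hlh,
      degProj_degProj, hlh]
    by_cases h : i = w.weight
    · rw [if_pos h, if_pos h.symm]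
    · rw [if_neg h, if_neg (Ne.symm h), map_zero, LinearMap.zero_apply]

/-- The endomorphisms `theta w` are linearly independent. This is seen by evaluating them on a
group-like series `∑ q_n` whose components are free generators of `k{X}`: the component of degree
`n` of `∑ theta w (q_n)` is the word `w` in the `q_i` if `|w| = n`. -/
lemma theta_injective [CharZero k] : Function.Injective (theta k) := by
  obtain ⟨c, l, e, -, -, -, hlh, he, hel⟩ := (expSeries_isLogBase k).exists_log_generators
  have heA : NAlg.IsHom (free k ℕ+) (free k ℕ+) e.toLinearMap := ⟨he.map_one, he.map_mul⟩
  have hκ := he.symm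
  have hκA : NAlg.IsHom (free k ℕ+) (free k ℕ+) e.symm.toLinearMap := ⟨hκ.map_one, hκ.map_mul⟩
  have hdeg (n : ℕ) (u : KX k) : degProj k n (e u) = e (degProj k n u) := by
    have : gradeHom k ∘ₗ e.toLinearMap = e.toLinearMap.compLeft ℕ ∘ₗ gradeHom k := by
      refine (gradeHom_isHom.comp heA).ext (heA.series.comp gradeHom_isHom) fun i => ?_
      ext1 n
      change degProj k n (e (gen k i)) = e (degProj k n (gen k i))
      rw [hel, map_smul, ← hlh i, degProj_degProj, hlh, ← mono_leaf, degProj_mono, weight_leaf,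
        mono_leaf]
      by_cases h : n = i
      · rw [if_pos h, if_pos h.symm, hel]
      · rw [if_neg h, if_neg (Ne.symm h), map_zero, smul_zero]
    exact congrFun (LinearMap.congr_fun this u) n
  let q : ℕ → KX k := fun n => e.symm (mono k (letter n))
  have hqn (m n : ℕ) : degProj k m (q n) = if m = n then q n else 0 := by
    apply e.injective
    rw [← hdeg]
    simp only [q, LinearEquiv.apply_symm_apply]
    have : degProj k n (mono k (letter n)) = mono k (letter n) := by
      cases n with
      | zero => rw [letter_zero, mono_one, degProj_one, if_pos rfl]
      | succ n => simp [letter, degProj_mono]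
    rw [← this, degProj_degProj, this]
    split_ifs
    · simp
    · simp
  let E : (KX k →ₗ[k] KX k) →ₗ[k] (ℕ → KX k) := LinearMap.pi fun n => LinearMap.applyₗ (q n)
  have hE : NAlg.IsHom (convKX k) (free k ℕ+).series E := by
    refine ⟨?_, fun f h => ?_⟩
    · ext1 n
      change (convKX k).one (q n) = _
      rw [convKX_one, hqn, series_one]
      by_cases h : n = 0
      · subst h
        rw [if_pos rfl, if_pos rfl]
        exact hκ.map_one
      · rw [if_neg h, if_neg (Ne.symm h)]
    · ext1 n
      change (convKX k).mul f h (q n) = _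
      rw [convKX_mul, conv, LinearMap.comp_apply, LinearMap.comp_apply,
        show (kxBialg k).comul (q n) = _ from hκ.map_comul _, symBialg_comul_letter, series_mul]
      simp only [map_sum, TensorProduct.map_tmul, TensorProduct.lift.tmul]
      rfl
  have key : E ∘ₗ theta k = e.symm.toLinearMap.compLeft ℕ ∘ₗ gradeHom k := by
    refine (hE.comp theta_isHom).ext (hκA.series.comp gradeHom_isHom) fun i => ?_
    ext1 n
    change theta k (gen k i) (q n) = e.symm (degProj k n (gen k i))
    rw [← mono_leaf, ← letter_coe, theta_letter, hqn, letter_coe, degProj_mono, weight_leaf]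
    split_ifs with h
    · simp only [q, ← letter_coe, h]
    · rw [map_zero]
  rw [injective_iff_map_eq_zero]
  intro p hp
  refine eq_zero_of_degProj_eq_zero fun n => ?_
  have := congrFun (LinearMap.congr_fun key p) n
  rw [LinearMap.comp_apply, hp, map_zero] at this
  exact (e.symm.map_eq_zero_iff).1 this.symm

variable (k) in
/-- The identification of the descent algebra with the free algebra. -/
def thetaEquiv [CharZero k] : KX k ≃ₗ[k] descentAlgebra k :=
  (LinearEquiv.ofInjective (theta k) theta_injective).trans (LinearEquiv.ofEq _ _ range_theta)

lemma thetaEquiv_apply [CharZero k] (p : KX k) :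
    (thetaEquiv k p : KX k →ₗ[k] KX k) = theta k p := rfl

end Log

/-! ### Substitution in trees -/

namespace PTree

variable {X Y Z : Type*}

@[simp] lemma subst_one (f : X → PTree Y) : subst f 1 = 1 := rfl

@[simp] lemma subst_leaf (f : X → PTree Y) (x : X) : subst f (leaf x) = f x := rfl

lemma subst_subst (g : Y → PTree Z) (f : X → PTree Y) (w : PTree X) :
    subst g (subst f w) = subst (fun x => subst g (f x)) w := by
  induction w using induction_on with
  | h1 => rfl
  | hl x => rfl
  | hm a b iha ihb => simp only [subst_mul, iha, ihb]

lemma subst_map (g : Y → PTree Z) (f : X → Y) (w : PTree X) :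
    subst g (map f w) = subst (fun x => g (f x)) w := subst_subst _ _ _

lemma map_subst (g : Y → Z) (f : X → PTree Y) (w : PTree X) :
    map g (subst f w) = subst (fun x => map g (f x)) w := subst_subst _ _ _

lemma map_map (g : Y → Z) (f : X → Y) (w : PTree X) :
    map g (map f w) = map (fun x => g (f x)) w := subst_subst _ _ _

@[simp] lemma map_mul (f : X → Y) (w v : PTree X) : map f (w * v) = map f w * map f v :=
  subst_mul _ w v

lemma subst_const_one (w : PTree X) : subst (fun _ => (1 : PTree Y)) w = 1 := by
  induction w using induction_on with
  | h1 => rfl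
  | hl x => rfl
  | hm a b iha ihb => rw [subst_mul, iha, ihb, one_mul]

lemma shape_map (f : X → Y) (w : PTree X) : shape (map f w) = shape w := map_map _ _ _

lemma length_leaves_shape (w : PTree X) : (shape w).leaves.length = w.leaves.length := by
  rw [shape, leaves_map, List.length_map]

/-- The leaves of a given tree can be labelled by any list of the right length. -/
lemma exists_shape_leaves (t : PTree Unit) (l : List X) (h : t.leaves.length = l.length) :
    ∃ w : PTree X, shape w = t ∧ w.leaves = l := by
  induction t using induction_on generalizing l with
  | h1 => exact ⟨1, rfl, (List.length_eq_zero_iff.1 h.symm).symm⟩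
  | hl u =>
    obtain ⟨x, rfl⟩ := List.length_eq_one_iff.1 h.symm
    exact ⟨leaf x, rfl, rfl⟩
  | hm a b iha ihb =>
    rw [leaves_mul, List.length_append] at h
    obtain ⟨u, hu, hu'⟩ := iha (l.take a.leaves.length) (by simp; omega)
    obtain ⟨v, hv, hv'⟩ := ihb (l.drop a.leaves.length) (by simp; omega)
    exact ⟨u * v, by rw [shape, map_mul, ← shape, ← shape, hu, hv], by
      rw [leaves_mul, hu', hv', List.take_append_drop]⟩

end PTree

/-! ### Reduction of symbols -/

namespace Symb

variable {m n : ℕ}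

open scoped Classical in
/-- The leaf labelled `A`, or the empty tree if `A` is empty. -/
def pruneLeaf (A : Finset (Fin m)) : PTree (Finset (Fin m)) :=
  if A.Nonempty then PTree.leaf A else 1

@[simp] lemma pruneLeaf_empty : pruneLeaf (∅ : Finset (Fin m)) = 1 := by simp [pruneLeaf]

lemma prune_eq (w : PTree (Finset (Fin m))) : prune w = w.subst pruneLeaf := rfl

lemma subst_prune {Y : Type*} {g : Finset (Fin m) → PTree Y} (hg : g ∅ = 1)
    (w : PTree (Finset (Fin m))) : (prune w).subst g = w.subst g := by
  rw [prune_eq, PTree.subst_subst]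
  congr 1
  funext A
  rcases A.eq_empty_or_nonempty with rfl | h
  · rw [pruneLeaf_empty, PTree.subst_one, hg]
  · rw [pruneLeaf, if_pos h, PTree.subst_leaf]

lemma reduce_tree (s : Symb m) : s.reduce.symb.tree = prune s.tree := rfl

lemma reduce_congr {s s' : Symb m} (h : s.tree.subst pruneLeaf = s'.tree.subst pruneLeaf) :
    s.reduce = s'.reduce := Comperm.ext (Symb.ext h)

lemma F_congr {k : Type*} [Field k] {s s' : Symb m}
    (h : s.tree.subst pruneLeaf = s'.tree.subst pruneLeaf) : F k s = F k s' := by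
  rw [F, F, reduce_congr h]

lemma comap_tree (f : Fin n → Fin m) (s : Symb m) :
    (s.comap f).tree = s.tree.map fun A => Finset.univ.filter fun i => f i ∈ A := rfl

lemma F_comap_reduce {k : Type*} [Field k] (f : Fin n → Fin m) (s : Symb m) :
    F k (s.reduce.symb.comap f) = F k (s.comap f) := by
  refine F_congr ?_
  rw [comap_tree, comap_tree, PTree.subst_map, PTree.subst_map, reduce_tree, subst_prune (by simp)]

lemma F_cast {k : Type*} [Field k] (h : n = m) (s : Symb m) :
    F k (s.comap (Fin.cast h)) = F k s := by
  subst h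
  refine F_congr ?_
  rw [comap_tree, PTree.subst_map]
  simp

lemma graft_tree (s : Symb m) (s' : Symb n) : (s.graft s').tree =
    s.tree.map (fun A => A.map (Fin.castAddEmb n)) *
      s'.tree.map (fun A => A.map (Fin.natAddEmb m)) := rfl

lemma F_graft_reduce {k : Type*} [Field k] (s : Symb m) (s' : Symb n)
    (γ : Equiv.Perm (Fin (m + n))) :
    F k ((s.reduce.symb.graft s'.reduce.symb).act γ) = F k ((s.graft s').act γ) := by
  refine F_congr ?_
  simp only [act, comap_tree, graft_tree, PTree.subst_map, PTree.map_mul, PTree.map_map,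
    PTree.subst_mul, reduce_tree]
  rw [subst_prune (by simp), subst_prune (by simp)]

lemma bullet_tree (s s' : Symb m) : (s.bullet s').tree =
    s.tree.subst fun A => s'.tree.map fun B => A.map s'.perm.toEmbedding ∩ B := rfl

end Symb

section Operations

open Symb

variable {k : Type*} [Field k] {m n : ℕ}

lemma compermBialg_mul_F (s : Symb m) (s' : Symb n) : (compermBialg k).mul (F k s) (F k s') =
    ∑ γ ∈ shuffles m n, F k ((s.graft s').act γ) := by
  simp only [compermBialg, F, Finsupp.linearCombination_single, one_smul]
  exact Finset.sum_congr rfl fun γ _ => F_graft_reduce s s' γ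

lemma compermBialg_comul_F (s : Symb m) : (compermBialg k).comul (F k s) =
    ∑ p : Fin (m + 1), F k (s.restrictLow p) ⊗ₜ[k] F k (s.restrictHigh p) := by
  simp only [compermBialg, F, Finsupp.linearCombination_single, one_smul]
  exact Finset.sum_congr rfl fun p _ => congrArg₂ _ (F_comap_reduce _ s) (F_comap_reduce _ s)

lemma compermBialg_counit_F (s : Symb m) :
    (compermBialg k).counit (F k s) = if m = 0 then 1 else 0 := by
  simp [compermBialg, F, Finsupp.linearCombination_single]

lemma bulletMul_F (s s' : Symb m) :
    bulletMul k (F k s) (F k s') = F k (s.reduce.symb.bullet s'.reduce.symb) := by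
  simp [bulletMul, F, Finsupp.linearCombination_single]

lemma bulletMul_F_of_ne (h : n ≠ m) (s : Symb m) (s' : Symb n) :
    bulletMul k (F k s) (F k s') = 0 := by
  simp [bulletMul, F, Finsupp.linearCombination_single, h]

lemma perm_eq_one_of_strictMono {γ : Equiv.Perm (Fin m)} (h : StrictMono γ) : γ = 1 := by
  have : (γ : Fin m → Fin m) = id :=
    h.range_inj strictMono_id |>.1 (by rw [γ.surjective.range_eq, Set.range_id])
  exact Equiv.ext fun i => congrFun this i

lemma shuffles_zero_left (n : ℕ) : shuffles 0 n = {1} := by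
  ext γ
  simp only [shuffles, Finset.mem_filter, Finset.mem_univ, true_and, Finset.mem_singleton]
  constructor
  · rintro ⟨-, h⟩
    refine perm_eq_one_of_strictMono fun i j hij => ?_
    have := h (a := Fin.cast (zero_add n) i) (b := Fin.cast (zero_add n) j) hij
    simpa using this
  · rintro rfl
    exact ⟨fun i => i.elim0, fun i j hij => by simpa using hij⟩

lemma shuffles_zero_right (m : ℕ) : shuffles m 0 = {1} := by
  ext γ
  simp only [shuffles, Finset.mem_filter, Finset.mem_univ, true_and, Finset.mem_singleton]
  constructor
  · rintro ⟨h, -⟩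
    refine perm_eq_one_of_strictMono fun i j hij => ?_
    exact h (a := i) (b := j) hij
  · rintro rfl
    exact ⟨fun i j hij => by simpa using hij, fun i => i.elim0⟩

lemma hom_ext_F {V : Type*} [AddCommGroup V] [Module k V] {f g : KComperm k →ₗ[k] V}
    (h : ∀ (m : ℕ) (s : Symb m), f (F k s) = g (F k s)) : f = g := by
  refine Finsupp.lhom_ext' fun ⟨m, c⟩ => LinearMap.ext_ring ?_
  have hc : c.symb.reduce = c := by
    refine Comperm.ext (Symb.ext ?_)
    rw [reduce_tree, prune_eq]
    have : ∀ w : PTree (Finset (Fin m)), (∀ A ∈ w.leaves, A.Nonempty) → w.subst pruneLeaf = w := by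
      intro w
      induction w using PTree.induction_on with
      | h1 => intro _; rfl
      | hl A =>
        intro h
        rw [PTree.subst_leaf, pruneLeaf, if_pos (h A (by simp))]
      | hm a b iha ihb =>
        intro h
        rw [PTree.subst_mul, iha fun A hA => h A (by simp [hA]), ihb fun A hA => h A (by simp [hA])]
    exact this _ c.reduced
  have := h m c.symb
  rwa [F, hc] at this

variable (k) in
/-- The algebra of compermutations with the outer product. -/
def compermAlg : NAlg k (KComperm k) where
  mul := (compermBialg k).mul
  one := (compermBialg k).one
  unit_mul u := by
    have : (compermBialg k).mul (compermBialg k).one = LinearMap.id := hom_ext_F fun m s => by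
      change (compermBialg k).mul (F k Symb.empty) (F k s) = F k s
      rw [compermBialg_mul_F, shuffles_zero_left, Finset.sum_singleton,
        ← F_cast (k := k) (zero_add m) s]
      refine F_congr ?_
      simp only [act, comap_tree, graft_tree, PTree.subst_map, PTree.map_mul, PTree.map_map,
        PTree.subst_mul]
      change 1 * _ = _
      rw [one_mul]
      congr 1
      funext A
      congr 1
      ext i
      simp only [Finset.mem_filter, Finset.mem_univ, true_and, Finset.mem_map,
        ← Equiv.Perm.inv_def, inv_one, Equiv.Perm.one_apply, Fin.natAddEmb_apply]
      constructor
      · rintro ⟨a, ha, rfl⟩; simpa using ha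
      · intro h; exact ⟨_, h, by ext; simp⟩
    exact LinearMap.congr_fun this u
  mul_unit u := by
    have : (compermBialg k).mul.flip (compermBialg k).one = LinearMap.id := hom_ext_F fun m s => by
      change (compermBialg k).mul (F k s) (F k Symb.empty) = F k s
      rw [compermBialg_mul_F, shuffles_zero_right, Finset.sum_singleton,
        ← F_cast (k := k) (add_zero m) s]
      refine F_congr ?_
      simp only [act, comap_tree, graft_tree, PTree.subst_map, PTree.map_mul, PTree.map_map,
        PTree.subst_mul]
      change _ * 1 = _
      rw [mul_one]
      congr 1
      funext A
      congr 1
      ext i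
      simp only [Finset.mem_filter, Finset.mem_univ, true_and, Finset.mem_map,
        ← Equiv.Perm.inv_def, inv_one, Equiv.Perm.one_apply, Fin.castAddEmb_apply]
      constructor
      · rintro ⟨a, ha, rfl⟩; simpa using ha
      · intro h; exact ⟨_, h, by ext; simp⟩
    exact LinearMap.congr_fun this u

end Operations

/-! ### Symbols defined by functions -/

/-- A planar binary rooted tree whose leaves are labelled bijectively by `J`. Symbols with this
underlying tree are the same thing as functions `Fin m → J`, see `LinTree.comap`. -/
structure LinTree (J : Type) where
  tree : PTree J
  nodup : tree.leaves.Nodup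
  mem_leaves : ∀ j, j ∈ tree.leaves

/-- The fibre of a function. -/
def fib {J : Type} [DecidableEq J] {m : ℕ} (h : Fin m → J) (j : J) : Finset (Fin m) :=
  Finset.univ.filter fun i => h i = j

/-- The sizes of the fibres of a function. -/
def cnt {J : Type} [DecidableEq J] {m : ℕ} (h : Fin m → J) (j : J) : ℕ := (fib h j).card

namespace LinTree

variable {J J' J₁ J₂ : Type} {m n : ℕ}

/-- The empty tree. -/
def nil : LinTree Empty := ⟨1, List.nodup_nil, fun j => j.elim⟩

/-- The tree with one leaf. -/
def single : LinTree Unit :=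
  ⟨PTree.leaf (), List.nodup_singleton _, fun _ => List.mem_singleton.2 rfl⟩

/-- The grafting of two trees. -/
def sum (T₁ : LinTree J₁) (T₂ : LinTree J₂) : LinTree (J₁ ⊕ J₂) where
  tree := T₁.tree.map Sum.inl * T₂.tree.map Sum.inr
  nodup := by
    rw [PTree.leaves_mul, PTree.leaves_map, PTree.leaves_map]
    refine (T₁.nodup.map Sum.inl_injective).append (T₂.nodup.map Sum.inr_injective) ?_
    intro j h₁ h₂
    obtain ⟨_, _, rfl⟩ := List.mem_map.1 h₁
    simp at h₂
  mem_leaves j := by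
    rcases j with j | j
    · simpa using T₁.mem_leaves j
    · simpa using T₂.mem_leaves j

/-- The tree with a copy of `T'` in each leaf of `T`. -/
def prod (T : LinTree J) (T' : LinTree J') : LinTree (J × J') where
  tree := T.tree.subst fun j => T'.tree.map (Prod.mk j)
  nodup := by
    rw [PTree.leaves_subst, List.nodup_flatMap]
    refine ⟨fun j _ => ?_, T.nodup.imp fun {a b} hab => ?_⟩
    · rw [PTree.leaves_map]
      exact T'.nodup.map (Prod.mk_right_injective j)
    · intro x h₁ h₂
      dsimp only at h₁ h₂
      rw [PTree.leaves_map] at h₁ h₂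
      obtain ⟨_, _, rfl⟩ := List.mem_map.1 h₁
      obtain ⟨_, _, h⟩ := List.mem_map.1 h₂
      exact hab (Prod.ext_iff.1 h).1.symm
  mem_leaves := fun ⟨j, j'⟩ => by
    simpa using ⟨T.mem_leaves j, T'.mem_leaves j'⟩

lemma sum_tree (T₁ : LinTree J₁) (T₂ : LinTree J₂) :
    (T₁.sum T₂).tree = T₁.tree.map Sum.inl * T₂.tree.map Sum.inr := rfl

lemma prod_tree (T : LinTree J) (T' : LinTree J') :
    (T.prod T').tree = T.tree.subst fun j => T'.tree.map (Prod.mk j) := rfl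

/-- The function on `Fin (m + n)` composed of functions on `Fin m` and `Fin n`. -/
def join (h₁ : Fin m → J₁) (h₂ : Fin n → J₂) (i : Fin (m + n)) : J₁ ⊕ J₂ :=
  Sum.map h₁ h₂ (finSumFinEquiv.symm i)

@[simp] lemma join_castAdd (h₁ : Fin m → J₁) (h₂ : Fin n → J₂) (i : Fin m) :
    join h₁ h₂ (Fin.castAdd n i) = Sum.inl (h₁ i) := by simp [join]

@[simp] lemma join_natAdd (h₁ : Fin m → J₁) (h₂ : Fin n → J₂) (i : Fin n) :
    join h₁ h₂ (Fin.natAdd m i) = Sum.inr (h₂ i) := by simp [join]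

variable [DecidableEq J] [DecidableEq J'] [DecidableEq J₁] [DecidableEq J₂]

/-- The symbol with underlying tree `T` whose pseudo-composition consists of the fibres of `h`. -/
def comap (T : LinTree J) (h : Fin m → J) : Symb m :=
  ⟨T.tree.map (fib h), fun i => by
    rw [PTree.leaves_map, List.countP_map,
      ← List.count_eq_one_of_mem T.nodup (T.mem_leaves (h i)), List.count]
    refine List.countP_congr fun j _ => ?_
    simp only [Function.comp_apply, fib, decide_eq_true_eq, Finset.mem_filter, Finset.mem_univ,
      true_and, beq_iff_eq]
    exact eq_comm⟩

lemma comap_tree (T : LinTree J) (h : Fin m → J) : (T.comap h).tree = T.tree.map (fib h) := rfl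

lemma comap_comap (T : LinTree J) (h : Fin m → J) (f : Fin n → Fin m) :
    (T.comap h).comap f = T.comap (fun i => h (f i)) := by
  refine Symb.ext ?_
  rw [Symb.comap_tree, comap_tree, comap_tree, PTree.map_map]
  congr 1
  funext j
  simp [fib]

lemma fib_join_inl (h₁ : Fin m → J₁) (h₂ : Fin n → J₂) (j : J₁) :
    fib (join h₁ h₂) (Sum.inl j) = (fib h₁ j).map (Fin.castAddEmb n) := by
  ext i
  refine Fin.addCases (fun i => ?_) (fun i => ?_) i
  · simp [fib]
  · simp [fib, Fin.ext_iff]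
    intro a _ h
    have := a.2
    omega

lemma fib_join_inr (h₁ : Fin m → J₁) (h₂ : Fin n → J₂) (j : J₂) :
    fib (join h₁ h₂) (Sum.inr j) = (fib h₂ j).map (Fin.natAddEmb m) := by
  ext i
  refine Fin.addCases (fun i => ?_) (fun i => ?_) i
  · simp [fib, Fin.ext_iff]
    intro a _ h
    have := i.2
    omega
  · simp [fib]

lemma graft_comap (T₁ : LinTree J₁) (T₂ : LinTree J₂) (h₁ : Fin m → J₁) (h₂ : Fin n → J₂) :
    (T₁.comap h₁).graft (T₂.comap h₂) = (T₁.sum T₂).comap (join h₁ h₂) := by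
  refine Symb.ext ?_
  simp only [Symb.graft_tree, comap_tree, sum_tree, PTree.map_mul, PTree.map_map, fib_join_inl,
    fib_join_inr]

/-- The symbol `tπ • t'π'`, for the symbols `tπ` and `t'π'` defined by the functions `h` and `h'`,
is defined by the function `i ↦ (h (σ⁻¹ i), h' i)`. -/
lemma F_bullet_comap {k : Type*} [Field k] (T : LinTree J) (T' : LinTree J') (h : Fin m → J)
    (h' : Fin m → J') :
    F k ((T.comap h).reduce.symb.bullet (T'.comap h').reduce.symb) =
      F k ((T.prod T').comap fun i => (h ((T'.comap h').reduce.symb.perm.symm i), h' i)) := by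
  refine Symb.F_congr ?_
  rw [Symb.bullet_tree]
  generalize (T'.comap h').reduce.symb.perm = σ
  simp only [PTree.subst_subst, PTree.subst_map, comap_tree, prod_tree, Symb.reduce_tree]
  have h1 (A : Finset (Fin m)) :
      (Symb.prune (T'.tree.map (fib h'))).subst
        (fun B => Symb.pruneLeaf (A.map σ.toEmbedding ∩ B)) =
      T'.tree.subst fun j => Symb.pruneLeaf (A.map σ.toEmbedding ∩ fib h' j) := by
    rw [Symb.subst_prune (by simp), PTree.subst_map]
  simp only [h1]
  rw [Symb.subst_prune (by simpa using PTree.subst_const_one _), PTree.subst_map]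
  congr 1
  funext j
  congr 1
  funext j'
  congr 1
  ext i
  simp [fib, Finset.mem_map_equiv]

end LinTree

/-! ### Sizes of fibres and shuffles -/

section Count

open Finset

variable {J J' J₁ J₂ : Type} [DecidableEq J] [DecidableEq J'] [DecidableEq J₁] [DecidableEq J₂]
  {m n : ℕ}

lemma cnt_eq_sum (h : Fin m → J) (j : J) : cnt h j = ∑ i, if h i = j then 1 else 0 := by
  rw [cnt, fib, card_filter]

lemma cnt_comp_equiv (e : Fin n ≃ Fin m) (h : Fin m → J) : cnt (fun i => h (e i)) = cnt h := by
  funext j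
  rw [cnt_eq_sum, cnt_eq_sum]
  exact e.sum_comp fun i => if h i = j then 1 else 0

lemma cnt_equiv_comp (e : J ≃ J') (h : Fin m → J) (j : J) :
    cnt (fun i => e (h i)) (e j) = cnt h j := by
  simp [cnt, fib]

lemma sum_cnt [Fintype J] (h : Fin m → J) : ∑ j, cnt h j = m := by
  simp only [cnt_eq_sum]
  rw [sum_comm]
  simp

lemma sum_cnt_fst [Fintype J'] (h : Fin m → J × J') (j : J) :
    ∑ j', cnt h (j, j') = cnt (fun i => (h i).1) j := by
  simp only [cnt_eq_sum]
  rw [sum_comm]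
  refine sum_congr rfl fun i _ => ?_
  obtain ⟨a, b⟩ := h i
  by_cases hj : a = j <;> simp [hj]

lemma sum_cnt_snd [Fintype J] (h : Fin m → J × J') (j' : J') :
    ∑ j, cnt h (j, j') = cnt (fun i => (h i).2) j' := by
  simp only [cnt_eq_sum]
  rw [sum_comm]
  refine sum_congr rfl fun i _ => ?_
  obtain ⟨a, b⟩ := h i
  by_cases hj : b = j' <;> simp [hj]

lemma sum_cnt_inl [Fintype J₁] (h : Fin m → J₁ ⊕ J₂) :
    ∑ j, cnt h (Sum.inl j) = (univ.filter fun i => (h i).isLeft).card := by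
  simp only [cnt_eq_sum]
  rw [sum_comm, card_filter]
  refine sum_congr rfl fun i _ => ?_
  rcases h i with a | b <;> simp

lemma cnt_join_inl (h₁ : Fin m → J₁) (h₂ : Fin n → J₂) (j : J₁) :
    cnt (LinTree.join h₁ h₂) (Sum.inl j) = cnt h₁ j := by
  rw [cnt, LinTree.fib_join_inl, card_map, cnt]

lemma cnt_join_inr (h₁ : Fin m → J₁) (h₂ : Fin n → J₂) (j : J₂) :
    cnt (LinTree.join h₁ h₂) (Sum.inr j) = cnt h₂ j := by
  rw [cnt, LinTree.fib_join_inr, card_map, cnt]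

/-- There is a function with fibres of given sizes. -/
lemma exists_cnt_eq [Fintype J] (a : J → ℕ) : ∃ h : Fin (∑ j, a j) → J, cnt h = a := by
  let e : Fin (∑ j, a j) ≃ Σ j, Fin (a j) :=
    Fintype.equivOfCardEq (by simp)
  refine ⟨fun i => (e i).1, funext fun j => ?_⟩
  rw [cnt_eq_sum, e.sum_comp fun x : Σ j, Fin (a j) => if x.1 = j then 1 else 0,
    Fintype.sum_sigma, Fintype.sum_eq_single j]
  · simp
  · intro x hx
    simp [hx]

/-- A shuffle is determined by the image of the first `m` elements. -/
lemma eq_of_mem_shuffles {γ : Equiv.Perm (Fin (m + n))} (hγ : γ ∈ shuffles m n)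
    {s : Finset (Fin (m + n))} (hm : #s = m) (hn : #sᶜ = n)
    (h₁ : ∀ i, γ (Fin.castAdd n i) ∈ s) (h₂ : ∀ i, γ (Fin.natAdd m i) ∈ sᶜ) :
    γ = finSumFinEquiv.symm.trans (finSumEquivOfFinset hm hn) := by
  rw [shuffles, mem_filter] at hγ
  refine Equiv.ext fun i => Fin.addCases (fun i => ?_) (fun i => ?_) i
  · have := orderEmbOfFin_unique hm h₁ hγ.2.1
    simpa using congrFun this i
  · have := orderEmbOfFin_unique hn h₂ hγ.2.2
    simpa using congrFun this i

lemma mem_shuffles_of_finset {s : Finset (Fin (m + n))} (hm : #s = m) (hn : #sᶜ = n) :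
    finSumFinEquiv.symm.trans (finSumEquivOfFinset hm hn) ∈ shuffles m n := by
  rw [shuffles, mem_filter]
  refine ⟨mem_univ _, fun i j hij => ?_, fun i j hij => ?_⟩
  · simpa using hij
  · simpa using hij

/-- Every function on `Fin (m + n)` which takes exactly `m` values in `J₁` arises in a unique way
from functions `Fin m → J₁` and `Fin n → J₂` and a shuffle. -/
lemma sum_shuffles [Fintype J₁] [Fintype J₂] {M : Type*} [AddCommMonoid M]
    (φ : (Fin (m + n) → J₁ ⊕ J₂) → M) :
    ∑ h₁ : Fin m → J₁, ∑ h₂ : Fin n → J₂, ∑ γ ∈ shuffles m n,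
        φ (fun i => LinTree.join h₁ h₂ (γ.symm i)) =
      ∑ h with ∑ j, cnt h (Sum.inl j) = m, φ h := by
  simp only [← sum_product']
  have hleft (h₁ : Fin m → J₁) (h₂ : Fin n → J₂) (γ : Equiv.Perm (Fin (m + n))) :
      (∀ i, γ (Fin.castAdd n i) ∈
        univ.filter fun i => (LinTree.join h₁ h₂ (γ.symm i)).isLeft) ∧
      ∀ i, γ (Fin.natAdd m i) ∈
        (univ.filter fun i => (LinTree.join h₁ h₂ (γ.symm i)).isLeft)ᶜ := by
    constructor <;> intro i <;> simp
  have hcard (h₁ : Fin m → J₁) (h₂ : Fin n → J₂) (γ : Equiv.Perm (Fin (m + n))) :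
      ∑ j, cnt (fun i => LinTree.join h₁ h₂ (γ.symm i)) (Sum.inl j) = m := by
    rw [cnt_comp_equiv]
    simp only [cnt_join_inl, sum_cnt]
  refine sum_bij (fun x _ i => LinTree.join x.1 x.2.1 (x.2.2.symm i)) ?_ ?_ ?_ fun _ _ => rfl
  · rintro ⟨h₁, h₂, γ⟩ _
    exact mem_filter.2 ⟨mem_univ _, hcard h₁ h₂ γ⟩
  · rintro ⟨h₁, h₂, γ⟩ hx ⟨h₁', h₂', γ'⟩ hx' heq
    simp only [mem_product, mem_univ, true_and] at hx hx'
    have hm := hcard h₁ h₂ γ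
    rw [sum_cnt_inl] at hm
    have hn := card_compl (univ.filter fun i => (LinTree.join h₁ h₂ (γ.symm i)).isLeft)
    rw [hm, Fintype.card_fin, Nat.add_sub_cancel_left] at hn
    have hl' := hleft h₁' h₂' γ'
    dsimp only at heq
    simp only [← fun i => congrFun heq i] at hl'
    have hγ := eq_of_mem_shuffles hx hm hn (hleft h₁ h₂ γ).1 (hleft h₁ h₂ γ).2
    have hγ' := eq_of_mem_shuffles hx' hm hn hl'.1 hl'.2
    obtain rfl : γ = γ' := hγ.trans hγ'.symm
    have hj : LinTree.join h₁ h₂ = LinTree.join h₁' h₂' := funext fun i => by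
      simpa using congrFun heq (γ i)
    have e₁ : h₁ = h₁' := funext fun i => by simpa using congrFun hj (Fin.castAdd n i)
    have e₂ : h₂ = h₂' := funext fun i => by simpa using congrFun hj (Fin.natAdd m i)
    rw [e₁, e₂]
  · intro h hh
    rw [mem_filter, sum_cnt_inl] at hh
    have hm := hh.2
    have hn := card_compl (univ.filter fun i => (h i).isLeft)
    rw [hm, Fintype.card_fin, Nat.add_sub_cancel_left] at hn
    set γ := finSumFinEquiv.symm.trans (finSumEquivOfFinset hm hn) with hγ
    have hl (i : Fin m) : ∃ j, h (γ (Fin.castAdd n i)) = Sum.inl j := by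
      have : γ (Fin.castAdd n i) ∈ univ.filter fun i => (h i).isLeft := by
        simp only [hγ, Equiv.trans_apply, finSumFinEquiv_symm_apply_castAdd,
          finSumEquivOfFinset_inl, orderEmbOfFin_mem]
      exact Sum.isLeft_iff.1 (mem_filter.1 this).2
    have hr (i : Fin n) : ∃ j, h (γ (Fin.natAdd m i)) = Sum.inr j := by
      have : γ (Fin.natAdd m i) ∈ (univ.filter fun i => (h i).isLeft)ᶜ := by
        simpa only [hγ, Equiv.trans_apply, finSumFinEquiv_symm_apply_natAdd,
          finSumEquivOfFinset_inr] using orderEmbOfFin_mem _ hn i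
      rw [mem_compl, mem_filter] at this
      exact Sum.isRight_iff.1 (by simpa using this)
    choose h₁ hh₁ using hl
    choose h₂ hh₂ using hr
    refine ⟨(h₁, h₂, γ), by simp [hγ, mem_shuffles_of_finset hm hn], funext fun i => ?_⟩
    obtain ⟨i, rfl⟩ := γ.surjective i
    simp only [Equiv.symm_apply_apply]
    refine Fin.addCases (fun i => ?_) (fun i => ?_) i
    · rw [LinTree.join_castAdd, hh₁]
    · rw [LinTree.join_natAdd, hh₂]

/-- The pairs of functions with sum `a`. -/
def pairs [Fintype J] (a : J → ℕ) : Finset ((J → ℕ) × (J → ℕ)) :=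
  (Fintype.piFinset fun j => antidiagonal (a j)).image fun x => (fun j => (x j).1, fun j => (x j).2)

@[simp] lemma mem_pairs [Fintype J] {a : J → ℕ} {x : (J → ℕ) × (J → ℕ)} :
    x ∈ pairs a ↔ x.1 + x.2 = a := by
  simp only [pairs, mem_image, Fintype.mem_piFinset, HasAntidiagonal.mem_antidiagonal]
  constructor
  · rintro ⟨y, hy, rfl⟩
    exact funext hy
  · intro h
    exact ⟨fun j => (x.1 j, x.2 j), fun j => congrFun h j, rfl⟩

end Count

section Dirac

open Finset

/-- The indicator function of `a`. -/
def dirac (k : Type*) [Field k] {I : Type} (a d : I → ℕ) : k :=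
  open scoped Classical in if d = a then 1 else 0

variable {k : Type*} [Field k] {J J₁ J₂ : Type}

lemma dirac_self (a : J → ℕ) : dirac k a a = 1 := by simp [dirac]

lemma dirac_of_ne {a d : J → ℕ} (h : d ≠ a) : dirac k a d = 0 := by simp [dirac, h]

lemma sum_pairs_dirac [Fintype J] [DecidableEq J] (a d d' : J → ℕ) :
    ∑ x ∈ pairs a, dirac k x.1 d * dirac k x.2 d' = dirac k a (d + d') := by
  by_cases h : d + d' = a
  · rw [sum_eq_single_of_mem (d, d') (by simpa using h)]
    · rw [dirac_self, dirac_self, h, dirac_self, one_mul]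
    · rintro ⟨b, c⟩ _ hne
      by_cases hb : d = b
      · have hc : d' ≠ c := by
          rintro rfl
          exact hne (by rw [hb])
        rw [dirac_of_ne hc, mul_zero]
      · rw [dirac_of_ne hb, zero_mul]
  · rw [dirac_of_ne h]
    refine sum_eq_zero fun x hx => ?_
    rw [mem_pairs] at hx
    by_cases hb : d = x.1
    · have hc : d' ≠ x.2 := by
        rintro rfl
        exact h (by rw [hb, hx])
      rw [dirac_of_ne hc, mul_zero]
    · rw [dirac_of_ne hb, zero_mul]

lemma dirac_elim (a : J₁ ⊕ J₂ → ℕ) (d : J₁ ⊕ J₂ → ℕ) :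
    dirac k a d = dirac k (fun j => a (Sum.inl j)) (fun j => d (Sum.inl j)) *
      dirac k (fun j => a (Sum.inr j)) (fun j => d (Sum.inr j)) := by
  by_cases h : d = a
  · subst h; simp [dirac_self]
  · rw [dirac_of_ne h]
    by_cases h₁ : (fun j => d (Sum.inl j)) = fun j => a (Sum.inl j)
    · have h₂ : (fun j => d (Sum.inr j)) ≠ fun j => a (Sum.inr j) := by
        intro h₂
        refine h (funext fun j => ?_)
        rcases j with j | j
        · exact congrFun h₁ j
        · exact congrFun h₂ j
      rw [dirac_of_ne h₂, mul_zero]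
    · rw [dirac_of_ne h₁, zero_mul]

end Dirac

/-! ### Sums of compermutations over functions -/

section FunSum

open Finset

variable {k : Type*} [Field k] {J J' J₁ J₂ : Type} [Fintype J] [Fintype J'] [Fintype J₁]
  [Fintype J₂] [DecidableEq J] [DecidableEq J'] [DecidableEq J₁] [DecidableEq J₂] {m n : ℕ}

/-- The sum of the compermutations with underlying tree `T` of degree `m`, indexed by the functions
`Fin m → J`, with a weight depending only on the sizes of the components. For the weight
`dirac k a` this is the element `D^T_{≤ a}`. -/
def funSum (m : ℕ) (T : LinTree J) (c : (J → ℕ) → k) : KComperm k :=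
  ∑ h : Fin m → J, c (cnt h) • F k (T.comap h)

lemma funSum_congr {T : LinTree J} {c c' : (J → ℕ) → k}
    (h : ∀ f : Fin m → J, c (cnt f) = c' (cnt f)) : funSum m T c = funSum m T c' :=
  sum_congr rfl fun f _ => by rw [h]

lemma funSum_eq_zero {T : LinTree J} {c : (J → ℕ) → k}
    (h : ∀ f : Fin m → J, c (cnt f) = 0) : funSum m T c = 0 :=
  sum_eq_zero fun f _ => by rw [h, zero_smul]

lemma funSum_dirac_eq_zero {T : LinTree J} {a : J → ℕ} (h : m ≠ ∑ j, a j) :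
    funSum m T (dirac k a) = 0 :=
  funSum_eq_zero fun f => dirac_of_ne fun hf => h (by rw [← hf, sum_cnt])

lemma funSum_sum {ι : Type*} (s : Finset ι) (T : LinTree J) (c : ι → (J → ℕ) → k) :
    ∑ x ∈ s, funSum m T (c x) = funSum m T fun d => ∑ x ∈ s, c x d := by
  simp only [funSum, sum_smul]
  exact sum_comm

lemma funSum_mul (T₁ : LinTree J₁) (T₂ : LinTree J₂) (c₁ : (J₁ → ℕ) → k) (c₂ : (J₂ → ℕ) → k) :
    (compermBialg k).mul (funSum m T₁ c₁) (funSum n T₂ c₂) =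
      funSum (m + n) (T₁.sum T₂) fun d => if ∑ j, d (Sum.inl j) = m then
        c₁ (fun j => d (Sum.inl j)) * c₂ (fun j => d (Sum.inr j)) else 0 := by
  simp only [funSum, map_sum, LinearMap.sum_apply, map_smul, LinearMap.smul_apply,
    compermBialg_mul_F, LinTree.graft_comap, Symb.act, LinTree.comap_comap, ite_smul, zero_smul,
    smul_sum]
  rw [← sum_filter, ← sum_shuffles fun h : Fin (m + n) → J₁ ⊕ J₂ =>
    (c₁ (fun j => cnt h (Sum.inl j)) * c₂ (fun j => cnt h (Sum.inr j))) •
      F k ((T₁.sum T₂).comap h), sum_comm]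
  refine sum_congr rfl fun h₁ _ => sum_congr rfl fun h₂ _ =>
    sum_congr rfl fun γ _ => ?_
  rw [cnt_comp_equiv]
  simp only [cnt_join_inl, cnt_join_inr]
  rw [smul_smul, mul_comm]

/-- The comultiplication of `D^T_{≤ a}`. -/
lemma funSum_comul (T : LinTree J) (a : J → ℕ) :
    (compermBialg k).comul (funSum (∑ j, a j) T (dirac k a)) =
      ∑ x ∈ pairs a, funSum (∑ j, x.1 j) T (dirac k x.1) ⊗ₜ[k]
        funSum (∑ j, x.2 j) T (dirac k x.2) := by
  set m := ∑ j, a j with hm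
  -- A function on `Fin m` consists of its restrictions to the first `p` and the last `m - p`
  -- elements.
  have hp (p : Fin (m + 1)) : ∑ h : Fin m → J, dirac k a (cnt h) •
      (F k ((T.comap h).restrictLow p) ⊗ₜ[k] F k ((T.comap h).restrictHigh p)) =
      ∑ x ∈ pairs a, funSum p T (dirac k x.1) ⊗ₜ[k] funSum (m - p) T (dirac k x.2) := by
    let e : Fin p ⊕ Fin (m - p) ≃ Fin m :=
      finSumFinEquiv.trans (finCongr (by have := p.2; omega))
    have he₁ (i : Fin p) : e (Sum.inl i) = Fin.castLE (Nat.lt_succ_iff.1 p.2) i := rfl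
    have he₂ (i : Fin (m - p)) : e (Sum.inr i) = ⟨p + i, by have := i.2; omega⟩ := rfl
    let E : (Fin m → J) ≃ (Fin p → J) × (Fin (m - p) → J) :=
      (Equiv.arrowCongr e.symm (Equiv.refl J)).trans (Equiv.sumArrowEquivProdArrow _ _ _)
    have hE₁ (h : Fin m → J) (i : Fin p) : (E h).1 i = h (e (Sum.inl i)) := rfl
    have hE₂ (h : Fin m → J) (i : Fin (m - p)) : (E h).2 i = h (e (Sum.inr i)) := rfl
    have hcnt (h : Fin m → J) : cnt h = cnt (E h).1 + cnt (E h).2 := by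
      funext j
      rw [Pi.add_apply, cnt_eq_sum, cnt_eq_sum, cnt_eq_sum, ← e.sum_comp, Fintype.sum_sum_type]
      rfl
    have h1 : ∑ h : Fin m → J, dirac k a (cnt h) •
        (F k ((T.comap h).restrictLow p) ⊗ₜ[k] F k ((T.comap h).restrictHigh p)) =
        ∑ h : (Fin p → J) × (Fin (m - p) → J), dirac k a (cnt h.1 + cnt h.2) •
          (F k (T.comap h.1) ⊗ₜ[k] F k (T.comap h.2)) := by
      rw [← E.sum_comp]
      refine sum_congr rfl fun h _ => ?_
      rw [hcnt, Symb.restrictLow, Symb.restrictHigh, LinTree.comap_comap, LinTree.comap_comap]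
      rfl
    rw [h1, Fintype.sum_prod_type]
    have h3 (c c' : (J → ℕ) → k) : funSum p T c ⊗ₜ[k] funSum (m - p) T c' =
        ∑ h₁ : Fin p → J, ∑ h₂ : Fin (m - p) → J, (c (cnt h₁) * c' (cnt h₂)) •
          (F k (T.comap h₁) ⊗ₜ[k] F k (T.comap h₂)) := by
      rw [funSum, funSum, TensorProduct.sum_tmul]
      refine sum_congr rfl fun h₁ _ => ?_
      rw [TensorProduct.tmul_sum]
      exact sum_congr rfl fun h₂ _ => TensorProduct.smul_tmul_smul _ _ _ _
    simp only [h3]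
    symm
    rw [sum_comm]
    refine sum_congr rfl fun h₁ _ => ?_
    rw [sum_comm]
    refine sum_congr rfl fun h₂ _ => ?_
    rw [← sum_smul, sum_pairs_dirac]
  have h2 : (compermBialg k).comul (funSum m T (dirac k a)) = ∑ p : Fin (m + 1),
      ∑ x ∈ pairs a, funSum p T (dirac k x.1) ⊗ₜ[k] funSum (m - p) T (dirac k x.2) := by
    rw [funSum, map_sum]
    simp only [map_smul, compermBialg_comul_F, smul_sum]
    rw [sum_comm]
    exact sum_congr rfl fun p _ => hp p
  rw [h2, sum_comm]
  refine sum_congr rfl fun x hx => ?_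
  rw [mem_pairs] at hx
  have hs : ∑ j, x.1 j + ∑ j, x.2 j = m := by
    rw [hm, ← hx, ← sum_add_distrib]; rfl
  rw [sum_eq_single_of_mem (⟨∑ j, x.1 j, by omega⟩ : Fin (m + 1)) (mem_univ _)]
  · rw [show m - ∑ j, x.1 j = ∑ j, x.2 j by omega]
  · intro p _ hne
    rw [funSum_dirac_eq_zero fun h => hne (Fin.ext h), TensorProduct.zero_tmul]

/-- The product `•` does not see the permutation `σ` which enters its definition, since the sum is
over all functions `h`, and `h ↦ h σ⁻¹` preserves the sizes of the fibres. -/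
lemma bulletMul_funSum (T : LinTree J) (T' : LinTree J') (c : (J → ℕ) → k) (c' : (J' → ℕ) → k) :
    bulletMul k (funSum m T c) (funSum m T' c') = funSum m (T.prod T') fun d =>
      c (fun j => ∑ j', d (j, j')) * c' (fun j' => ∑ j, d (j, j')) := by
  simp only [funSum, map_sum, LinearMap.sum_apply, map_smul, LinearMap.smul_apply, bulletMul_F,
    LinTree.F_bullet_comap]
  have h1 : ∑ h : Fin m → J × J', (c (fun j => ∑ j', cnt h (j, j')) *
      c' (fun j' => ∑ j, cnt h (j, j'))) • F k ((T.prod T').comap h) =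
      ∑ h' : Fin m → J', ∑ h : Fin m → J, (c (cnt h) * c' (cnt h')) •
        F k ((T.prod T').comap fun i => (h i, h' i)) := by
    rw [sum_comm, ← Fintype.sum_prod_type', ← (Equiv.arrowProdEquivProdArrow _ _ _).sum_comp]
    refine sum_congr rfl fun h _ => ?_
    simp only [sum_cnt_fst, sum_cnt_snd]
    rfl
  rw [h1]
  refine sum_congr rfl fun h' _ => ?_
  rw [smul_sum]
  refine Eq.trans ?_ ((Equiv.arrowCongr ((T'.comap h').reduce.symb.perm) (Equiv.refl J)).sum_comp _)
  refine sum_congr rfl fun h _ => ?_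
  have : cnt (Equiv.arrowCongr ((T'.comap h').reduce.symb.perm) (Equiv.refl J) h) = cnt h :=
    cnt_comp_equiv (T'.comap h').reduce.symb.perm.symm h
  rw [this, smul_smul, mul_comm]
  rfl

lemma funSum_bullet (T : LinTree J) (T' : LinTree J') (a : J → ℕ) (b : J' → ℕ) :
    bulletMul k (funSum (∑ j, a j) T (dirac k a)) (funSum (∑ j, b j) T' (dirac k b)) =
      funSum (∑ j, a j) (T.prod T') fun d =>
        dirac k a (fun j => ∑ j', d (j, j')) * dirac k b (fun j' => ∑ j, d (j, j')) := by
  by_cases h : ∑ j, b j = ∑ j, a j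
  · rw [h, bulletMul_funSum]
  · rw [funSum_eq_zero (T := T.prod T') fun f => ?_]
    · rw [funSum, funSum, map_sum]
      simp only [map_sum, LinearMap.sum_apply, map_smul, LinearMap.smul_apply,
        bulletMul_F_of_ne h, smul_zero, sum_const_zero]
    · by_cases hb : (fun j' => ∑ j, cnt f (j, j')) = b
      · refine absurd ?_ h
        rw [← hb, sum_comm, ← Fintype.sum_prod_type' fun j j' => cnt f (j, j'), sum_cnt]
      · rw [dirac_of_ne hb, mul_zero]

end FunSum

/-! ### The nonassociative Solomon descent algebra as an image of the free algebra -/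

section Solomon

open NAlg FreeNA BialgData PTree Finset

variable (k : Type*) [Field k]

/-- The homomorphism from `k{X}` to the algebra of compermutations which maps `x_i` to the class
of the tree with one leaf and the composition `({1, …, i})`. -/
def xi : KX k →ₗ[k] KComperm k :=
  (compermAlg k).ev fun i : ℕ+ => F k (LinTree.single.comap fun _ : Fin i => ())

variable {k}

lemma xi_isHom : NAlg.IsHom (free k ℕ+) (compermAlg k) (xi k) := NAlg.ev_isHom _ _

lemma xi_one : xi k 1 = F k Symb.empty := xi_isHom.map_one

lemma xi_mul (p q : KX k) : xi k (p * q) = (compermBialg k).mul (xi k p) (xi k q) :=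
  xi_isHom.map_mul p q

lemma Symb.pruneLeaf_fib {J : Type} [DecidableEq J] (h : Fin 0 → J) (j : J) :
    Symb.pruneLeaf (fib h j) = 1 := by
  rw [Finset.eq_empty_of_isEmpty (fib _ _), Symb.pruneLeaf_empty]

lemma xi_letter (n : ℕ) :
    xi k (mono k (letter n)) = F k (LinTree.single.comap fun _ : Fin n => ()) := by
  cases n with
  | zero =>
    rw [letter_zero, mono_one, xi_one]
    refine Symb.F_congr ?_
    rw [LinTree.comap_tree, subst_map]
    simp only [Symb.pruneLeaf_fib, subst_const_one]
    rfl
  | succ n => exact NAlg.ev_gen _ _ _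

namespace LinTree

variable {J J' J₁ J₂ : Type}

/-- The word with shape `T` and letters `x_{a j}`, where `x₀ = 1`. -/
def word (T : LinTree J) (a : J → ℕ) : PTree ℕ+ := T.tree.subst fun j => letter (a j)

lemma word_sum (T₁ : LinTree J₁) (T₂ : LinTree J₂) (a : J₁ ⊕ J₂ → ℕ) :
    (T₁.sum T₂).word a = T₁.word (fun j => a (Sum.inl j)) * T₂.word (fun j => a (Sum.inr j)) := by
  rw [word, sum_tree, subst_mul, subst_map, subst_map]
  rfl

variable [DecidableEq J] [DecidableEq J'] [DecidableEq J₁] [DecidableEq J₂]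

lemma F_sum_prod_comap (T₁ : LinTree J₁) (T₂ : LinTree J₂) (T' : LinTree J') {m : ℕ}
    (h : Fin m → (J₁ ⊕ J₂) × J') :
    F k (((T₁.prod T').sum (T₂.prod T')).comap fun i => Equiv.sumProdDistrib J₁ J₂ J' (h i)) =
      F k (((T₁.sum T₂).prod T').comap h) := by
  refine Symb.F_congr ?_
  simp only [comap_tree, sum_tree, prod_tree, subst_map, subst_mul, subst_subst, PTree.map_mul,
    map_subst, PTree.map_map]
  have h₁ (j : J₁) (j' : J') : fib (fun i => Equiv.sumProdDistrib J₁ J₂ J' (h i))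
      (Sum.inl (j, j')) = fib h (Sum.inl j, j') := by
    ext i
    simp only [fib, mem_filter, mem_univ, true_and]
    exact (Equiv.sumProdDistrib J₁ J₂ J').apply_eq_iff_eq (y := (Sum.inl j, j'))
  have h₂ (j : J₂) (j' : J') : fib (fun i => Equiv.sumProdDistrib J₁ J₂ J' (h i))
      (Sum.inr (j, j')) = fib h (Sum.inr j, j') := by
    ext i
    simp only [fib, mem_filter, mem_univ, true_and]
    exact (Equiv.sumProdDistrib J₁ J₂ J').apply_eq_iff_eq (y := (Sum.inr j, j'))
  simp only [h₁, h₂]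

variable [Fintype J] [Fintype J'] [Fintype J₁] [Fintype J₂]

/-- Every word has a shape with leaves labelled bijectively by some `J`, which is built by grafting
from trees with at most one leaf. -/
lemma exists_word_eq {P : ∀ {J : Type} [Fintype J] [DecidableEq J], LinTree J → Prop}
    (h_nil : P LinTree.nil) (h_single : P LinTree.single)
    (h_sum : ∀ {J₁ J₂ : Type} [Fintype J₁] [DecidableEq J₁] [Fintype J₂] [DecidableEq J₂]
      (T₁ : LinTree J₁) (T₂ : LinTree J₂), P T₁ → P T₂ → P (T₁.sum T₂)) (w : PTree ℕ+) :
    ∃ (J : Type) (_ : Fintype J) (_ : DecidableEq J) (T : LinTree J) (a : J → ℕ),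
      (∀ j, 0 < a j) ∧ T.word a = w ∧ P T := by
  induction w using PTree.induction_on with
  | h1 => exact ⟨Empty, inferInstance, inferInstance, nil, fun _ => 0, fun j => j.elim, rfl, h_nil⟩
  | hl x =>
    exact ⟨Unit, inferInstance, inferInstance, single, fun _ => x, fun _ => x.pos, letter_coe x,
      h_single⟩
  | hm u v ihu ihv =>
    obtain ⟨J₁, _, _, T₁, a₁, h₁, rfl, hT₁⟩ := ihu
    obtain ⟨J₂, _, _, T₂, a₂, h₂, rfl, hT₂⟩ := ihv
    refine ⟨J₁ ⊕ J₂, inferInstance, inferInstance, T₁.sum T₂, Sum.elim a₁ a₂, ?_,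
      word_sum _ _ _, h_sum T₁ T₂ hT₁ hT₂⟩
    rintro (j | j)
    · exact h₁ j
    · exact h₂ j

variable (k) in
/-- The formulas for the image in `k[Ϭ]` and for the coproduct of the words of a given shape. Their
arguments `a` may take the value `0`. -/
structure Compatible (T : LinTree J) : Prop where
  xi_word : ∀ a, xi k (mono k (T.word a)) = funSum (∑ j, a j) T (dirac k a)
  comul_word : ∀ a, (symBialg k).comul (mono k (T.word a)) =
    ∑ x ∈ pairs a, mono k (T.word x.1) ⊗ₜ[k] mono k (T.word x.2)
  weight_word : ∀ a, (T.word a).weight = ∑ j, a j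

lemma compatible_nil : Compatible k nil where
  xi_word a := by
    change xi k 1 = _
    rw [xi_one, Fintype.sum_empty, funSum, Fintype.sum_unique,
      show cnt default = a from Subsingleton.elim _ _, dirac_self, one_smul]
    rfl
  comul_word a := by
    rw [show pairs a = {(0, 0)} from by
      ext x; simp [Subsingleton.elim a 0, Subsingleton.elim x (0, 0)]]
    rw [sum_singleton]
    exact (symBialg_isBialgebra (k := k)).comul_one
  weight_word a := rfl

lemma compatible_single : Compatible k single where
  xi_word a := by
    change xi k (mono k (letter (a ()))) = _
    rw [xi_letter, Fintype.sum_unique]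
    change _ = funSum (a ()) _ _
    rw [funSum, Fintype.sum_unique, show cnt (default : Fin (a ()) → Unit) = a from ?_, dirac_self,
      one_smul]
    funext u
    simp [cnt, fib]
  comul_word a := by
    change (symBialg k).comul (mono k (letter (a ()))) = _
    rw [symBialg_comul_letter]
    refine sum_bij' (fun x _ => (fun _ => x.1, fun _ => x.2)) (fun x _ => (x.1 (), x.2 ()))
      ?_ ?_ ?_ ?_ ?_
    · intro x hx
      rw [HasAntidiagonal.mem_antidiagonal] at hx
      exact mem_pairs.2 (funext fun u => hx)
    · intro x hx
      exact HasAntidiagonal.mem_antidiagonal.2 (congrFun (mem_pairs.1 hx) ())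
    · intro x _; rfl
    · intro x _; rfl
    · intro x _; rfl
  weight_word a := by
    change (letter (a ())).weight = a ()
    cases a () with
    | zero => rfl
    | succ n => exact weight_leaf _

lemma Compatible.sum {T₁ : LinTree J₁} {T₂ : LinTree J₂} (h₁ : Compatible k T₁)
    (h₂ : Compatible k T₂) : Compatible k (T₁.sum T₂) where
  xi_word a := by
    rw [word_sum, mono_mul, xi_mul, h₁.xi_word, h₂.xi_word, funSum_mul, Fintype.sum_sum_type]
    refine funSum_congr fun f => ?_
    split_ifs with h
    · rw [dirac_elim a]
    · rw [dirac_of_ne]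
      intro hf
      exact h (sum_congr rfl fun j _ => congrFun hf (Sum.inl j))
  comul_word a := by
    rw [word_sum, mono_mul, ← free_mul, symBialg_comul_isHom.map_mul, h₁.comul_word,
      h₂.comul_word]
    simp only [map_sum, LinearMap.sum_apply, tensor_mul_tmul, free_mul, ← mono_mul]
    rw [sum_comm, ← sum_product']
    refine sum_bij' (fun x _ => (Sum.elim x.1.1 x.2.1, Sum.elim x.1.2 x.2.2))
      (fun x _ => ((fun j => x.1 (Sum.inl j), fun j => x.2 (Sum.inl j)),
        (fun j => x.1 (Sum.inr j), fun j => x.2 (Sum.inr j)))) ?_ ?_ ?_ ?_ ?_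
    · intro x hx
      rw [mem_product, mem_pairs, mem_pairs] at hx
      refine mem_pairs.2 (funext fun j => ?_)
      rcases j with j | j
      · exact congrFun hx.1 j
      · exact congrFun hx.2 j
    · intro x hx
      rw [mem_pairs] at hx
      rw [mem_product, mem_pairs, mem_pairs, ← hx]
      exact ⟨rfl, rfl⟩
    · intro x _; rfl
    · intro x _
      refine Prod.ext (funext fun j => ?_) (funext fun j => ?_) <;> rcases j with j | j <;> rfl
    · intro x _
      rw [word_sum, word_sum]
      rfl
  weight_word a := by
    rw [word_sum, weight_mul, h₁.weight_word, h₂.weight_word, Fintype.sum_sum_type]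

variable (k) in
/-- The compatibility of the inner products for the words of a given shape as first factor. -/
def BulletCompatible (T : LinTree J) : Prop :=
  ∀ {J' : Type} [Fintype J'] [DecidableEq J'] (T' : LinTree J'), Compatible k T' →
    ∀ (a : J → ℕ) (b : J' → ℕ), xi k (inner k (mono k (T.word a)) (mono k (T'.word b))) =
      bulletMul k (funSum (∑ j, a j) T (dirac k a)) (funSum (∑ j, b j) T' (dirac k b))

lemma Compatible.xi_degProj {T : LinTree J} (h : Compatible k T) (n : ℕ) (a : J → ℕ) :
    xi k (degProj k n (mono k (T.word a))) = funSum n T (dirac k a) := by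
  rw [degProj_mono, h.weight_word]
  split_ifs with hn
  · rw [h.xi_word, hn]
  · rw [map_zero, funSum_dirac_eq_zero (Ne.symm hn)]

lemma bulletCompatible_nil : BulletCompatible k nil := fun {J'} _ _ T' hT' a b => by
  change xi k (inner k 1 _) = _
  rw [inner_one, hT'.xi_degProj, funSum_bullet, Fintype.sum_empty, funSum, funSum,
    Fintype.sum_unique, Fintype.sum_unique]
  have h1 : (fun j : Empty => ∑ j', cnt (default : Fin 0 → Empty × J') (j, j')) = a :=
    Subsingleton.elim _ _
  have h2 : (fun j' => ∑ j, cnt (default : Fin 0 → Empty × J') (j, j')) =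
      cnt (default : Fin 0 → _) := by
    funext j'
    simp [cnt, fib]
  rw [h1, h2, dirac_self, one_mul]
  congr 1
  refine Symb.F_congr ?_
  rw [comap_tree, comap_tree, subst_map, subst_map, prod_tree, subst_subst]
  simp only [Symb.pruneLeaf_fib, subst_const_one]

lemma bulletCompatible_single : BulletCompatible k single := fun {J'} _ _ T' hT' a b => by
  have h1 : inner k (mono k (single.word a)) = degProj k (a ()) := by
    change inner k (mono k (letter (a ()))) = _
    cases a () with
    | zero => rw [letter_zero, mono_one, inner_one]
    | succ n => exact inner_gen _
  rw [h1, hT'.xi_degProj, funSum_bullet, Fintype.sum_unique]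
  change _ = funSum (a ()) _ _
  rw [funSum, funSum, ← (Equiv.arrowCongr (Equiv.refl (Fin (a ())))
    (Equiv.punitProd J').symm).sum_comp]
  refine sum_congr rfl fun h _ => ?_
  have h2 : (Equiv.arrowCongr (Equiv.refl (Fin (a ()))) (Equiv.punitProd J').symm) h =
    fun i => ((), h i) := rfl
  rw [h2]
  simp only [sum_cnt_fst, sum_cnt_snd]
  rw [show cnt (fun _ : Fin (a ()) => ()) = a from ?_, dirac_self, one_mul]
  · congr 1
    refine Symb.F_congr ?_
    rw [comap_tree, comap_tree, subst_map, subst_map, prod_tree, subst_subst]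
    change _ = PTree.subst _ (PTree.map _ _)
    rw [subst_map]
    congr 1
    funext j
    congr 1
    ext i
    simp [fib]
  · funext u
    simp [cnt, fib]

/-- The splitting rule `(p p') • q = ∑ (p • q₍₁₎) (p' • q₍₂₎)` for compermutations. -/
lemma BulletCompatible.sum {T₁ : LinTree J₁} {T₂ : LinTree J₂} (h₁ : BulletCompatible k T₁)
    (h₂ : BulletCompatible k T₂) : BulletCompatible k (T₁.sum T₂) := fun {J'} _ _ T' hT' a b => by
  set a₁ : J₁ → ℕ := fun j => a (Sum.inl j) with ha₁
  set a₂ : J₂ → ℕ := fun j => a (Sum.inr j) with ha₂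
  have hL : xi k (inner k (mono k ((T₁.sum T₂).word a)) (mono k (T'.word b))) =
      ∑ x ∈ pairs b, (compermBialg k).mul
        (funSum (∑ j, a₁ j) (T₁.prod T') fun d =>
          dirac k a₁ (fun j => ∑ j', d (j, j')) * dirac k x.1 (fun j' => ∑ j, d (j, j')))
        (funSum (∑ j, a₂ j) (T₂.prod T') fun d =>
          dirac k a₂ (fun j => ∑ j', d (j, j')) * dirac k x.2 (fun j' => ∑ j, d (j, j'))) := by
    rw [word_sum, mono_mul, inner_mul, conv, LinearMap.comp_apply, LinearMap.comp_apply,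
      hT'.comul_word]
    simp only [map_sum, TensorProduct.map_tmul, TensorProduct.lift.tmul]
    refine sum_congr rfl fun x _ => ?_
    rw [← funSum_bullet, ← funSum_bullet, ← h₁ T' hT', ← h₂ T' hT', ← xi_mul]
    rfl
  rw [hL, funSum_bullet]
  simp only [funSum_mul]
  rw [funSum_sum, Fintype.sum_sum_type, funSum, funSum,
    ← (Equiv.arrowCongr (Equiv.refl (Fin (∑ j, a₁ j + ∑ j, a₂ j)))
      (Equiv.sumProdDistrib J₁ J₂ J')).sum_comp]
  refine sum_congr rfl fun h _ => ?_
  have hE : (Equiv.arrowCongr (Equiv.refl (Fin (∑ j, a₁ j + ∑ j, a₂ j)))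
      (Equiv.sumProdDistrib J₁ J₂ J')) h = fun i => Equiv.sumProdDistrib J₁ J₂ J' (h i) := rfl
  rw [hE, F_sum_prod_comap]
  congr 1
  have hl (j : J₁) (j' : J') : cnt (fun i => Equiv.sumProdDistrib J₁ J₂ J' (h i))
      (Sum.inl (j, j')) = cnt h (Sum.inl j, j') :=
    cnt_equiv_comp (Equiv.sumProdDistrib J₁ J₂ J') h (Sum.inl j, j')
  have hr (j : J₂) (j' : J') : cnt (fun i => Equiv.sumProdDistrib J₁ J₂ J' (h i))
      (Sum.inr (j, j')) = cnt h (Sum.inr j, j') :=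
    cnt_equiv_comp (Equiv.sumProdDistrib J₁ J₂ J') h (Sum.inr j, j')
  simp only [Fintype.sum_prod_type, hl, hr]
  rw [dirac_elim a]
  by_cases hd₁ : (fun j => ∑ j', cnt h (Sum.inl j, j')) = a₁
  · have hs : ∑ j, ∑ j', cnt h (Sum.inl j, j') = ∑ j, a₁ j :=
      sum_congr rfl fun j _ => congrFun hd₁ j
    simp only [hs, if_true]
    have hb : (fun j' => ∑ j, cnt h (j, j')) =
        (fun j' => ∑ j, cnt h (Sum.inl j, j')) + fun j' => ∑ j, cnt h (Sum.inr j, j') :=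
      funext fun j' => Fintype.sum_sum_type _
    rw [hb, ← sum_pairs_dirac, mul_sum]
    refine sum_congr rfl fun x _ => ?_
    ring
  · rw [dirac_of_ne hd₁]
    simp

end LinTree

/-- The image of a word in `k[Ϭ]`, the coproduct of a word, and the compatibility of the inner
products, for a suitable shape of the word. -/
lemma exists_compatible (w : PTree ℕ+) :
    ∃ (J : Type) (_ : Fintype J) (_ : DecidableEq J) (T : LinTree J) (a : J → ℕ),
      (∀ j, 0 < a j) ∧ T.word a = w ∧ T.Compatible k ∧ T.BulletCompatible k :=
  LinTree.exists_word_eq (P := fun T => T.Compatible k ∧ T.BulletCompatible k)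
    ⟨LinTree.compatible_nil, LinTree.bulletCompatible_nil⟩
    ⟨LinTree.compatible_single, LinTree.bulletCompatible_single⟩
    (fun _ _ h₁ h₂ => ⟨h₁.1.sum h₂.1, LinTree.BulletCompatible.sum h₁.2 h₂.2⟩) w

/-- The isomorphism `xi` carries the inner product of `k{X}` to the product `•`. -/
lemma xi_inner (p q : KX k) : xi k (inner k p q) = bulletMul k (xi k p) (xi k q) := by
  have : (inner k).compr₂ (xi k) = (bulletMul k).compl₁₂ (xi k) (xi k) := by
    refine hom_ext fun w => hom_ext fun v => ?_
    obtain ⟨J, _, _, T, a, -, rfl, hT, hT'⟩ := exists_compatible (k := k) w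
    obtain ⟨J', _, _, T', b, -, rfl, hS, -⟩ := exists_compatible (k := k) v
    rw [LinearMap.compr₂_apply, LinearMap.compl₁₂_apply, hT.xi_word, hS.xi_word, hT' T' hS]
  exact LinearMap.congr_fun (LinearMap.congr_fun this p) q

lemma xi_isBialgHom : (symBialg k).IsHom (compermBialg k) (xi k) where
  map_one := xi_one
  map_mul := xi_mul
  map_comul u := by
    have : (compermBialg k).comul ∘ₗ xi k =
        TensorProduct.map (xi k) (xi k) ∘ₗ (symBialg k).comul := by
      refine FreeNA.hom_ext (k := k) (X := ℕ+) (V := KComperm k ⊗[k] KComperm k) fun w => ?_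
      obtain ⟨J, _, _, T, a, -, rfl, hT, -⟩ := exists_compatible (k := k) w
      change (compermBialg k).comul (xi k _) =
        TensorProduct.map (xi k) (xi k) ((symBialg k).comul _)
      rw [hT.xi_word, hT.comul_word, funSum_comul, map_sum]
      refine sum_congr rfl fun x _ => ?_
      rw [TensorProduct.map_tmul, hT.xi_word, hT.xi_word]
    exact LinearMap.congr_fun this u
  map_counit u := by
    have : (compermBialg k).counit ∘ₗ xi k = (symBialg k).counit := by
      refine hom_ext fun w => ?_
      change (compermBialg k).counit (xi k _) = _
      rw [symBialg, counit_eq_ite]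
      split_ifs with h
      · rw [eq_one_of_weight_eq_zero h, mono_one, xi_one, compermBialg_counit_F, if_pos rfl]
      · obtain ⟨J, _, _, T, a, -, rfl, hT, -⟩ := exists_compatible (k := k) w
        rw [hT.weight_word] at h
        rw [hT.xi_word, funSum, map_sum]
        simp only [map_smul, compermBialg_counit_F, if_neg h, smul_zero, sum_const_zero]
    exact LinearMap.congr_fun this u

variable (k) in
/-- The linear map which sends a compermutation to its type, as a word in `x₁, x₂, …`. -/
def typeMap : KComperm k →ₗ[k] KX k :=
  Finsupp.linearCombination k fun c => mono k (c.2.symb.tree.subst fun A => letter A.card)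

lemma typeMap_F {m : ℕ} (s : Symb m) :
    typeMap k (F k s) = mono k (s.tree.subst fun A => letter A.card) := by
  rw [typeMap, F, Finsupp.linearCombination_single, one_smul, Symb.reduce_tree,
    Symb.subst_prune (by simp)]

lemma typeMap_xi [CharZero k] (w : PTree ℕ+) :
    ∃ N : k, N ≠ 0 ∧ typeMap k (xi k (mono k w)) = N • mono k w := by
  obtain ⟨J, _, _, T, a, -, rfl, hT, -⟩ := exists_compatible (k := k) w
  obtain ⟨h, hh⟩ := exists_cnt_eq a
  refine ⟨((univ.filter fun f : Fin (∑ j, a j) → J => cnt f = a).card : k), ?_, ?_⟩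
  · exact_mod_cast (card_pos.2 ⟨h, by simpa using hh⟩).ne'
  · rw [hT.xi_word, funSum, map_sum, Nat.cast_smul_eq_nsmul, ← sum_const, sum_filter]
    refine sum_congr rfl fun f _ => ?_
    rw [map_smul, typeMap_F, LinTree.comap_tree, subst_map]
    split_ifs with hf
    · rw [hf, dirac_self, one_smul, LinTree.word]
      simp only [← fun j => congrFun hf j]
      rfl
    · rw [dirac_of_ne hf, zero_smul]

lemma xi_injective [CharZero k] : Function.Injective (xi k) := by
  choose N hN0 hN using typeMap_xi (k := k)
  have key (p : KX k) (w : PTree ℕ+) : (typeMap k (xi k p)).coeff w = N w * p.coeff w := by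
    induction p using FreeNA.induction_on with
    | hw v =>
      rw [hN]
      by_cases h : v = w
      · subst h; simp
      · simp [h]
    | h0 => simp
    | hadd a b ha hb => simp [ha, hb, mul_add]
    | hs c a ha => simp [ha, mul_left_comm]
  rw [injective_iff_map_eq_zero]
  intro p hp
  ext w
  have := key p w
  rw [hp, map_zero] at this
  simpa [hN0 w] using this.symm

/-! ### The basis of the Solomon algebra -/

lemma exists_map_eq_of_nodup {α β : Type*} [Inhabited β] :
    ∀ (l : List α) (l' : List β), l.Nodup → l.length = l'.length → ∃ f : α → β, l.map f = l' := by
  classical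
  intro l
  induction l with
  | nil => intro l' _ h; exact ⟨fun _ => default, (List.length_eq_zero_iff.1 h.symm).symm⟩
  | cons a l ih =>
    intro l' hl h
    obtain ⟨b, l', rfl⟩ := List.exists_cons_of_length_eq_add_one h.symm
    obtain ⟨f, rfl⟩ := ih l' (List.nodup_cons.1 hl).2 (by simpa using h)
    refine ⟨Function.update f a b, ?_⟩
    rw [List.map_cons, Function.update_self]
    congr 1
    refine List.map_congr_left fun x hx => ?_
    rw [Function.update_of_ne]
    rintro rfl
    exact (List.nodup_cons.1 hl).1 hx

/-- The element `D^t_{≤ I}` as a sum over functions. -/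
lemma D_eq_funSum {J : Type} [Fintype J] [DecidableEq J] (T : LinTree J) (a : J → ℕ)
    (ha : ∀ j, 0 < a j) {I : List ℕ} (hI : T.tree.leaves.map a = I) :
    D k T.tree.shape I = funSum I.sum T (dirac k a) := by
  classical
  have hfun : funSum I.sum T (dirac k a) =
      ∑ h with cnt h = a, F k (T.comap (m := I.sum) h) := by
    rw [sum_filter]
    refine sum_congr rfl fun h _ => ?_
    split_ifs with hh
    · rw [hh, dirac_self, one_smul]
    · rw [dirac_of_ne hh, zero_smul]
  have hred {h : Fin I.sum → J} (hh : cnt h = a) :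
      ∀ A ∈ (T.comap h).tree.leaves, A.Nonempty := by
    intro A hA
    rw [LinTree.comap_tree, leaves_map] at hA
    obtain ⟨j, -, rfl⟩ := List.mem_map.1 hA
    rw [← card_pos]
    change 0 < cnt h j
    rw [hh]
    exact ha j
  rw [hfun, D]
  symm
  refine sum_bij (fun h hh => (⟨T.comap h, hred (mem_filter.1 hh).2⟩ : Comperm _)) ?_ ?_ ?_
    fun _ _ => rfl
  · intro h hh
    refine (Set.Finite.mem_toFinset _).2 ⟨?_, ?_⟩
    · exact shape_map _ _
    · rw [LinTree.comap_tree, leaves_map, List.map_map]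
      exact Eq.trans (List.map_congr_left fun j _ => congrFun (mem_filter.1 hh).2 j) hI
  · intro h hh h' hh' heq
    have ht : (T.comap h).tree = (T.comap h').tree := congrArg (fun c => c.symb.tree) heq
    have hl := congrArg leaves ht
    rw [LinTree.comap_tree, LinTree.comap_tree, leaves_map, leaves_map, List.map_inj_left] at hl
    funext i
    have hi : i ∈ fib h (h i) := by simp [fib]
    rw [hl _ (T.mem_leaves _)] at hi
    exact (mem_filter.1 hi).2.symm
  · intro c hc
    obtain ⟨hc₁, hc₂⟩ := (Set.Finite.mem_toFinset _).1 hc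
    obtain ⟨f, hf⟩ := exists_map_eq_of_nodup T.tree.leaves c.symb.tree.leaves T.nodup (by
      rw [← length_leaves_shape, ← hc₁, length_leaves_shape])
    have hcT : c.symb.tree = T.tree.map f :=
      ext_shape_leaves _ _ (by rw [hc₁, shape_map]) (by rw [leaves_map, hf])
    have hex (i : Fin I.sum) : ∃ j, ∀ j', i ∈ f j' ↔ j = j' := by
      have h1 := c.symb.mem_one i
      rw [← hf, List.countP_map, List.countP_eq_length_filter, List.length_eq_one_iff] at h1
      obtain ⟨j, hj⟩ := h1
      refine ⟨j, fun j' => ?_⟩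
      have : j' ∈ T.tree.leaves.filter ((fun A => decide (i ∈ A)) ∘ f) ↔ j' ∈ [j] := by rw [hj]
      simpa [T.mem_leaves, eq_comm] using this
    choose h hh using hex
    have hfib : fib h = f := by
      funext j
      ext i
      simp [fib, hh]
    have hcnt : cnt h = a := by
      have hc₂ := hc₂.trans hI.symm
      rw [← hf, List.map_map, List.map_inj_left] at hc₂
      funext j
      rw [cnt, hfib]
      exact hc₂ j (T.mem_leaves j)
    exact ⟨h, by simpa using hcnt, Comperm.ext (Symb.ext (by
      rw [LinTree.comap_tree, hfib, hcT]))⟩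

lemma xi_mono (w : PTree ℕ+) :
    xi k (mono k w) = D k w.shape (w.leaves.map fun i : ℕ+ => (i : ℕ)) := by
  obtain ⟨J, _, _, T, a, ha, rfl, hT, -⟩ := exists_compatible (k := k) w
  obtain ⟨p, hp⟩ : ∃ p : J → ℕ+, ∀ j, (p j : ℕ) = a j := ⟨fun j => ⟨a j, ha j⟩, fun _ => rfl⟩
  have hw : T.word a = T.tree.map p := by
    rw [LinTree.word, PTree.map]
    congr 1
    funext j
    rw [← hp, letter_coe]
  have hshape : (T.word a).shape = T.tree.shape := by rw [hw, shape_map]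
  have hleaves : T.tree.leaves.map a = (T.word a).leaves.map fun i : ℕ+ => (i : ℕ) := by
    rw [hw, leaves_map, List.map_map]
    exact List.map_congr_left fun j _ => (hp j).symm
  rw [hT.xi_word, hshape, D_eq_funSum T a ha hleaves, ← hT.weight_word]
  rfl

/-- The image of `xi` is the nonassociative Solomon descent algebra. -/
lemma range_xi : LinearMap.range (xi k) = sol k := by
  refine le_antisymm ?_ (Submodule.span_le.2 ?_)
  · rintro _ ⟨p, rfl⟩
    induction p using FreeNA.induction_on with
    | hw w =>
      rw [xi_mono]
      refine Submodule.subset_span ⟨_, _, ?_, ?_, rfl⟩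
      · intro i hi
        obtain ⟨j, -, rfl⟩ := List.mem_map.1 hi
        exact j.pos
      · rw [length_leaves_shape, List.length_map]
    | h0 => rw [map_zero]; exact zero_mem _
    | hadd a b ha hb => rw [map_add]; exact add_mem ha hb
    | hs c a ha => rw [map_smul]; exact Submodule.smul_mem _ _ ha
  · rintro _ ⟨t, I, hI, hlen, rfl⟩
    obtain ⟨l, rfl⟩ : ∃ l : List ℕ+, l.map (fun i : ℕ+ => (i : ℕ)) = I := by
      clear hlen
      induction I with
      | nil => exact ⟨[], rfl⟩
      | cons i I ih =>
        obtain ⟨l, hl⟩ := ih fun j hj => hI j (List.mem_cons_of_mem _ hj)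
        exact ⟨⟨i, hI i List.mem_cons_self⟩ :: l, congrArg (i :: ·) hl⟩
    obtain ⟨w, rfl, rfl⟩ := exists_shape_leaves t l (by simpa using hlen)
    exact ⟨mono k w, xi_mono w⟩

variable (k) in
/-- The identification of the nonassociative Solomon descent algebra with the free algebra. -/
def xiEquiv [CharZero k] : KX k ≃ₗ[k] sol k :=
  (LinearEquiv.ofInjective (xi k) xi_injective).trans (LinearEquiv.ofEq _ _ range_xi)

lemma xiEquiv_apply [CharZero k] (p : KX k) : (xiEquiv k p : KComperm k) = xi k p := rfl

end Solomon

/-! ### The three bialgebras -/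

section Bialgebras

open NAlg FreeNA BialgData PTree

variable (k : Type*) [Field k] [CharZero k]

/-- The bialgebra structure of the descent algebra, transported from `symBialg k`. -/
def descentBialg : BialgData k (descentAlgebra k) := (symBialg k).transport (thetaEquiv k)

/-- The bialgebra structure of the nonassociative Solomon descent algebra, transported from
`symBialg k`. -/
def solBialg : BialgData k (sol k) := (symBialg k).transport (xiEquiv k)

variable {k}

lemma thetaEquiv_isHom : (symBialg k).IsHom (descentBialg k) (thetaEquiv k).toLinearMap :=
  transport_isHom _ _

lemma xiEquiv_isHom : (symBialg k).IsHom (solBialg k) (xiEquiv k).toLinearMap :=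
  transport_isHom _ _

lemma solBialg_isHom_subtype : (solBialg k).IsHom (compermBialg k) (sol k).subtype := by
  have h := xi_isBialgHom.comp (xiEquiv_isHom (k := k)).symm
  have hs : xi k ∘ₗ (xiEquiv k).symm.toLinearMap = (sol k).subtype := by
    refine LinearMap.ext fun a => ?_
    change xi k ((xiEquiv k).symm a) = a
    rw [← xiEquiv_apply, LinearEquiv.apply_symm_apply]
  rwa [hs] at h

lemma descentBialg_mul (f h : descentAlgebra k) :
    ((descentBialg k).mul f h : KX k →ₗ[k] KX k) = (kxBialg k).conv f h := by
  obtain ⟨p, rfl⟩ := (thetaEquiv k).surjective f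
  obtain ⟨q, rfl⟩ := (thetaEquiv k).surjective h
  rw [descentBialg, transport_mul, LinearEquiv.symm_apply_apply, LinearEquiv.symm_apply_apply,
    thetaEquiv_apply, thetaEquiv_apply, thetaEquiv_apply]
  exact theta_mul p q

lemma thetaEquiv_letter (n : ℕ) : thetaEquiv k (mono k (letter n)) = degProjMem k n :=
  Subtype.ext (theta_letter n)

lemma descentBialg_comul (m : ℕ) : (descentBialg k).comul (degProjMem k m) =
    ∑ ij ∈ Finset.HasAntidiagonal.antidiagonal m,
      degProjMem k ij.1 ⊗ₜ[k] degProjMem k ij.2 := by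
  rw [← thetaEquiv_letter, descentBialg, transport_comul, LinearEquiv.symm_apply_apply,
    symBialg_comul_letter, map_sum]
  refine Finset.sum_congr rfl fun ij _ => ?_
  rw [TensorProduct.map_tmul, ← thetaEquiv_letter, ← thetaEquiv_letter]
  rfl

/-- The isomorphism `k{X} ≅ Σ` defined by a base for logarithms. -/
lemma IsLogBase.exists_equiv {g : ℕ → FreeNA k Unit} (hg : IsLogBase g) :
    ∃ L : KX k →ₗ[k] KX k, (∀ L', IsConvLog g L' ↔ L' = L) ∧
      ∃ φ : KX k ≃ₗ[k] descentAlgebra k, (kxBialg k).IsHom (descentBialg k) φ.toLinearMap ∧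
        ∀ i : ℕ+, (φ (FreeNA.gen k i) : KX k →ₗ[k] KX k) = degProj k i ∘ₗ convEval (g 1) L := by
  obtain ⟨c, l, e, hc, hl0, hl, hlh, he, hei⟩ := hg.exists_log_generators
  obtain ⟨L, hL, hLi⟩ := hg.exists_convLog hl0 hl hlh
  refine ⟨L, hL, e.trans (thetaEquiv k), thetaEquiv_isHom.comp he, fun i => ?_⟩
  have h1 : convEval (g 1) L = c • L := by
    change (convKX k).ev (fun _ => L) (g 1) = _
    rw [hc, map_smul, ev_gen]
  rw [h1, LinearEquiv.trans_apply, hei, thetaEquiv_apply, map_smul, ← hLi, LinearMap.comp_smul]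

lemma bulletMul_mem_sol (a b : sol k) : bulletMul k a b ∈ sol k := by
  obtain ⟨p, rfl⟩ := (xiEquiv k).surjective a
  obtain ⟨q, rfl⟩ := (xiEquiv k).surjective b
  rw [xiEquiv_apply, xiEquiv_apply, ← xi_inner, ← xiEquiv_apply]
  exact SetLike.coe_mem _

/-- The isomorphism `sol(Ϭ) ≅ Σ` carries `•` to composition, since both correspond to `inner k`. -/
lemma thetaEquiv_xiEquiv_symm_bulletMul (a b : sol k) :
    (thetaEquiv k ((xiEquiv k).symm ⟨bulletMul k a b, bulletMul_mem_sol a b⟩) : KX k →ₗ[k] KX k) =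
      (thetaEquiv k ((xiEquiv k).symm a) : KX k →ₗ[k] KX k) ∘ₗ
        (thetaEquiv k ((xiEquiv k).symm b) : KX k →ₗ[k] KX k) := by
  obtain ⟨p, rfl⟩ := (xiEquiv k).surjective a
  obtain ⟨q, rfl⟩ := (xiEquiv k).surjective b
  have h : (⟨bulletMul k (xiEquiv k p) (xiEquiv k q), bulletMul_mem_sol _ _⟩ : sol k) =
      xiEquiv k (inner k p q) := Subtype.ext (xi_inner p q).symm
  rw [h]
  simp only [LinearEquiv.symm_apply_apply, thetaEquiv_apply, theta_inner]

end Bialgebras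

end NonassocDescent

end

open scoped TensorProduct in
open NonassocDescent in
theorem mainTheorem6 (k : Type*) [Field k] [CharZero k] :
    ∃ (S : BialgData k (sol k)) (E : BialgData k (descentAlgebra k)),
      -- `sol(Ϭ)` is a subbialgebra of `k[Ϭ]`, with the operations `S`
      S.IsBialgebra ∧ S.IsHom (compermBialg k) (sol k).subtype ∧
      -- `E` is the bialgebra `(Σ, *, Δ)`: `*` is the convolution product, and `Δ` is the
      -- comultiplication with `Δ(I_m) = ∑ I_i ⊗ I_j`, which is the one induced from `k{X}` by the
      -- isomorphism `x_i ↦ e¹_i = I_i ∘ g₁^*(log_g^*(Id))`, for every base for logarithms `g`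
      E.IsBialgebra ∧
      (∀ f h : descentAlgebra k,
        (E.mul f h : KX k →ₗ[k] KX k) = (kxBialg k).conv f h) ∧
      (∀ m, E.comul (degProjMem k m) =
        ∑ ij ∈ Finset.HasAntidiagonal.antidiagonal m,
          degProjMem k ij.1 ⊗ₜ[k] degProjMem k ij.2) ∧
      (∀ g : ℕ → FreeNA k Unit, IsLogBase g →
        ∃ L : KX k →ₗ[k] KX k, (∀ L', IsConvLog g L' ↔ L' = L) ∧
          ∃ φ : KX k ≃ₗ[k] descentAlgebra k, (kxBialg k).IsHom E φ.toLinearMap ∧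
            ∀ i : ℕ+, (φ (FreeNA.gen k i) : KX k →ₗ[k] KX k) =
              degProj k i ∘ₗ convEval (g 1) L) ∧
      -- `(Σ, *, Δ) ≅ (k{X}, *, Δ)`
      (∃ θ : descentAlgebra k ≃ₗ[k] KX k, E.IsHom (kxBialg k) θ.toLinearMap) ∧
      -- `(sol(Ϭ), *, Δ) ≅ (Σ, *, Δ)`, and the same map is `(sol(Ϭ), •) ≅ (Σ, ∘)`
      ∃ ψ : sol k ≃ₗ[k] descentAlgebra k, S.IsHom E ψ.toLinearMap ∧
        ∀ a b : sol k, ∃ h : bulletMul k a b ∈ sol k,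
          (ψ ⟨bulletMul k a b, h⟩ : KX k →ₗ[k] KX k) =
            (ψ a : KX k →ₗ[k] KX k) ∘ₗ (ψ b : KX k →ₗ[k] KX k) := by
  obtain ⟨-, -, φ, hφ, -⟩ := (expSeries_isLogBase (k := k)).exists_equiv
  exact ⟨solBialg k, descentBialg k, symBialg_isBialgebra.of_equiv _ xiEquiv_isHom,
    solBialg_isHom_subtype, symBialg_isBialgebra.of_equiv _ thetaEquiv_isHom, descentBialg_mul,
    descentBialg_comul, fun g hg => hg.exists_equiv, ⟨φ.symm, hφ.symm⟩,
    (xiEquiv k).symm.trans (thetaEquiv k), thetaEquiv_isHom.comp xiEquiv_isHom.symm,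
    fun a b => ⟨bulletMul_mem_sol a b, thetaEquiv_xiEquiv_symm_bulletMul a b⟩⟩
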